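/- Let $\mathbb{F}_q$ be a finite field, $A=\mathbb{F}_q[\theta]$, $K=\mathbb{F}_q(\theta)$, and let $A_+\subset A$ be the set of monic polynomials. Let $z$ be a further variable, $\mathbb{T}_z(K_\infty)=\mathbb{F}_q[z]((\theta^{-1}))\subset \mathbb{K}_\infty=\mathbb{F}_q(z)((\theta^{-1}))$ with the $\theta^{-1}$-adic (Gauss norm) topology; for $a\in A$ write $a(z)=a|_{\theta=z}$. Let $$\phi_t=\theta+\kappa_1\tau+\cdots+\kappa_r\tau^r,\qquad \psi_t=\theta+\eta_1\tau+\cdots+\eta_\ell\tau^\ell\qquad(\kappa_i,\eta_j\in A)$$ be Drinfeld modules $\mathbb{F}_q[t]\to A[\tau]$ of ranks $r\neq\ell$, $r,\ell\ge 2$, with everywhere good reduction, i.e. $\kappa_r,\eta_\ell\in\mathbb{F}_q^\times$. Set $\chi_\phi(a)=((-1)^{r+1}\kappa_r)^{\deg a}$, $\chi_\psi(a)=((-1)^{\ell+1}\eta_\ell)^{\deg a}$ and $\overline{\chi}_\psi=\chi_\psi^{-1}$. For $f\in A_+$ irreducible of degree $d$, let $P_{\phi,f}(X)\in A[X]$ be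 the characteristic polynomial of the $q^d$-power Frobenius $\tau^d$ on the $\lambda$-adic Tate module of the reduction of $\phi$ modulo $f$ (with $t=\theta$; $\lambda\in\mathbb{F}_q[t]$ is monic irreducible with $\lambda(\theta)\ne f$, and the polynomial does not depend on $\lambda$), and let $P_{\phi,f}^\vee(X)\in K[X]$ be that of $\tau^d$ on the dual Tate module (on which $\tau^d$ acts contragrediently); similarly for $\psi$, and $P_{\psi,f(z)}=P_{\psi,f}|_{\theta=z}$. For monic polynomials $P=\prod_i(X-x_i)$ and $Q=\prod_j(X-y_j)$ put $P\otimes Q=\prod_{i,j}(X-x_iy_j)$, let $\mathbf{Q}_f^\vee(X)$ be the reciprocal polynomial of $\mathbf{P}_f^\vee=P_{\phi,f}^\vee\otimes P_{\psi,f(z)}\in K[z][X]$, and for an integer $s\ge 0$ define $$L(\mathbb{E}(\phi\times\psi)^\vee,s)=\prod_{f\in A_+\text{ irreducible}}\mathbf{Q}_f^\vee(f^{-s})^{-1}.$$ For $n\ge2$ and $k_1,\dots,k_{n-1}\ge 0$ let $S_{k_1,\dots,k_{n-1}}(x_1,\dots,x_n)\in\mathbb{Z}[x_1,\dots,x_n]$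 be the Schur polynomial of the partition $(k_1+\cdots+k_{n-1},\,k_2+\cdots+k_{n-1},\,\dots,\,k_{n-1},\,0)$. With $\alpha_1,\dots,\alpha_r$ the roots of $P^\vee_{\phi,f}$ in $\overline{K}$, define $$\boldsymbol{\mu}_{\phi,\theta}(f^{k_1},\dots,f^{k_{r-1}})=S_{k_1,\dots,k_{r-1}}(\alpha_1,\dots,\alpha_r)\,f^{k_1+\cdots+k_{r-1}},\qquad \boldsymbol{\nu}_{\phi,\theta}(f^{k_1},\dots,f^{k_{r-1}})=S_{k_1,\dots,k_{r-1}}(\alpha_1^{-1},\dots,\alpha_r^{-1}),$$ elements of $A$, and extend both to functions $(A_+)^{r-1}\to A$ multiplicatively, i.e. $\boldsymbol{\mu}_{\phi,\theta}(a_1,\dots,a_{r-1})=\prod_f\boldsymbol{\mu}_{\phi,\theta}(f^{v_f(a_1)},\dots,f^{v_f(a_{r-1})})$, and likewise for $\boldsymbol{\nu}_{\phi,\theta}$. Define $\boldsymbol{\nu}_{\psi,\theta}:(A_+)^{\ell-1}\to A$ in the same way and put $\boldsymbol{\nu}_{\psi,z}=\boldsymbol{\nu}_{\psi,\theta}|_{\theta=z}$.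 If $r<\ell$, set $$L(\boldsymbol{\mu}_{\phi,\theta}\times\boldsymbol{\nu}_{\psi,z},s)=\sum_{a_1,\dots,a_r\in A_+}\frac{\chi_\phi(a_r)\,\boldsymbol{\mu}_{\phi,\theta}(a_1,\dots,a_{r-1})\,\boldsymbol{\nu}_{\psi,z}(a_1,\dots,a_r,1,\dots,1)}{a_1\cdots a_r\,(a_1a_2^2\cdots a_r^r)^s},$$ and if $r>\ell$, set $$L(\boldsymbol{\mu}_{\phi,\theta}\times\boldsymbol{\nu}_{\psi,z},s)=\sum_{a_1,\dots,a_\ell\in A_+}\frac{\overline{\chi}_\psi(a_\ell)\,a_\ell(z)\,\boldsymbol{\mu}_{\phi,\theta}(a_1,\dots,a_\ell,1,\dots,1)\,\boldsymbol{\nu}_{\psi,z}(a_1,\dots,a_{\ell-1})}{a_1\cdots a_\ell\,(a_1a_2^2\cdots a_\ell^\ell)^s}.$$ Then for every integer $s\ge0$ the product and the series converge in $\mathbb{T}_z(K_\infty)$, and $$L(\mathbb{E}(\phi\times\psi)^\vee,s)=L(\boldsymbol{\mu}_{\phi,\theta}\times\boldsymbol{\nu}_{\psi,z},s).$$ -/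

import Mathlib

namespace DrinfeldConv

open Polynomial

section Basic

/-- The index set of all Euler products: monic irreducible `f ∈ A = 𝔽_q[θ]`. -/
abbrev MonicIrred (F : Type*) [Field F] : Type _ :=
  {f : F[X] // f.Monic ∧ Irreducible f}

/-- The set `A₊` of monic elements of `A = 𝔽_q[θ]`. -/
abbrev MonicPoly (F : Type*) [Field F] : Type _ := {a : F[X] // a.Monic}

instance {F : Type*} [Field F] (f : MonicIrred F) : Fact (Irreducible f.1) := ⟨f.2.2⟩

/-- A Drinfeld module `φ : 𝔽_q[t] → A[τ]` of rank `r` over `A = 𝔽_q[θ]`; such an `𝔽_q`-algebra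
homomorphism is the same as its value
`φ_t = κ₀ + κ₁ τ + ⋯ + κ_r τ^r` with `κ₀ = θ` and `κ_r ≠ 0`. -/
structure DrinfeldModule (F : Type*) [Field F] (r : ℕ) where
  coeff : Fin (r + 1) → F[X]
  coeff_zero : coeff 0 = X
  coeff_last_ne_zero : coeff (Fin.last r) ≠ 0

/-- The leading coefficient `κ_r`. -/
def DrinfeldModule.lead {F : Type*} [Field F] {r : ℕ} (φ : DrinfeldModule F r) : F[X] :=
  φ.coeff (Fin.last r)

/-- Good reduction modulo `f`: the reduction modulo `f` still has rank `r`. -/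
def DrinfeldModule.GoodReductionAt {F : Type*} [Field F] {r : ℕ} (φ : DrinfeldModule F r)
    (f : MonicIrred F) : Prop := ¬ f.1 ∣ φ.lead

/-- Good reduction at every `f` (equivalently, `κ_r ∈ 𝔽_q^×`). -/
def DrinfeldModule.EverywhereGoodReduction {F : Type*} [Field F] {r : ℕ}
    (φ : DrinfeldModule F r) : Prop := ∀ f : MonicIrred F, φ.GoodReductionAt f

/-- `χ_φ(a) = ((-1)^{r+1} κ_r)^{deg a}`, where `κ_r` is a constant polynomial. -/
noncomputable def DrinfeldModule.chi {F : Type*} [Field F] {r : ℕ} (φ : DrinfeldModule F r)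
    (a : F[X]) : F := ((-1) ^ (r + 1) * φ.lead.coeff 0) ^ a.natDegree

end Basic

section Tate

variable {R : Type*} [CommRing R]

/-- The Tate module `T_a(M) = lim M[a^m]`, as the module of sequences `(x_m)` with `x_0 = 0`
and `a x_{m+1} = x_m` (so that `x_m ∈ M[a^m]`). -/
def tateModule (a : R) (M : Type*) [AddCommGroup M] [Module R M] : Submodule R (ℕ → M) where
  carrier := {x | x 0 = 0 ∧ ∀ m, a • x (m + 1) = x m}
  add_mem' := by
    rintro x y ⟨hx, hx'⟩ ⟨hy, hy'⟩
    exact ⟨by simp [hx, hy], fun m => by simp [hx', hy']⟩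
  zero_mem' := by simp
  smul_mem' := by
    rintro c x ⟨hx, hx'⟩
    exact ⟨by simp [hx], fun m => by simp [smul_comm a c, hx']⟩

variable {a : R} {M : Type*} [AddCommGroup M] [Module R M]

lemma tateModule_pow_smul (x : tateModule a M) (m : ℕ) : a ^ m • x.1 m = 0 := by
  induction m with
  | zero => simp [x.2.1]
  | succ m ih => rw [pow_succ, mul_smul, x.2.2 m, ih]

lemma tateModule_smul_congr (x : tateModule a M) {m : ℕ} {c d : R}
    (h : Ideal.Quotient.mk (Ideal.span {a} ^ m) c = Ideal.Quotient.mk (Ideal.span {a} ^ m) d) :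
    c • x.1 m = d • x.1 m := by
  rw [Ideal.Quotient.eq, Ideal.span_singleton_pow, Ideal.mem_span_singleton] at h
  obtain ⟨e, he⟩ := h
  rw [← sub_eq_zero, ← sub_smul, he, mul_comm, mul_smul, tateModule_pow_smul, smul_zero]

/-- A lift to `R` of the image of an element of the `a`-adic completion in `R / a^m`. -/
noncomputable def adicLift (c : AdicCompletion (Ideal.span {a}) R) (m : ℕ) : R :=
  Quotient.out (AdicCompletion.evalₐ (Ideal.span {a}) m c)

lemma mk_adicLift (c : AdicCompletion (Ideal.span {a}) R) (m : ℕ) :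
    Ideal.Quotient.mk (Ideal.span {a} ^ m) (adicLift c m) =
      AdicCompletion.evalₐ (Ideal.span {a}) m c :=
  Ideal.Quotient.mk_out _

lemma mk_adicLift_succ (c : AdicCompletion (Ideal.span {a}) R) (m : ℕ) :
    Ideal.Quotient.mk (Ideal.span {a} ^ m) (adicLift c (m + 1)) =
      Ideal.Quotient.mk (Ideal.span {a} ^ m) (adicLift c m) := by
  have h := congrArg (Ideal.Quotient.factor (Ideal.pow_le_pow_right (Nat.le_succ m)))
    (mk_adicLift c (m + 1))
  rw [Ideal.Quotient.factor_mk] at h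
  rw [h, mk_adicLift]
  obtain ⟨y, rfl⟩ := AdicCompletion.mk_surjective _ _ c
  rw [AdicCompletion.evalₐ_mk, AdicCompletion.evalₐ_mk, Ideal.Quotient.factor_mk]
  have hy := (y.2 (Nat.le_succ m)).symm
  rw [SModEq.sub_mem] at hy
  rw [Ideal.Quotient.eq]
  simpa using hy

/-- The `a`-adic completion of `R` acts on `T_a(M)`: on `M[a^m]` it acts through `R / a^m`. -/
noncomputable instance : SMul (AdicCompletion (Ideal.span {a}) R) (tateModule a M) where
  smul c x := ⟨fun m => adicLift c m • x.1 m, by simp [x.2.1], fun m => by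
    rw [smul_comm, x.2.2 m]
    exact tateModule_smul_congr x (mk_adicLift_succ c m)⟩

lemma tateModule_smul_apply (c : AdicCompletion (Ideal.span {a}) R) (x : tateModule a M) (m : ℕ) :
    (c • x).1 m = adicLift c m • x.1 m := rfl

noncomputable instance : Module (AdicCompletion (Ideal.span {a}) R) (tateModule a M) where
  one_smul x := Subtype.ext <| funext fun m => by
    rw [tateModule_smul_apply, tateModule_smul_congr (d := 1) x (by simp [mk_adicLift]), one_smul]
  mul_smul c d x := Subtype.ext <| funext fun m => by
    rw [tateModule_smul_apply, tateModule_smul_apply, tateModule_smul_apply, smul_smul,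
      tateModule_smul_congr (d := adicLift c m * adicLift d m) x (by simp [mk_adicLift])]
  smul_zero c := Subtype.ext <| funext fun m => by
    rw [tateModule_smul_apply]; simp
  smul_add c x y := Subtype.ext <| funext fun m => by
    simp [tateModule_smul_apply]
  add_smul c d x := Subtype.ext <| funext fun m => by
    rw [tateModule_smul_apply,
      tateModule_smul_congr (d := adicLift c m + adicLift d m) x (by simp [mk_adicLift]), add_smul]
    rfl
  zero_smul x := Subtype.ext <| funext fun m => by
    rw [tateModule_smul_apply, tateModule_smul_congr (d := 0) x (by simp [mk_adicLift]), zero_smul]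
    rfl

/-- The endomorphism of `T_a(M)` induced by an endomorphism of `M`. -/
noncomputable def tateMap (a : R) (g : M →ₗ[R] M) :
    Module.End (AdicCompletion (Ideal.span {a}) R) (tateModule a M) where
  toFun x := ⟨fun m => g (x.1 m), by simp [x.2.1], fun m => by rw [← map_smul, x.2.2 m]⟩
  map_add' x y := Subtype.ext <| funext fun m => by simp
  map_smul' c x := Subtype.ext <| funext fun m => by
    simp [tateModule_smul_apply]

/-- `P` is the characteristic polynomial of the endomorphism `g` of the finite free module `M`. -/
def HasCharpoly {S : Type*} [CommRing S] {N : Type*} [AddCommMonoid N] [Module S N]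
    (g : Module.End S N) (P : S[X]) : Prop :=
  ∃ (n : ℕ) (b : Module.Basis (Fin n) S N), (LinearMap.toMatrix b b g).charpoly = P

end Tate

section Frobenius

variable {F : Type*} [Field F] [Fintype F] {r : ℕ}

/-- The algebraic closure of the residue field `𝔽_f = A/fA`. -/
abbrev ResidueClosure (f : MonicIrred F) : Type _ := AlgebraicClosure (AdjoinRoot f.1)

/-- The operator `x ↦ ∑ᵢ (κᵢ mod f) x^{q^i}` on the algebraic closure of `𝔽_f`: the action of `t`
through the reduction of `φ` modulo `f`. -/
noncomputable def DrinfeldModule.reductionOp (φ : DrinfeldModule F r) (f : MonicIrred F) :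
    Module.End F (ResidueClosure f) :=
  ∑ i : Fin (r + 1),
    LinearMap.mulLeft F
        (algebraMap (AdjoinRoot f.1) (ResidueClosure f) (AdjoinRoot.mk f.1 (φ.coeff i))) *
      (FiniteField.frobeniusAlgHom F (ResidueClosure f)).toLinearMap ^ (i : ℕ)

/-- The algebraic closure of `𝔽_f` with the `𝔽_q[t]`-module structure given by the reduction of
`φ` modulo `f`. -/
abbrev DrinfeldModule.ReductionPoints (φ : DrinfeldModule F r) (f : MonicIrred F) : Type _ :=
  Module.AEval' (φ.reductionOp f)

lemma frobenius_pow_apply {B : Type*} [CommRing B] [Algebra F B] (n : ℕ) (x : B) :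
    ((FiniteField.frobeniusAlgHom F B).toLinearMap ^ n) x = x ^ (Fintype.card F) ^ n := by
  induction n with
  | zero => simp
  | succ n ih =>
    rw [pow_succ', Module.End.mul_apply, ih, AlgHom.toLinearMap_apply,
      FiniteField.frobeniusAlgHom_apply, ← pow_mul, ← pow_succ]

lemma residue_pow (f : MonicIrred F) (c : AdjoinRoot f.1) :
    c ^ (Fintype.card F) ^ f.1.natDegree = c := by
  have hf : f.1 ≠ 0 := f.2.2.ne_zero
  have : Module.Finite F (AdjoinRoot f.1) := (AdjoinRoot.powerBasis hf).finite
  have : Finite (AdjoinRoot f.1) := Module.finite_of_finite F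
  have := Fintype.ofFinite (AdjoinRoot f.1)
  have h : Fintype.card (AdjoinRoot f.1) = (Fintype.card F) ^ f.1.natDegree := by
    rw [← Nat.card_eq_fintype_card, Module.natCard_eq_pow_finrank (K := F),
      Nat.card_eq_fintype_card, (AdjoinRoot.powerBasis hf).finrank, AdjoinRoot.powerBasis_dim]
  rw [← h, FiniteField.pow_card]

lemma frobenius_comm (φ : DrinfeldModule F r) (f : MonicIrred F) :
    (FiniteField.frobeniusAlgHom F (ResidueClosure f)).toLinearMap ^ f.1.natDegree *
        φ.reductionOp f =
      φ.reductionOp f *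
        (FiniteField.frobeniusAlgHom F (ResidueClosure f)).toLinearMap ^ f.1.natDegree := by
  rw [DrinfeldModule.reductionOp, Finset.mul_sum, Finset.sum_mul]
  refine Finset.sum_congr rfl fun i _ => LinearMap.ext fun x => ?_
  simp only [Module.End.mul_apply, LinearMap.mulLeft_apply, frobenius_pow_apply]
  rw [mul_pow, ← map_pow, residue_pow, ← pow_mul, ← pow_mul, mul_comm (_ ^ (i : ℕ))]

/-- The `q^d`-th power Frobenius `τ^d`, `d = deg f`, acting on the points of the reduction of `φ`
modulo `f`. -/
noncomputable def DrinfeldModule.frob (φ : DrinfeldModule F r) (f : MonicIrred F) :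
    φ.ReductionPoints f →ₗ[F[X]] φ.ReductionPoints f :=
  LinearMap.ofAEval (φ.reductionOp f)
    ((Module.AEval'.of (φ.reductionOp f)).toLinearMap ∘ₗ
      (FiniteField.frobeniusAlgHom F (ResidueClosure f)).toLinearMap ^ f.1.natDegree)
    (fun x => by
      have h := LinearMap.congr_fun (frobenius_comm φ f) x
      simp only [Module.End.mul_apply] at h
      simp only [LinearMap.comp_apply, LinearEquiv.coe_coe, Module.End.smul_def]
      rw [h, Module.AEval'.X_smul_of])

/-- `τ^d` acting on the `λ`-adic Tate module of the reduction of `φ` modulo `f`. -/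
noncomputable def DrinfeldModule.frobTate (φ : DrinfeldModule F r) (f l : MonicIrred F) :
    Module.End (AdicCompletion (Ideal.span {l.1}) F[X])
      (tateModule l.1 (φ.ReductionPoints f)) :=
  tateMap l.1 (φ.frob f)

/-- `P ∈ A[X]` is the characteristic polynomial of `τ^d` on the `λ`-adic Tate module, for all
`λ ≠ f` (with `t = θ`). -/
def DrinfeldModule.IsFrobPoly (φ : DrinfeldModule F r) (f : MonicIrred F) (P : F[X][X]) : Prop :=
  ∀ l : MonicIrred F, l ≠ f →
    HasCharpoly (φ.frobTate f l)
      (P.map (algebraMap F[X] (AdicCompletion (Ideal.span {l.1}) F[X])))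

/-- `P ∈ K[X]` is the characteristic polynomial of `τ^d` on the dual of the `λ`-adic Tate module
(on which it acts by `ξ ↦ ξ ∘ τ^{-d}`), for all `λ ≠ f`. The coefficients in `K = Frac A` and in
the completion `A_λ` are compared inside `Frac A_λ`, by multiplying with the denominator. -/
def DrinfeldModule.IsFrobPolyDual (φ : DrinfeldModule F r) (f : MonicIrred F)
    (P : (RatFunc F)[X]) : Prop :=
  ∀ l : MonicIrred F, l ≠ f →
    ∃ (D : Module.End (AdicCompletion (Ideal.span {l.1}) F[X])
          (Module.Dual (AdicCompletion (Ideal.span {l.1}) F[X])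
            (tateModule l.1 (φ.ReductionPoints f))))
      (P' : (AdicCompletion (Ideal.span {l.1}) F[X])[X]),
      (∀ ξ x, D ξ (φ.frobTate f l x) = ξ x) ∧ HasCharpoly D P' ∧
      ∀ i, algebraMap F[X] (AdicCompletion (Ideal.span {l.1}) F[X]) (P.coeff i).denom *
          P'.coeff i =
        algebraMap F[X] (AdicCompletion (Ideal.span {l.1}) F[X]) (P.coeff i).num

/-- `P_{φ,f}(X) ∈ A[X]`, the (unique) characteristic polynomial of Frobenius at `f`. -/
noncomputable def DrinfeldModule.frobPoly (φ : DrinfeldModule F r) (f : MonicIrred F) : F[X][X] :=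
  Classical.epsilon (φ.IsFrobPoly f)

/-- `P_{φ,f}^∨(X) ∈ K[X]`, the (unique) characteristic polynomial of Frobenius at `f` on the
dual. -/
noncomputable def DrinfeldModule.frobPolyDual (φ : DrinfeldModule F r) (f : MonicIrred F) :
    (RatFunc F)[X] :=
  Classical.epsilon (φ.IsFrobPolyDual f)

end Frobenius

section Schur

/-- `det (x_j ^ (e_i))`. -/
noncomputable def alternant (n : ℕ) (e : Fin n → ℕ) : MvPolynomial (Fin n) ℤ :=
  (Matrix.of fun i j : Fin n => (MvPolynomial.X j : MvPolynomial (Fin n) ℤ) ^ e i).det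

/-- `V(x) = ∏_{i<j} (x_i - x_j)`. -/
noncomputable def vandermonde (n : ℕ) : MvPolynomial (Fin n) ℤ :=
  ∏ i : Fin n, ∏ j ∈ Finset.Ioi i, (MvPolynomial.X i - MvPolynomial.X j)

/-- The exponent `k_i + ⋯ + k_{n-1} + n - i` of the `i`-th row (rows and entries of `k` are
numbered from `0` here). -/
def schurExponent (n : ℕ) (k : Fin (n - 1) → ℕ) (i : Fin n) : ℕ :=
  (∑ m : Fin (n - 1), if (i : ℕ) ≤ (m : ℕ) then k m else 0) + (n - 1 - (i : ℕ))

/-- The Schur polynomial `S_{k_1,…,k_{n-1}}(x_1,…,x_n) ∈ ℤ[x]`: the quotient of the alternant by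
the Vandermonde determinant (which divides it). -/
noncomputable def schur (n : ℕ) (k : Fin (n - 1) → ℕ) : MvPolynomial (Fin n) ℤ :=
  Function.invFun (fun S : MvPolynomial (Fin n) ℤ => vandermonde n * S)
    (alternant n (schurExponent n k))

/-- The roots, with multiplicity and in some order, of a monic polynomial of degree `n` over a
field, in its algebraic closure. -/
noncomputable def rootFamily {k : Type*} [Field k] (n : ℕ) (P : k[X]) :
    Fin n → AlgebraicClosure k :=
  fun i => (P.aroots (AlgebraicClosure k)).toList.getD i 0

/-- `P ⊗ Q = ∏ (X - α_i β_j)`, the product over the roots `α_i` of `P` and `β_j` of `Q` with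
multiplicity, as a polynomial over the base field. -/
noncomputable def polyTensor {k : Type*} [Field k] (P Q : k[X]) : k[X] :=
  Function.invFun (Polynomial.map (algebraMap k (AlgebraicClosure k)))
    ((P.aroots (AlgebraicClosure k) ×ˢ Q.aroots (AlgebraicClosure k)).map
      fun x => X - C (x.1 * x.2)).prod

end Schur

section MuNu

variable {F : Type*} [Field F] [Fintype F] {r : ℕ}

/-- `𝛍_{φ,θ}(f^{k_1},…,f^{k_{r-1}}) = S_k(α_1,…,α_r) f^{k_1+⋯+k_{r-1}}`, an element of `A`, where
the `α_i` are the roots of `P_{φ,f}^∨` in the algebraic closure of `K`. -/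
noncomputable def DrinfeldModule.muLocal (φ : DrinfeldModule F r) (f : MonicIrred F)
    (k : Fin (r - 1) → ℕ) : F[X] :=
  Function.invFun (algebraMap F[X] (AlgebraicClosure (RatFunc F)))
    (MvPolynomial.aeval (rootFamily r (φ.frobPolyDual f)) (schur r k) *
      algebraMap F[X] (AlgebraicClosure (RatFunc F)) f.1 ^ ∑ i, k i)

/-- `𝛎_{φ,θ}(f^{k_1},…,f^{k_{r-1}}) = S_k(α_1^{-1},…,α_r^{-1})`, an element of `A`. -/
noncomputable def DrinfeldModule.nuLocal (φ : DrinfeldModule F r) (f : MonicIrred F)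
    (k : Fin (r - 1) → ℕ) : F[X] :=
  Function.invFun (algebraMap F[X] (AlgebraicClosure (RatFunc F)))
    (MvPolynomial.aeval (fun i => (rootFamily r (φ.frobPolyDual f) i)⁻¹) (schur r k))

/-- The multiplicative extension of `𝛍_{φ,θ}` to `(A₊)^{r-1}`. -/
noncomputable def DrinfeldModule.mu (φ : DrinfeldModule F r) (a : Fin (r - 1) → F[X]) : F[X] :=
  ∏ᶠ f : MonicIrred F, φ.muLocal f fun i => multiplicity f.1 (a i)

/-- The multiplicative extension of `𝛎_{φ,θ}` to `(A₊)^{r-1}`. -/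
noncomputable def DrinfeldModule.nu (φ : DrinfeldModule F r) (a : Fin (r - 1) → F[X]) : F[X] :=
  ∏ᶠ f : MonicIrred F, φ.nuLocal f fun i => multiplicity f.1 (a i)

end MuNu

section LSeries

variable (F : Type*) [Field F]

/-- `𝕂_∞ = 𝔽_q(z)((θ^{-1}))`: Laurent series in the variable `θ^{-1}`, with the `θ^{-1}`-adic
topology, that is, the topology of the Gauss norm. -/
abbrev KInfty : Type _ := LaurentSeries (RatFunc F)

/-- `𝕋_z(K_∞) = 𝔽_q[z]((θ^{-1}))` inside `𝕂_∞`. -/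
def tateAlgebra : Set (KInfty F) :=
  {x | ∀ n : ℤ, x.coeff n ∈ Set.range (algebraMap F[X] (RatFunc F))}

/-- `a ↦ a(z)`. -/
noncomputable def zHom : F[X] →+* KInfty F :=
  (HahnSeries.C : RatFunc F →+* KInfty F).comp (algebraMap F[X] (RatFunc F))

/-- `a ↦ a(θ)`. -/
noncomputable def thetaHom : F[X] →+* KInfty F :=
  Polynomial.eval₂RingHom ((HahnSeries.C : RatFunc F →+* KInfty F).comp RatFunc.C)
    (HahnSeries.single (-1 : ℤ) (1 : RatFunc F))

lemma coeff_thetaHom (p : F[X]) (n : ℕ) :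
    (thetaHom F p).coeff (-(n : ℤ)) = RatFunc.C (p.coeff n) := by
  induction p using Polynomial.induction_on' with
  | add p q hp hq => simp [hp, hq]
  | monomial m c =>
    have h : thetaHom F (monomial m c) = HahnSeries.single (-(m : ℤ)) (RatFunc.C c) := by
      simp [thetaHom, Polynomial.eval₂_monomial, HahnSeries.single_pow, HahnSeries.C_apply,
        HahnSeries.single_mul_single]
    rw [h, Polynomial.coeff_monomial, HahnSeries.coeff_single]
    by_cases hmn : m = n
    · simp [hmn]
    · rw [if_neg (by omega), if_neg hmn, map_zero]

lemma thetaHom_injective : Function.Injective (thetaHom F) := by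
  intro p q h
  ext n
  apply RatFunc.C_injective
  rw [← coeff_thetaHom, ← coeff_thetaHom, h]

/-- The embedding of `K = 𝔽_q(θ)` into `𝕂_∞`. -/
noncomputable def thetaHomK : RatFunc F →+* KInfty F :=
  RatFunc.liftRingHom (thetaHom F)
    (nonZeroDivisors_le_comap_nonZeroDivisors_of_injective _ (thetaHom_injective F))

variable {F} [Fintype F] {r l : ℕ}

/-- `𝐏_f^∨ = P_{φ,f}^∨ ⊗ P_{ψ,f(z)}`, where `P_{ψ,f(z)} = P_{ψ,f}|_{θ=z}`. -/
noncomputable def convPolyDual (φ : DrinfeldModule F r) (ψ : DrinfeldModule F l)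
    (f : MonicIrred F) : (KInfty F)[X] :=
  polyTensor ((φ.frobPolyDual f).map (thetaHomK F)) ((ψ.frobPoly f).map (zHom F))

/-- The Euler factor `𝐐_f^∨(f^{-s})^{-1}`, with `𝐐_f^∨` the reciprocal polynomial of `𝐏_f^∨`. -/
noncomputable def eulerFactor (φ : DrinfeldModule F r) (ψ : DrinfeldModule F l) (s : ℕ)
    (f : MonicIrred F) : KInfty F :=
  ((convPolyDual φ ψ f).reverse.eval ((thetaHom F f.1 ^ s)⁻¹))⁻¹

/-- `L(𝔼(φ×ψ)^∨, s) = ∏_f 𝐐_f^∨(f^{-s})^{-1}`. -/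
noncomputable def LEulerDual (φ : DrinfeldModule F r) (ψ : DrinfeldModule F l) (s : ℕ) :
    KInfty F := ∏' f : MonicIrred F, eulerFactor φ ψ s f

/-- The entries of `(a_1,…,a_n)`, followed by `1`s; restricting to the first `m` indices gives
`(a_1,…,a_m)` if `m ≤ n` and `(a_1,…,a_n,1,…,1)` if `m ≥ n`. -/
noncomputable def pad {n : ℕ} (a : Fin n → MonicPoly F) (i : ℕ) : F[X] :=
  if h : i < n then (a ⟨i, h⟩).1 else 1

/-- `a_1 ⋯ a_n (a_1 a_2² ⋯ a_n^n)^s` as an element of `𝕂_∞`. -/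
noncomputable def convDenom {n : ℕ} (s : ℕ) (a : Fin n → MonicPoly F) : KInfty F :=
  thetaHom F ((∏ i, (a i).1) * (∏ i, (a i).1 ^ ((i : ℕ) + 1)) ^ s)

/-- The general term of the series `L(𝛍_{φ,θ} × 𝛎_{ψ,z}, s)` for `r < ℓ`:
`χ_φ(a_r) 𝛍_{φ,θ}(a_1,…,a_{r-1}) 𝛎_{ψ,z}(a_1,…,a_r,1,…,1) / (a_1⋯a_r (a_1 a_2²⋯a_r^r)^s)`. -/
noncomputable def convTermLT (φ : DrinfeldModule F r) (ψ : DrinfeldModule F l) (s : ℕ)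
    (a : Fin r → MonicPoly F) : KInfty F :=
  thetaHom F (C (φ.chi (pad a (r - 1)))) * thetaHom F (φ.mu fun i => pad a i) *
    zHom F (ψ.nu fun i => pad a i) / convDenom s a

/-- The general term of the series `L(𝛍_{φ,θ} × 𝛎_{ψ,z}, s)` for `r > ℓ`:
`χ̄_ψ(a_ℓ) a_ℓ(z) 𝛍_{φ,θ}(a_1,…,a_ℓ,1,…,1) 𝛎_{ψ,z}(a_1,…,a_{ℓ-1}) / (a_1⋯a_ℓ (a_1 a_2²⋯a_ℓ^ℓ)^s)`,
where `χ̄_ψ` is the inverse of `χ_ψ`. -/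
noncomputable def convTermGT (φ : DrinfeldModule F r) (ψ : DrinfeldModule F l) (s : ℕ)
    (a : Fin l → MonicPoly F) : KInfty F :=
  thetaHom F (C (ψ.chi (pad a (l - 1)))⁻¹) * zHom F (pad a (l - 1)) *
    thetaHom F (φ.mu fun i => pad a i) * zHom F (ψ.nu fun i => pad a i) / convDenom s a

end LSeries

end DrinfeldConv

/-! Fix a monic irreducible f of degree d; let α_i be the roots of P^∨_{φ,f} and β_j those of
P_{ψ,f(z)}. The Cauchy identity (`cauchy_identity`) expands ∏ (1 - α_i β_j T)⁻¹ as ∑_λ s_λ(α) s_λ(β)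
T^{|λ|}, where λ runs over partitions with at most n = min(r, ℓ) parts, recorded by the differences
k_i = λ_i - λ_{i+1}. At T = f^{-s} this is the Euler factor. Columns of full height split off
(`schurVal_eq`): s_λ(α) = (α_1⋯α_r)^{k_r} S_{k_1,…,k_{r-1}}(α). Since α_1⋯α_r = χ_φ(f)/f, the
product s_λ(α) f^{k_1+⋯+k_r} equals χ_φ(f)^{k_r} 𝛍(f^{k_1},…,f^{k_{r-1}}); likewise s_λ(β) =
(χ_ψ(f)⁻¹ f(z))^{k_ℓ} 𝛎(f^{k_1},…,f^{k_{ℓ-1}}). If r < ℓ then k_ℓ = 0, and if r > ℓ then k_r = 0,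
which accounts for the two shapes of the series. So each Euler factor is a sum of local terms
(`hasSum_localTerm`).

Unique factorization identifies n-tuples of monic polynomials with finitely supported families of
exponents (`monicTupleEquiv`), so the terms of the series are the products of local terms. Once such
a series is summable, the product of the local sums converges to it (`hasProd_of_summable`).
Summability is a degree estimate (`summable_prod_localTerm`): the inverse roots α_i⁻¹ have degree at
most d/r, hence the factor from φ has degree at most (1 - 1/r) W with W = ∑ deg a_i, while the
denominator has degree at least W. The factors in z have Gauss norm at most 1, and only finitely
many tuples have bounded W.

All this needs the Frobenius polynomial to exist in A[X], independently of λ, with constant term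
(-1)^r χ_φ(f)⁻¹ f and with its coefficient of X^m of degree at most d(r - m)/r
(`exists_isFrobPoly`). Over the closure K of the residue field, the t-motive of the reduction is
described by K[t]-coordinates in 1, τ, …, τ^{r-1}, and τ^d by a product of Frobenius twists of one
companion-like matrix. Rotating this product cyclically shows that its characteristic polynomial has
coefficients in 𝔽_q[t]; its determinant gives the constant term; the weights r for t and i for τ^i
give the degree bounds. A perfect pairing of the a-torsion with the motive modulo a, with values in
K[t]/a, shows that τ^d has the same characteristic polynomial modulo a on both (`dvd_charpoly_sub`).
Taking a = λ^m for all m gives the Tate module, and the polynomial on its dual is the normalized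
reciprocal (`frobPolyDual_eq`). -/

namespace DrinfeldConv

open Polynomial

/-! ### Alternants, Vandermonde determinants and their quotients -/

section Alternants

variable {R : Type*} [CommRing R] {n : ℕ}

/-- The matrix `(x_j ^ e_i)`. -/
def altMat (x : Fin n → R) (e : Fin n → ℕ) : Matrix (Fin n) (Fin n) R :=
  Matrix.of fun i j => x j ^ e i

/-- `∏_{i<j} (x_i - x_j)`. -/
def vand (x : Fin n → R) : R := ∏ i : Fin n, ∏ j ∈ Finset.Ioi i, (x i - x j)

lemma map_det_altMat {S : Type*} [CommRing S] (g : R →+* S) (x : Fin n → R) (e : Fin n → ℕ) :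
    g (altMat x e).det = (altMat (fun i => g (x i)) e).det := by
  rw [RingHom.map_det]
  congr 1
  ext i j
  simp [altMat]

lemma map_vand {S : Type*} [CommRing S] (g : R →+* S) (x : Fin n → R) :
    g (vand x) = vand (fun i => g (x i)) := by
  simp [vand, map_prod]

/-- The value of a polynomial with integer coefficients at a family of ring elements. -/
noncomputable def evalAt {σ : Type*} (x : σ → R) : MvPolynomial σ ℤ →+* R :=
  MvPolynomial.eval₂Hom (Int.castRingHom R) x

@[simp]
lemma evalAt_var {σ : Type*} (x : σ → R) (i : σ) : evalAt x (MvPolynomial.X i) = x i := by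
  simp [evalAt]

lemma aeval_eq_evalAt {σ : Type*} [Algebra ℤ R] (x : σ → R) (p : MvPolynomial σ ℤ) :
    MvPolynomial.aeval x p = evalAt x p := by
  rw [evalAt, MvPolynomial.aeval_def, MvPolynomial.coe_eval₂Hom]
  congr 1
  exact Subsingleton.elim _ _

lemma evalAt_X {σ : Type*} (p : MvPolynomial σ ℤ) : evalAt MvPolynomial.X p = p := by
  rw [← aeval_eq_evalAt, MvPolynomial.aeval_X_left_apply]

/-- The device for passing from universal to arbitrary arguments: an identity is proved for the
variables of a polynomial ring over ℤ, where the Vandermonde determinant can be cancelled, and is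
then specialized to rings with repeated or zero arguments. -/
lemma map_evalAt {σ S : Type*} [CommRing S] (g : R →+* S) (x : σ → R) (p : MvPolynomial σ ℤ) :
    g (evalAt x p) = evalAt (fun i => g (x i)) p := by
  rw [evalAt, evalAt, MvPolynomial.coe_eval₂Hom, MvPolynomial.coe_eval₂Hom, MvPolynomial.hom_eval₂]
  congr 1
  exact Subsingleton.elim _ _

lemma evalAt_alternant (x : Fin n → R) (e : Fin n → ℕ) :
    evalAt x (alternant n e) = (altMat x e).det := by
  have h := map_det_altMat (evalAt x) (fun i => MvPolynomial.X i) e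
  refine Eq.trans h ?_
  simp

lemma evalAt_vandermonde (x : Fin n → R) :
    evalAt x (vandermonde n) = vand x := by
  simp [vandermonde, vand, map_prod]

lemma det_altMat_delta (x : Fin n → R) :
    (altMat x fun i => n - 1 - (i : ℕ)).det = vand x := by
  have h := Matrix.det_projVandermonde (fun _ : Fin n => (1 : R)) x
  rw [← Matrix.det_transpose]
  simp only [one_mul] at h
  rw [vand, ← h]
  congr 1
  ext i j
  simp only [altMat, Matrix.transpose_apply, Matrix.of_apply, Matrix.projVandermonde_apply,
    one_pow, one_mul, Fin.val_rev]
  congr 1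
  omega

lemma eval_eq_sum_rev (p : R[X]) (hp : p.natDegree < n) (x : R) :
    p.eval x = ∑ m : Fin n, p.coeff (n - 1 - m) * x ^ (n - 1 - (m : ℕ)) := by
  rw [eval_eq_sum_range' hp, Finset.sum_range, ← Equiv.sum_comp Fin.revPerm]
  refine Finset.sum_congr rfl fun m _ => ?_
  simp only [Fin.revPerm_apply, Fin.val_rev]
  congr 2 <;> omega

/-- Reduce X^{e_i} modulo ∏ (X - x_j). The remainder has degree below n and the same values at the
x_j, so the alternant matrix is a matrix of remainder coefficients times the Vandermonde matrix. -/
lemma vand_dvd_det_altMat (x : Fin n → R) (e : Fin n → ℕ) : vand x ∣ (altMat x e).det := by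
  nontriviality R
  rcases Nat.eq_zero_or_pos n with rfl | hn
  · simp [vand]
  set p : R[X] := ∏ j, (X - C (x j)) with hp
  have hpm : p.Monic := monic_prod_of_monic _ _ fun j _ => monic_X_sub_C _
  have hdeg : p.natDegree = n := by
    rw [hp, natDegree_prod_of_monic _ _ fun j _ => monic_X_sub_C _]; simp
  have hp1 : p ≠ 1 := by
    intro h; rw [h] at hdeg; simp at hdeg; omega
  have key : altMat x e =
      (Matrix.of fun i m : Fin n => (X ^ e i %ₘ p).coeff (n - 1 - m)) *
        altMat x fun i => n - 1 - (i : ℕ) := by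
    ext i j
    have h0 : p.eval (x j) = 0 := by
      rw [hp, eval_prod]
      exact Finset.prod_eq_zero (Finset.mem_univ j) (by simp)
    have h1 : (X ^ e i %ₘ p).eval (x j) = x j ^ e i := by
      have := congrArg (eval (x j)) (modByMonic_add_div (X ^ e i) p)
      simpa [h0] using this
    rw [Matrix.mul_apply]
    simp only [altMat, Matrix.of_apply]
    rw [← h1]
    exact eval_eq_sum_rev _ (hdeg ▸ natDegree_modByMonic_lt _ hpm hp1) _
  rw [key, Matrix.det_mul, det_altMat_delta]
  exact Dvd.intro_left _ rfl

lemma det_altMat_mul_left (x : Fin n → R) (e : Fin n → ℕ) (a : ℕ) :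
    (altMat x fun i => e i + a).det = (∏ i, x i) ^ a * (altMat x e).det := by
  rw [← Finset.prod_pow, ← Matrix.det_mul_row]
  congr 1
  ext i j
  simp [altMat, pow_add, mul_comm]

lemma det_altMat_scale (c : R) (x : Fin n → R) (e : Fin n → ℕ) :
    (altMat (fun i => c * x i) e).det = c ^ (∑ i, e i) * (altMat x e).det := by
  rw [← Finset.prod_pow_eq_pow_sum, ← Matrix.det_mul_column]
  congr 1
  ext i j
  simp [altMat, mul_pow]

lemma det_altMat_perm (σ : Equiv.Perm (Fin n)) (x : Fin n → R) (e : Fin n → ℕ) :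
    (altMat (fun i => x (σ i)) e).det = Equiv.Perm.sign σ * (altMat x e).det := by
  rw [← Matrix.det_permute']
  rfl

/-- The bialternant: the quotient of the alternant with exponents `e` by the Vandermonde
determinant. -/
noncomputable def altQ (n : ℕ) (e : Fin n → ℕ) : MvPolynomial (Fin n) ℤ :=
  Function.invFun (fun S : MvPolynomial (Fin n) ℤ => vandermonde n * S) (alternant n e)

lemma vandermonde_mul_altQ (n : ℕ) (e : Fin n → ℕ) : vandermonde n * altQ n e = alternant n e := by
  refine Function.invFun_eq (f := fun S : MvPolynomial (Fin n) ℤ => vandermonde n * S) ?_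
  obtain ⟨c, hc⟩ := vand_dvd_det_altMat (fun i => (MvPolynomial.X i : MvPolynomial (Fin n) ℤ)) e
  exact ⟨c, hc.symm⟩

lemma vand_mul_evalAt_altQ (x : Fin n → R) (e : Fin n → ℕ) :
    vand x * evalAt x (altQ n e) = (altMat x e).det := by
  rw [← evalAt_vandermonde, ← map_mul, vandermonde_mul_altQ, evalAt_alternant]

lemma vand_ne_zero [IsDomain R] {x : Fin n → R} (hx : Function.Injective x) : vand x ≠ 0 := by
  refine Finset.prod_ne_zero_iff.2 fun i _ => Finset.prod_ne_zero_iff.2 fun j hj => ?_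
  rw [sub_ne_zero]
  exact hx.ne (Finset.mem_Ioi.1 hj).ne

/-- Permuting the variables multiplies numerator and denominator by the same sign; the sign is a
unit and the Vandermonde determinant of the variables is cancellable. -/
lemma altQ_isSymmetric (n : ℕ) (e : Fin n → ℕ) : (altQ n e).IsSymmetric := by
  intro σ
  have h1 := vand_mul_evalAt_altQ (fun i => (MvPolynomial.X (σ i) : MvPolynomial (Fin n) ℤ)) e
  have h2 := vand_mul_evalAt_altQ (fun i => (MvPolynomial.X i : MvPolynomial (Fin n) ℤ)) e
  rw [← det_altMat_delta, det_altMat_perm σ (fun i => MvPolynomial.X i), det_altMat_perm σ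
    (fun i => MvPolynomial.X i), det_altMat_delta, ← h2, mul_assoc] at h1
  have h3 := ((Equiv.Perm.sign σ).isUnit.map (Int.castRingHom (MvPolynomial (Fin n) ℤ))).mul_left_cancel h1
  have h4 := mul_left_cancel₀ (vand_ne_zero MvPolynomial.X_injective) h3
  rw [MvPolynomial.rename_eq_aeval, aeval_eq_evalAt]
  exact h4.trans (evalAt_X _)

/-- Homogeneity: the alternant has degree ∑ e_i, the Vandermonde determinant has degree ∑ (n - 1 -
i), and `N` is the difference. -/
lemma evalAt_altQ_scale_of_injective [IsDomain R] {c : R} {x : Fin n → R} (hc : c ≠ 0)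
    (hx : Function.Injective x) (e : Fin n → ℕ) {N : ℕ}
    (hN : ∑ i, e i = N + ∑ i : Fin n, (n - 1 - (i : ℕ))) :
    evalAt (fun i => c * x i) (altQ n e) = c ^ N * evalAt x (altQ n e) := by
  have h1 := vand_mul_evalAt_altQ (fun i => c * x i) e
  have h2 := vand_mul_evalAt_altQ x e
  rw [← det_altMat_delta, det_altMat_scale, det_altMat_scale, det_altMat_delta, ← h2, hN,
    pow_add] at h1
  have hV := vand_ne_zero hx
  refine mul_left_cancel₀ (mul_ne_zero (pow_ne_zero (∑ i : Fin n, (n - 1 - (i : ℕ))) hc) hV) ?_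
  rw [h1]; ring

lemma evalAt_altQ_scale (c : R) (x : Fin n → R) (e : Fin n → ℕ) {N : ℕ}
    (hN : ∑ i, e i = N + ∑ i : Fin n, (n - 1 - (i : ℕ))) :
    evalAt (fun i => c * x i) (altQ n e) = c ^ N * evalAt x (altQ n e) := by
  -- In the universal case the scalar is one more variable, indexed by `none`.
  have key := evalAt_altQ_scale_of_injective
    (MvPolynomial.X_ne_zero (R := ℤ) (none : Option (Fin n)))
    (MvPolynomial.X_injective.comp (Option.some_injective (Fin n))) e hN
  have h := congrArg
    (evalAt fun o : Option (Fin n) => o.elim c x) key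
  rw [map_evalAt, map_mul, map_pow, map_evalAt] at h
  simpa using h

end Alternants

/-! ### Schur values: setting variables to zero, splitting off full columns -/

section Specialization

variable {R : Type*} [CommRing R] {n : ℕ}

/-- With last variable 0 and last exponent 0, the last column is (0, …, 0, 1), since only 0^0
survives. Expanding along it leaves exponents that are all raised by one. -/
lemma det_altMat_snoc_zero (x : Fin n → R) (e : Fin n → ℕ) :
    (altMat (Fin.snoc (α := fun _ => R) x 0) (Fin.snoc (α := fun _ => ℕ) (fun i => e i + 1) 0)).det =
      (∏ i, x i) * (altMat x e).det := by
  rw [Matrix.det_succ_column _ (Fin.last n), Fin.sum_univ_castSucc, Finset.sum_eq_zero, zero_add]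
  · have h := det_altMat_mul_left x e 1
    rw [pow_one] at h
    rw [← h]
    have h2 : (altMat (Fin.snoc (α := fun _ => R) x 0)
        (Fin.snoc (α := fun _ => ℕ) (fun i => e i + 1) 0)).submatrix (Fin.last n).succAbove
        (Fin.last n).succAbove = altMat x fun i => e i + 1 := by
      ext i j
      simp [altMat]
    rw [h2]
    simp [altMat, ← two_mul]
  · intro i _
    simp [altMat]

lemma det_altMat_snoc_zero_of_pos (x : Fin n → R) (e : Fin (n + 1) → ℕ) (he : ∀ i, e i ≠ 0) :
    (altMat (Fin.snoc (α := fun _ => R) x 0) e).det = 0 := by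
  refine Matrix.det_eq_zero_of_column_eq_zero (Fin.last n) fun i => ?_
  simp [altMat, he]

lemma vand_snoc_zero (x : Fin n → R) :
    vand (Fin.snoc (α := fun _ => R) x 0 : Fin (n + 1) → R) = (∏ i, x i) * vand x := by
  rw [← det_altMat_delta, ← det_altMat_delta, ← det_altMat_snoc_zero]
  congr 2
  ext i
  refine Fin.lastCases ?_ (fun j => ?_) i
  · simp
  · simp only [Fin.snoc_castSucc, Fin.val_castSucc]
    omega

lemma map_snoc_zero {S : Type*} [CommRing S] (g : R →+* S) (x : Fin n → R) :
    (fun i => g ((Fin.snoc (α := fun _ => R) x 0 : Fin (n + 1) → R) i)) =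
      Fin.snoc (α := fun _ => S) (fun i => g (x i)) 0 := by
  ext i
  refine Fin.lastCases ?_ (fun j => ?_) i <;> simp

/-- Stability of Schur polynomials: alternant and Vandermonde determinant acquire the same factor ∏
x_i, which is cancelled for variables before specializing. -/
lemma evalAt_altQ_snoc_zero (x : Fin n → R) (e : Fin n → ℕ) :
    evalAt (Fin.snoc (α := fun _ => R) x 0)
      (altQ (n + 1) (Fin.snoc (α := fun _ => ℕ) (fun i => e i + 1) 0)) =
      evalAt x (altQ n e) := by
  have key : evalAt (Fin.snoc (α := fun _ => MvPolynomial (Fin n) ℤ) MvPolynomial.X 0)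
      (altQ (n + 1) (Fin.snoc (α := fun _ => ℕ) (fun i => e i + 1) 0)) =
      evalAt (MvPolynomial.X : Fin n → MvPolynomial (Fin n) ℤ) (altQ n e) := by
    have h1 := vand_mul_evalAt_altQ
      (Fin.snoc (α := fun _ => MvPolynomial (Fin n) ℤ) MvPolynomial.X 0)
      (Fin.snoc (α := fun _ => ℕ) (fun i => e i + 1) 0)
    have h2 := vand_mul_evalAt_altQ (MvPolynomial.X : Fin n → MvPolynomial (Fin n) ℤ) e
    rw [vand_snoc_zero, det_altMat_snoc_zero, ← h2, ← mul_assoc] at h1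
    refine mul_left_cancel₀ (mul_ne_zero ?_ (vand_ne_zero MvPolynomial.X_injective)) h1
    exact Finset.prod_ne_zero_iff.2 fun i _ => MvPolynomial.X_ne_zero i
  have h := congrArg (evalAt x) key
  rw [map_evalAt, map_evalAt, map_snoc_zero] at h
  simpa using h

lemma evalAt_altQ_snoc_zero_of_pos (x : Fin n → R) (e : Fin (n + 1) → ℕ) (he : ∀ i, e i ≠ 0) :
    evalAt (Fin.snoc (α := fun _ => R) x 0) (altQ (n + 1) e) = 0 := by
  have key : evalAt (Fin.snoc (α := fun _ => MvPolynomial (Fin n) ℤ) MvPolynomial.X 0)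
      (altQ (n + 1) e) = 0 := by
    have h1 := vand_mul_evalAt_altQ
      (Fin.snoc (α := fun _ => MvPolynomial (Fin n) ℤ) MvPolynomial.X 0) e
    rw [vand_snoc_zero, det_altMat_snoc_zero_of_pos _ e he] at h1
    refine (mul_eq_zero.1 h1).resolve_left
      (mul_ne_zero ?_ (vand_ne_zero MvPolynomial.X_injective))
    exact Finset.prod_ne_zero_iff.2 fun i _ => MvPolynomial.X_ne_zero i
  have h := congrArg (evalAt x) key
  rw [map_evalAt, map_snoc_zero, map_zero] at h
  simpa using h

/-- The exponents `λ_i + n - i` for the partition `λ` with `λ_i = k_i + ⋯ + k_n`. -/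
def partExponent (n : ℕ) (k : ℕ → ℕ) (i : Fin n) : ℕ :=
  (∑ m ∈ Finset.Ico (i : ℕ) n, k m) + (n - 1 - (i : ℕ))

/-- The value at `x` of the Schur polynomial in `n` variables of the partition with
`λ_i = k_i + ⋯ + k_n`. -/
noncomputable def schurVal (n : ℕ) (k : ℕ → ℕ) (x : Fin n → R) : R :=
  evalAt x (altQ n (partExponent n k))

/-- The entry `k n` is the size of the (n+1)-st part. A partition with n + 1 nonzero parts gives a
Schur polynomial divisible by every variable, hence 0 here; otherwise stability applies. -/
lemma schurVal_snoc_zero (k : ℕ → ℕ) (x : Fin n → R) :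
    schurVal (n + 1) k (Fin.snoc (α := fun _ => R) x 0) = if k n = 0 then schurVal n k x else 0 := by
  split_ifs with h
  · rw [schurVal, schurVal, ← evalAt_altQ_snoc_zero x]
    have : partExponent (n + 1) k =
        Fin.snoc (α := fun _ => ℕ) (fun i => partExponent n k i + 1) 0 := by
      ext i
      refine Fin.lastCases ?_ (fun j => ?_) i
      · simp [partExponent, h]
      · simp only [Fin.snoc_castSucc, Fin.val_castSucc, partExponent]
        rw [Finset.sum_Ico_succ_top (by omega), h]
        omega
    rw [this]
  · refine evalAt_altQ_snoc_zero_of_pos _ _ fun i => ?_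
    rw [partExponent, Finset.sum_Ico_succ_top (by omega)]
    omega

lemma snoc_zero_eq {x : ℕ → R} {l : ℕ} (hx : x l = 0) :
    (fun i : Fin (l + 1) => x i) = Fin.snoc (α := fun _ => R) (fun i : Fin l => x i) 0 := by
  ext i
  refine Fin.lastCases ?_ (fun j => ?_) i
  · simp [hx]
  · simp

lemma schurVal_extend_zero {r l : ℕ} (hrl : r ≤ l) (k : ℕ → ℕ) (x : ℕ → R)
    (hx : ∀ m, r ≤ m → x m = 0) (hk : ∀ m, r ≤ m → m < l → k m = 0) :
    schurVal l k (fun i => x i) = schurVal r k (fun i => x i) := by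
  induction l, hrl using Nat.le_induction with
  | base => rfl
  | succ l hl ih =>
    rw [snoc_zero_eq (hx l hl), schurVal_snoc_zero, if_pos (hk l hl (by omega)),
      ih fun m h1 h2 => hk m h1 (by omega)]

lemma schurVal_extend_zero_eq_zero {r l : ℕ} (hrl : r ≤ l) (k : ℕ → ℕ) (x : ℕ → R)
    (hx : ∀ m, r ≤ m → x m = 0) (hk : ∃ m, r ≤ m ∧ m < l ∧ k m ≠ 0) :
    schurVal l k (fun i => x i) = 0 := by
  induction l, hrl using Nat.le_induction with
  | base => obtain ⟨m, h1, h2, -⟩ := hk; omega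
  | succ l hl ih =>
    rw [snoc_zero_eq (hx l hl), schurVal_snoc_zero]
    split_ifs with h
    · obtain ⟨m, h1, h2, h3⟩ := hk
      refine ih ⟨m, h1, lt_of_le_of_ne (by omega) ?_, h3⟩
      rintro rfl; exact h3 h
    · rfl

lemma partExponent_eq_schurExponent (n : ℕ) (k : ℕ → ℕ) (i : Fin n) :
    partExponent n k i = schurExponent n (fun m => k m) i + k (n - 1) := by
  have hi := i.2
  obtain ⟨n, rfl⟩ : ∃ m, n = m + 1 := ⟨n - 1, by omega⟩
  simp only [partExponent, schurExponent, Nat.add_sub_cancel]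
  rw [Finset.sum_Ico_succ_top (by omega)]
  have : ∑ m ∈ Finset.Ico (i : ℕ) n, k m = ∑ m : Fin n, if (i : ℕ) ≤ m then k m else 0 := by
    rw [← Finset.sum_range (fun m => if (i : ℕ) ≤ m then k m else 0), ← Finset.sum_filter]
    refine Finset.sum_congr ?_ fun _ _ => rfl
    ext m
    simp
    omega
  rw [this, add_right_comm]
  rfl

lemma evalAt_altQ_add (x : Fin n → R) (e : Fin n → ℕ) (a : ℕ) :
    evalAt x (altQ n fun i => e i + a) =
      (∏ i, x i) ^ a * evalAt x (altQ n e) := by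
  have key : altQ n (fun i => e i + a) = (∏ i, MvPolynomial.X i) ^ a * altQ n e := by
    have hV := vand_ne_zero (MvPolynomial.X_injective (σ := Fin n) (R := ℤ))
    refine mul_left_cancel₀ hV ?_
    have h1 := vand_mul_evalAt_altQ (fun i => (MvPolynomial.X i : MvPolynomial (Fin n) ℤ)) e
    have h2 := vand_mul_evalAt_altQ (fun i => (MvPolynomial.X i : MvPolynomial (Fin n) ℤ))
      (fun i => e i + a)
    rw [evalAt_X] at h1 h2
    rw [mul_left_comm]
    refine h2.trans ?_
    rw [det_altMat_mul_left, ← h1]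
  rw [key]
  simp [map_prod]

/-- The last difference adds the same amount to every exponent, and so contributes a power of the
product of the variables. This is the origin of the last summation variable of the L-series and of
its character. -/
lemma schurVal_eq (n : ℕ) (k : ℕ → ℕ) (x : Fin n → R) :
    schurVal n k x =
      (∏ i, x i) ^ k (n - 1) * evalAt x (schur n fun m => k m) := by
  rw [schurVal, funext (partExponent_eq_schurExponent n k), evalAt_altQ_add]
  rfl

end Specialization

/-! ### Schur polynomials at inverse variables -/

section Duality

variable {n : ℕ}

/-- Reversing the differences replaces a partition by its complement in the rectangle with n rows
and width ∑ k_m, read from bottom to top. -/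
lemma schurExponent_rev (k : Fin (n - 1) → ℕ) (i : Fin n) :
    schurExponent n (fun m => k m.rev) i.rev + schurExponent n k i = ∑ m, k m + (n - 1) := by
  simp only [schurExponent, Fin.val_rev]
  have : (∑ m : Fin (n - 1), if n - (↑i + 1) ≤ (m : ℕ) then k m.rev else 0) =
      ∑ m : Fin (n - 1), if (i : ℕ) ≤ m then 0 else k m := by
    rw [← Equiv.sum_comp Fin.revPerm]
    refine Finset.sum_congr rfl fun m _ => ?_
    simp only [Fin.revPerm_apply, Fin.rev_rev, Fin.val_rev]
    have := i.2; have := m.2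
    split_ifs <;> first | rfl | omega
  have h2 : (∑ m : Fin (n - 1), if (i : ℕ) ≤ m then 0 else k m) +
      (∑ m : Fin (n - 1), if (i : ℕ) ≤ m then k m else 0) = ∑ m, k m := by
    rw [← Finset.sum_add_distrib]
    refine Finset.sum_congr rfl fun m _ => ?_
    split_ifs <;> simp
  rw [this]
  have := i.2
  omega

/-- Multiplying column j by x_j^{∑k+n-1} turns each power of y_j = x_j⁻¹ into the complementary
power of x_j. The complementary exponents come in reversed row order, whence the sign. -/
lemma det_altMat_inverse {R : Type*} [CommRing R] (k : Fin (n - 1) → ℕ) (x y : Fin n → R)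
    (hxy : ∀ i, x i * y i = 1) :
    (∏ i, x i) ^ (∑ m, k m + (n - 1)) * (altMat y (schurExponent n k)).det =
      Equiv.Perm.sign (Fin.revPerm : Equiv.Perm (Fin n)) *
        (altMat x (schurExponent n fun m => k m.rev)).det := by
  rw [← Matrix.det_permute, ← Finset.prod_pow, ← Matrix.det_mul_row]
  congr 1
  ext i j
  simp only [altMat, Matrix.of_apply, Matrix.submatrix_apply, id, Fin.revPerm_apply]
  rw [← schurExponent_rev k i, pow_add, mul_assoc, ← mul_pow, hxy, one_pow, mul_one]

lemma schur_zero_exponent (n : ℕ) : schurExponent n (fun _ => 0) = fun i : Fin n => n - 1 - (i : ℕ) := by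
  ext i; simp [schurExponent]

lemma evalAt_schur_inverse_of_injective {R : Type*} [CommRing R] [IsDomain R] (k : Fin (n - 1) → ℕ)
    {x y : Fin n → R} (hxy : ∀ i, x i * y i = 1) (hx : Function.Injective x) :
    (∏ i, x i) ^ (∑ m, k m) * evalAt y (schur n k) =
      evalAt x (schur n fun m => k m.rev) := by
  have hy : Function.Injective y := by
    intro i j h
    apply hx
    calc x i = x i * (x j * y j) := by rw [hxy, mul_one]
      _ = x j * (x i * y i) := by rw [h]; ring
      _ = x j := by rw [hxy, mul_one]
  have hx0 : ∏ i, x i ≠ 0 := Finset.prod_ne_zero_iff.2 fun i _ h => by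
    have := hxy i; rw [h, zero_mul] at this; exact zero_ne_one this
  have h1 := det_altMat_inverse k x y hxy
  -- For k = 0 both alternants are Vandermonde determinants; comparison with this case removes the
  -- sign and the factor (∏ x_i)^{n-1}.
  have h2 := det_altMat_inverse (fun _ : Fin (n - 1) => 0) x y hxy
  rw [schur_zero_exponent, det_altMat_delta, det_altMat_delta] at h2
  rw [← vand_mul_evalAt_altQ, ← vand_mul_evalAt_altQ,
    ← mul_assoc (((Equiv.Perm.sign _ : ℤˣ) : ℤ) : R), ← h2] at h1
  refine mul_left_cancel₀ (mul_ne_zero (pow_ne_zero (n - 1) hx0) (vand_ne_zero hy)) ?_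
  simp only [Finset.sum_const_zero, zero_add] at h1
  refine Eq.trans ?_ h1
  rw [pow_add, schur, altQ]
  ring

/-- `S_{k_1,…,k_{n-1}}(x^{-1}) (x_1 ⋯ x_n)^{k_1 + ⋯ + k_{n-1}} = S_{k_{n-1},…,k_1}(x)`. -/
lemma evalAt_schur_inverse {R : Type*} [CommRing R] (k : Fin (n - 1) → ℕ) (x y : Fin n → R)
    (hxy : ∀ i, x i * y i = 1) :
    (∏ i, x i) ^ (∑ m, k m) * evalAt y (schur n k) =
      evalAt x (schur n fun m => k m.rev) := by
  -- The universal case lives in ℤ[X] with the product of the variables inverted: a domain in which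
  -- each X_i has an inverse, and which maps to `R` because the x_i are units.
  obtain ⟨p, hpdef⟩ : ∃ p : MvPolynomial (Fin n) ℤ, p = ∏ i, MvPolynomial.X i := ⟨_, rfl⟩
  have hp : p ≠ 0 := hpdef ▸ Finset.prod_ne_zero_iff.2 fun i _ => MvPolynomial.X_ne_zero i
  have hle : Submonoid.powers p ≤ nonZeroDivisors (MvPolynomial (Fin n) ℤ) :=
    powers_le_nonZeroDivisors_of_noZeroDivisors hp
  have : IsDomain (Localization.Away p) := IsLocalization.isDomain_localization hle
  have hinj : Function.Injective (algebraMap (MvPolynomial (Fin n) ℤ) (Localization.Away p)) :=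
    IsLocalization.injective _ hle
  have hYp : IsUnit (algebraMap _ (Localization.Away p) p) :=
    IsLocalization.Away.algebraMap_isUnit p
  have hYu : ∀ i : Fin n, IsUnit (algebraMap _ (Localization.Away p) (MvPolynomial.X i)) :=
    fun i => isUnit_of_dvd_unit (map_dvd _ (hpdef ▸ Finset.dvd_prod_of_mem _ (Finset.mem_univ i))) hYp
  choose Z hZ using fun i => (hYu i).exists_right_inv
  have key := evalAt_schur_inverse_of_injective k hZ (hinj.comp MvPolynomial.X_injective)
  have hu : IsUnit ((evalAt x) p) := by
    refine IsUnit.of_mul_eq_one (∏ i, y i) ?_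
    simp [hpdef, map_prod, ← Finset.prod_mul_distrib, hxy]
  obtain ⟨g, hg⟩ : ∃ g : Localization.Away p →+* R, ∀ i : Fin n,
      g (algebraMap _ (Localization.Away p) (MvPolynomial.X i)) = x i :=
    ⟨IsLocalization.Away.lift p hu, fun i =>
      (IsLocalization.Away.lift_eq p hu _).trans (evalAt_var x i)⟩
  have hgZ : ∀ i, g (Z i) = y i := fun i => by
    have h := congrArg g (hZ i)
    rw [map_mul, hg, map_one] at h
    calc g (Z i) = (x i * y i) * g (Z i) := by rw [hxy, one_mul]
      _ = y i * (x i * g (Z i)) := by ring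
      _ = y i := by rw [h, mul_one]
  have h := congrArg g key
  rw [map_mul, map_pow, map_prod, map_evalAt, map_evalAt] at h
  simpa only [hg, hgZ] using h

end Duality

/-! ### The Cauchy determinant with cleared denominators -/

section CauchyDeterminant

variable {R : Type*} [CommRing R] {n : ℕ}

lemma reflect_prod_X_sub_C {ι : Type*} (s : Finset ι) (y : ι → R) :
    reflect s.card (∏ m ∈ s, (X - C (y m))) = ∏ m ∈ s, (1 - C (y m) * X) := by
  classical
  induction s using Finset.induction_on with
  | empty => simp
  | insert a s ha ih =>
    rw [Finset.prod_insert ha, Finset.prod_insert ha, Finset.card_insert_of_notMem ha, add_comm,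
      reflect_mul _ _ (natDegree_X_sub_C_le _), ih]
    · congr 1
      rw [reflect_sub, reflect_C, pow_one]
      congr 1
      simp
    · refine (natDegree_prod_le _ _).trans ((Finset.sum_le_card_nsmul _ _ 1 fun i _ =>
        natDegree_X_sub_C_le _).trans (by simp))

lemma natDegree_prod_X_sub_C_le {ι : Type*} (s : Finset ι) (y : ι → R) :
    (∏ m ∈ s, (X - C (y m))).natDegree ≤ s.card :=
  (natDegree_prod_le _ _).trans ((Finset.sum_le_card_nsmul _ _ 1 fun i _ =>
        natDegree_X_sub_C_le _).trans (by simp))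

/-- Separates x from y: for a set of n - 1 indices the product is a row of powers of x times a
column of coefficients in y, so that `det_prod_erase` becomes the determinant of a matrix product.
-/
lemma prod_one_sub_mul (s : Finset (Fin n)) (hs : s.card = n - 1) (hn : 0 < n) (y : Fin n → R)
    (x : R) :
    ∏ m ∈ s, (1 - x * y m) =
      ∑ j : Fin n, x ^ (n - 1 - (j : ℕ)) * (∏ m ∈ s, (X - C (y m))).coeff j := by
  have h1 : ∏ m ∈ s, (1 - x * y m) = (reflect s.card (∏ m ∈ s, (X - C (y m)))).eval x := by
    rw [reflect_prod_X_sub_C, eval_prod]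
    refine Finset.prod_congr rfl fun m _ => ?_
    simp only [eval_sub, eval_one, eval_mul, eval_C, eval_X, mul_comm]
  have h2 : (reflect s.card (∏ m ∈ s, (X - C (y m)))).natDegree < n := by
    refine natDegree_reflect_le.trans_lt ?_
    have := natDegree_prod_X_sub_C_le s y
    rw [max_lt_iff]
    omega
  rw [h1, eval_eq_sum_rev _ h2]
  refine Finset.sum_congr rfl fun j _ => ?_
  rw [mul_comm, coeff_reflect, hs, revAt_le (by omega)]
  congr 2
  have := j.2
  omega

/-- The coefficients of the polynomials `∏_{m ≠ k} (X - y_m)`. -/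
noncomputable def omitMat (y : Fin n → R) : Matrix (Fin n) (Fin n) R :=
  Matrix.of fun j k => (∏ m ∈ Finset.univ.erase k, (X - C (y m))).coeff j

lemma prod_erase_eq (y : Fin n → R) :
    ∏ i, ∏ m ∈ Finset.univ.erase i, (y i - y m) =
      (∏ i : Fin n, ∏ j ∈ Finset.Ioi i, (y j - y i)) * vand y := by
  have h1 : ∀ i : Fin n, Finset.univ.erase i = Finset.Iio i ∪ Finset.Ioi i := by
    intro i; ext j; simp [lt_or_lt_iff_ne]
  have h2 : ∀ i : Fin n, Disjoint (Finset.Iio i) (Finset.Ioi i) := by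
    intro i
    rw [Finset.disjoint_left]
    intro j h3 h4
    exact absurd (Finset.mem_Iio.1 h3) (Finset.mem_Ioi.1 h4).asymm
  simp_rw [h1, Finset.prod_union (h2 _), Finset.prod_mul_distrib]
  rw [vand]
  congr 1
  exact Finset.prod_comm' (by simp)

/-- Lagrange interpolation: the polynomial omitting the root y_k vanishes at every y_i with i ≠ k,
so the Vandermonde matrix times `omitMat` is diagonal. The product of the diagonal entries is a
Vandermonde determinant times `vand y`. -/
lemma det_omitMat_of_injective [IsDomain R] {y : Fin n → R} (hy : Function.Injective y) :
    (omitMat y).det = vand y := by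
  have key : Matrix.vandermonde y * omitMat y =
      Matrix.diagonal fun i => ∏ m ∈ Finset.univ.erase i, (y i - y m) := by
    ext i k
    rw [Matrix.mul_apply]
    have h1 : (∏ m ∈ Finset.univ.erase k, (X - C (y m))).natDegree < n := by
      refine (natDegree_prod_X_sub_C_le _ y).trans_lt ?_
      rw [Finset.card_erase_of_mem (Finset.mem_univ k), Finset.card_univ, Fintype.card_fin]
      have := k.2
      omega
    have h2 : ∑ j, Matrix.vandermonde y i j * omitMat y j k =
        (∏ m ∈ Finset.univ.erase k, (X - C (y m))).eval (y i) := by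
      rw [eval_eq_sum_range' h1, Finset.sum_range]
      simp [omitMat, Matrix.vandermonde_apply, mul_comm]
    rw [h2, eval_prod]
    by_cases hik : i = k
    · subst hik
      simp
    · rw [Matrix.diagonal_apply_ne _ hik]
      exact Finset.prod_eq_zero (Finset.mem_erase.2 ⟨hik, Finset.mem_univ i⟩) (by simp)
  have h := congrArg Matrix.det key
  rw [Matrix.det_mul, Matrix.det_diagonal, prod_erase_eq, Matrix.det_vandermonde] at h
  refine mul_left_cancel₀ ?_ h
  refine Finset.prod_ne_zero_iff.2 fun i _ => Finset.prod_ne_zero_iff.2 fun j hj => ?_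
  rw [sub_ne_zero]
  exact hy.ne (Finset.mem_Ioi.1 hj).ne'

lemma det_omitMat (y : Fin n → R) : (omitMat y).det = vand y := by
  have key := congrArg (evalAt y)
    (det_omitMat_of_injective (MvPolynomial.X_injective (σ := Fin n) (R := ℤ)))
  rw [map_vand, RingHom.map_det] at key
  simp only [evalAt_var] at key
  rw [← key]
  congr 1
  ext j k
  simp only [omitMat, RingHom.mapMatrix_apply, Matrix.map_apply, Matrix.of_apply]
  rw [← coeff_map, Polynomial.map_prod]
  simp

/-- The matrix is a transposed Vandermonde matrix in x times the coefficient matrix `omitMat y`;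
both determinants are known. -/
lemma det_prod_erase (x y : Fin n → R) :
    (Matrix.of fun i k => ∏ m ∈ Finset.univ.erase k, (1 - x i * y m)).det = vand x * vand y := by
  rw [← det_altMat_delta x, ← Matrix.det_transpose (altMat x _), ← det_omitMat, ← Matrix.det_mul]
  congr 1
  ext i k
  rw [Matrix.mul_apply, Matrix.of_apply, prod_one_sub_mul _ (by simp) (by have := k.2; omega)]
  rfl

end CauchyDeterminant

/-! ### Partitions and strictly decreasing exponent vectors -/

section Partitions

/-- Extension of a finite sequence by zeros. -/
def zeroPad {n : ℕ} (k : Fin n → ℕ) (m : ℕ) : ℕ := if h : m < n then k ⟨m, h⟩ else 0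

@[simp]
lemma zeroPad_val {n : ℕ} (k : Fin n → ℕ) (i : Fin n) : zeroPad k i = k i := by
  simp [zeroPad]

/-- The size `k_1 + 2 k_2 + ⋯ + n k_n` of the partition with `λ_i = k_i + ⋯ + k_n`. -/
def partSize {n : ℕ} (k : Fin n → ℕ) : ℕ := ∑ i : Fin n, ((i : ℕ) + 1) * k i

/-- The sequences `k` with `partSize k = M`. -/
def partsOfSize (n M : ℕ) : Finset (Fin n → ℕ) :=
  (Fintype.piFinset fun _ => Finset.range (M + 1)).filter fun k => partSize k = M

lemma mem_partsOfSize {n M : ℕ} {k : Fin n → ℕ} : k ∈ partsOfSize n M ↔ partSize k = M := by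
  rw [partsOfSize, Finset.mem_filter, and_iff_right_iff_imp]
  intro h
  rw [Fintype.mem_piFinset]
  intro i
  rw [Finset.mem_range, Nat.lt_succ_iff, ← h]
  calc k i ≤ ((i : ℕ) + 1) * k i := Nat.le_mul_of_pos_left _ (by omega)
    _ ≤ partSize k := Finset.single_le_sum (f := fun i : Fin n => ((i : ℕ) + 1) * k i)
        (fun _ _ => Nat.zero_le _) (Finset.mem_univ i)

lemma partExponent_last {n : ℕ} (k : ℕ → ℕ) : partExponent (n + 1) k (Fin.last n) = k n := by
  simp [partExponent]

lemma partExponent_castSucc {n : ℕ} (k : ℕ → ℕ) (i : Fin n) :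
    partExponent (n + 1) k i.castSucc = partExponent (n + 1) k i.succ + k i + 1 := by
  have := i.2
  simp only [partExponent, Fin.val_castSucc, Fin.val_succ]
  rw [Finset.sum_eq_sum_Ico_succ_bot (by omega)]
  omega

lemma partExponent_strictAnti (n : ℕ) (k : ℕ → ℕ) : StrictAnti (partExponent n k) := by
  rcases n with _ | n
  · intro i; exact i.elim0
  · exact Fin.strictAnti_iff_succ_lt.2 fun i => by rw [partExponent_castSucc]; omega

lemma sum_partExponent {n : ℕ} (k : Fin n → ℕ) :
    ∑ i, partExponent n (zeroPad k) i = partSize k + ∑ i : Fin n, (n - 1 - (i : ℕ)) := by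
  simp only [partExponent, Finset.sum_add_distrib]
  congr 1
  have h : ∀ i : Fin n, ∑ m ∈ Finset.Ico (i : ℕ) n, zeroPad k m =
      ∑ m : Fin n, if (i : ℕ) ≤ m then k m else 0 := by
    intro i
    have : ∑ m : Fin n, (if (i : ℕ) ≤ m then k m else 0) =
        ∑ m : Fin n, if (i : ℕ) ≤ m then zeroPad k m else 0 := by simp
    rw [this, ← Finset.sum_range (fun m => if (i : ℕ) ≤ m then zeroPad k m else 0),
      ← Finset.sum_filter]
    refine Finset.sum_congr ?_ fun _ _ => rfl
    ext m
    simp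
    omega
  simp_rw [h]
  rw [Finset.sum_comm, partSize]
  refine Finset.sum_congr rfl fun m _ => ?_
  rw [← Finset.sum_filter, Finset.sum_const, smul_eq_mul]
  congr 1
  have : (Finset.univ.filter fun i : Fin n => (i : ℕ) ≤ m) = Finset.Iic m := by
    ext i; rw [Finset.mem_filter, Finset.mem_Iic, Fin.le_def]; simp
  rw [this, Fin.card_Iic]

lemma partExponent_injective {n : ℕ} {k k' : Fin n → ℕ}
    (h : partExponent n (zeroPad k) = partExponent n (zeroPad k')) : k = k' := by
  rcases n with _ | n
  · ext i; exact i.elim0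
  ext i
  rw [← zeroPad_val k, ← zeroPad_val k']
  refine Fin.lastCases ?_ (fun j => ?_) i
  · have := congrFun h (Fin.last n)
    rwa [partExponent_last, partExponent_last] at this
  · have h1 := congrFun h j.castSucc
    have h2 := congrFun h j.succ
    rw [partExponent_castSucc, partExponent_castSucc, h2] at h1
    simp only [Fin.val_castSucc]
    omega

lemma exists_partExponent_eq {n : ℕ} {e : Fin n → ℕ} (he : StrictAnti e) :
    ∃ k : Fin n → ℕ, partExponent n (zeroPad k) = e := by
  rcases n with _ | n
  · exact ⟨0, funext fun i => i.elim0⟩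
  -- Consecutive exponents differ by k_i + 1 and the last exponent is k_n itself; the witness reads
  -- k off from these.
  refine ⟨Fin.lastCases (e (Fin.last n)) fun i => e i.castSucc - e i.succ - 1, ?_⟩
  set k : Fin (n + 1) → ℕ := Fin.lastCases (e (Fin.last n)) fun i => e i.castSucc - e i.succ - 1
  ext i
  induction i using Fin.reverseInduction with
  | last =>
    have := zeroPad_val k (Fin.last n)
    rw [Fin.val_last] at this
    rw [partExponent_last, this]
    simp [k]
  | cast i ih =>
    have := zeroPad_val k i.castSucc
    rw [Fin.val_castSucc] at this
    rw [partExponent_castSucc, ih, this]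
    have h := Fin.strictAnti_iff_succ_lt.1 he i
    simp only [k, Fin.lastCases_castSucc]
    omega

/-- Sorting an injective exponent vector decreasingly gives the exponents of a partition. With the
uniqueness in `partExponent_comp_injective`, injective vectors are pairs of a partition and a
permutation, which is what regroups the determinant in `det_geomMat`. -/
lemma exists_partExponent_comp {n : ℕ} {e : Fin n → ℕ} (he : Function.Injective e) :
    ∃ (k : Fin n → ℕ) (σ : Equiv.Perm (Fin n)), (fun i => partExponent n (zeroPad k) (σ i)) = e := by
  have h := Tuple.monotone_sort fun i => OrderDual.toDual (e i)
  set τ := Tuple.sort fun i => OrderDual.toDual (e i)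
  have h2 : StrictAnti fun i => e (τ i) := by
    have h3 : Antitone fun i => e (τ i) := fun i j hij => h hij
    exact h3.strictAnti_of_injective (he.comp τ.injective)
  obtain ⟨k, hk⟩ := exists_partExponent_eq h2
  exact ⟨k, τ⁻¹, funext fun i => by simp [hk]⟩

lemma partExponent_comp_injective {n : ℕ} {k k' : Fin n → ℕ} {σ σ' : Equiv.Perm (Fin n)}
    (h : (fun i => partExponent n (zeroPad k) (σ i)) =
      fun i => partExponent n (zeroPad k') (σ' i)) : k = k' ∧ σ = σ' := by
  have hk : partExponent n (zeroPad k) = partExponent n (zeroPad k') := by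
    refine ((partExponent_strictAnti n _).range_inj (partExponent_strictAnti n _)).1 ?_
    calc Set.range (partExponent n (zeroPad k)) = Set.range (partExponent n (zeroPad k) ∘ σ) :=
          (σ.surjective.range_comp _).symm
      _ = Set.range (partExponent n (zeroPad k') ∘ σ') := congrArg Set.range h
      _ = Set.range (partExponent n (zeroPad k')) := σ'.surjective.range_comp _
  refine ⟨partExponent_injective hk, ?_⟩
  ext i
  have := congrFun h i
  simp only [hk] at this
  rw [(partExponent_strictAnti n _).injective this]

end Partitions

/-! ### The Cauchy identity -/

section CauchyIdentity

variable {R : Type*} [CommRing R] {n : ℕ}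

/-- The generating series `∑_λ s_λ(x) s_λ(y) T^{|λ|}`, with `λ` having at most `n` parts. -/
noncomputable def schurSeries {n m : ℕ} (x : Fin n → R) (y : Fin m → R) : PowerSeries R :=
  PowerSeries.mk fun M => ∑ k ∈ partsOfSize n M,
    schurVal n (zeroPad k) x * schurVal m (zeroPad k) y

/-- `∏_{i,j} (1 - x_i y_j T)`. -/
noncomputable def cauchyProd {n m : ℕ} (x : Fin n → R) (y : Fin m → R) : R[X] :=
  ∏ i, ∏ j, (1 - C (x i * y j) * X)

lemma one_sub_mul_geometric (a : R) :
    ((1 - C a * X : R[X]) : PowerSeries R) * PowerSeries.mk (fun m => a ^ m) = 1 := by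
  ext m
  rcases m with _ | m
  · simp [sub_mul, mul_assoc]
  · simp only [Polynomial.coe_sub, Polynomial.coe_one, Polynomial.coe_mul, Polynomial.coe_C,
      Polynomial.coe_X, sub_mul, one_mul, map_sub, mul_assoc, PowerSeries.coeff_C_mul,
      PowerSeries.coeff_succ_X_mul, PowerSeries.coeff_mk, PowerSeries.coeff_one]
    simp [pow_succ']

/-- The matrix of geometric series `1 / (1 - x_i y_j T)`. -/
noncomputable def geomMat (x y : Fin n → R) : Matrix (Fin n) (Fin n) (PowerSeries R) :=
  Matrix.of fun i j => PowerSeries.mk fun m => (x i * y j) ^ m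

lemma coe_powerSeries_prod {ι : Type*} (s : Finset ι) (f : ι → R[X]) :
    ((∏ i ∈ s, f i : R[X]) : PowerSeries R) = ∏ i ∈ s, (f i : PowerSeries R) := by
  simpa only [Polynomial.coeToPowerSeries.ringHom_apply] using
    map_prod (Polynomial.coeToPowerSeries.ringHom (R := R)) f s

/-- Multiplying row i by ∏_j (1 - x_i y_j T) leaves the products omitting one index, to which the
Cauchy determinant applies with x replaced by Tx; homogeneity of the Vandermonde determinant gives
the power of T. -/
lemma cauchyProd_mul_det (x y : Fin n → R) :
    (cauchyProd x y : PowerSeries R) * (geomMat x y).det =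
      PowerSeries.X ^ (∑ i : Fin n, (n - 1 - (i : ℕ))) * PowerSeries.C (vand x * vand y) := by
  have h1 : (cauchyProd x y : PowerSeries R) =
      ∏ i, ((∏ j, (1 - C (x i * y j) * X) : R[X]) : PowerSeries R) := by
    rw [cauchyProd]
    exact coe_powerSeries_prod _ _
  have h2 : (Matrix.of fun i j => ((∏ j, (1 - C (x i * y j) * X) : R[X]) : PowerSeries R) *
      geomMat x y i j) = Matrix.of fun i k => ∏ m ∈ Finset.univ.erase k,
        (1 - (PowerSeries.X * PowerSeries.C (x i)) * PowerSeries.C (y m)) := by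
    ext1 i k
    simp only [Matrix.of_apply]
    rw [← Finset.mul_prod_erase _ _ (Finset.mem_univ k), Polynomial.coe_mul, mul_right_comm,
      geomMat, Matrix.of_apply, one_sub_mul_geometric, one_mul]
    rw [coe_powerSeries_prod]
    refine Finset.prod_congr rfl fun m _ => ?_
    simp
    ring
  rw [h1, ← Matrix.det_mul_column, h2, det_prod_erase, ← det_altMat_delta, det_altMat_scale,
    det_altMat_delta, ← map_vand, ← map_vand, map_mul, mul_assoc]

/-- In the Leibniz expansion choose the term of degree `l i` from the series in column i. For fixed
`l` the powers of y factor out and the sum over permutations is an alternant in x. -/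
lemma coeff_det_geomMat (x y : Fin n → R) (M : ℕ) :
    PowerSeries.coeff M (geomMat x y).det = ∑ l ∈ Finset.univ.finsuppAntidiag M,
      (∏ i, y i ^ l i) * (altMat x l).det := by
  rw [Matrix.det_apply', map_sum]
  have h : ∀ σ : Equiv.Perm (Fin n),
      PowerSeries.coeff M (((Equiv.Perm.sign σ : ℤ) : PowerSeries R) * ∏ i, geomMat x y (σ i) i) =
      ∑ l ∈ Finset.univ.finsuppAntidiag M,
        (∏ i, y i ^ l i) * (((Equiv.Perm.sign σ : ℤ) : R) * ∏ i, x (σ i) ^ l i) := by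
    intro σ
    rw [← map_intCast (PowerSeries.C (R := R)), PowerSeries.coeff_C_mul, PowerSeries.coeff_prod,
      Finset.mul_sum]
    refine Finset.sum_congr rfl fun l _ => ?_
    simp only [geomMat, Matrix.of_apply, PowerSeries.coeff_mk, mul_pow, Finset.prod_mul_distrib]
    ring
  rw [Finset.sum_congr rfl fun σ _ => h σ, Finset.sum_comm]
  refine Finset.sum_congr rfl fun l _ => ?_
  rw [← Finset.mul_sum, ← Matrix.det_transpose, Matrix.det_apply']
  rfl

lemma det_altMat_eq_zero (x : Fin n → R) {e : Fin n → ℕ} (he : ¬ Function.Injective e) :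
    (altMat x e).det = 0 := by
  simp only [Function.Injective, not_forall] at he
  obtain ⟨i, j, hij, hne⟩ := he
  refine Matrix.det_zero_of_row_eq hne ?_
  ext m
  simp [altMat, hij]

lemma det_altMat_comp (x : Fin n → R) (e : Fin n → ℕ) (σ : Equiv.Perm (Fin n)) :
    (altMat x fun i => e (σ i)).det = Equiv.Perm.sign σ * (altMat x e).det := by
  rw [← Matrix.det_permute]
  rfl

lemma sum_sign_mul_prod (y : Fin n → R) (e : Fin n → ℕ) :
    ∑ σ : Equiv.Perm (Fin n), ((Equiv.Perm.sign σ : ℤ) : R) * ∏ i, y i ^ e (σ i) =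
      (altMat y e).det := by
  rw [Matrix.det_apply']
  rfl

/-- The Cauchy–Binet argument: exponent vectors with a repetition contribute 0, each other one is a
partition exponent vector permuted in a unique way, and the signed sum over the permutations builds
the alternant in y. Dividing both alternants by Vandermonde determinants gives the Schur values. -/
lemma det_geomMat (x y : Fin n → R) :
    (geomMat x y).det = PowerSeries.X ^ (∑ i : Fin n, (n - 1 - (i : ℕ))) *
      (PowerSeries.C (vand x * vand y) * schurSeries x y) := by
  ext M
  rw [coeff_det_geomMat, PowerSeries.coeff_X_pow_mul']
  have hinj : ∀ l ∈ Finset.univ.finsuppAntidiag M, Function.Injective l → ∃ (k : Fin n → ℕ)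
      (σ : Equiv.Perm (Fin n)), (fun i => partExponent n (zeroPad k) (σ i)) = l ∧
      partSize k + ∑ i : Fin n, (n - 1 - (i : ℕ)) = M := by
    intro l hl hli
    obtain ⟨k, σ, h⟩ := exists_partExponent_comp hli
    refine ⟨k, σ, h, ?_⟩
    rw [← (Finset.mem_finsuppAntidiag.1 hl).1, ← sum_partExponent, ← h,
      Equiv.sum_comp σ (partExponent n (zeroPad k))]
  split_ifs with hM
  · rw [PowerSeries.coeff_C_mul, schurSeries, PowerSeries.coeff_mk]
    set D := ∑ i : Fin n, (n - 1 - (i : ℕ))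
    have h1 : vand x * vand y * ∑ k ∈ partsOfSize n (M - D),
        schurVal n (zeroPad k) x * schurVal n (zeroPad k) y =
        ∑ p ∈ partsOfSize n (M - D) ×ˢ (Finset.univ : Finset (Equiv.Perm (Fin n))),
          (∏ i, y i ^ partExponent n (zeroPad p.1) (p.2 i)) *
            (altMat x fun i => partExponent n (zeroPad p.1) (p.2 i)).det := by
      rw [Finset.sum_product, Finset.mul_sum]
      refine Finset.sum_congr rfl fun k _ => ?_
      simp only [det_altMat_comp, ← mul_assoc]
      rw [← Finset.sum_mul]
      have := sum_sign_mul_prod y (partExponent n (zeroPad k))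
      simp only [mul_comm (∏ i, y i ^ _)]
      rw [this, ← vand_mul_evalAt_altQ, ← vand_mul_evalAt_altQ, schurVal, schurVal]
      ring
    rw [h1]
    symm
    -- The pairs (partition, permutation) are embedded into all exponent vectors of sum `M`; the
    -- vectors not reached have a repeated entry.
    refine Finset.sum_of_injOn
      (fun p => Finsupp.equivFunOnFinite.symm fun i => partExponent n (zeroPad p.1) (p.2 i))
      ?_ ?_ ?_ ?_
    · rintro ⟨k, σ⟩ - ⟨k', σ'⟩ - h
      obtain ⟨rfl, rfl⟩ := partExponent_comp_injective (Finsupp.equivFunOnFinite.symm.injective h)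
      rfl
    · rintro ⟨k, σ⟩ hk
      rw [Finset.mem_coe, Finset.mem_product, mem_partsOfSize] at hk
      rw [Finset.mem_coe, Finset.mem_finsuppAntidiag]
      refine ⟨?_, Finset.subset_univ _⟩
      have := sum_partExponent k
      rw [hk.1] at this
      simp only [Finsupp.equivFunOnFinite_symm_apply_apply]
      rw [Equiv.sum_comp σ (partExponent n (zeroPad k)), this]
      omega
    · intro l hl hl2
      rw [det_altMat_eq_zero, mul_zero]
      intro hli
      obtain ⟨k, σ, h, hs⟩ := hinj l hl hli
      refine hl2 ⟨(k, σ), ?_, ?_⟩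
      · rw [Finset.mem_coe, Finset.mem_product, mem_partsOfSize]
        exact ⟨by simp only; omega, Finset.mem_univ _⟩
      · ext i
        exact congrFun h i
    · intro p _
      rfl
  -- An injective exponent vector has sum at least 0 + 1 + ⋯ + (n - 1), so none occurs in this low
  -- degree.
  · refine Finset.sum_eq_zero fun l hl => ?_
    rw [det_altMat_eq_zero, mul_zero]
    intro hli
    obtain ⟨k, σ, -, h⟩ := hinj l hl hli
    omega

/-- `cauchyProd_mul_det` and `det_geomMat` evaluate the determinant of geometric series in two ways;
their common factor is nonzero for distinct arguments. -/
lemma cauchyProd_mul_schurSeries_of_injective [IsDomain R] {x y : Fin n → R}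
    (hx : Function.Injective x) (hy : Function.Injective y) :
    (cauchyProd x y : PowerSeries R) * schurSeries x y = 1 := by
  have h := cauchyProd_mul_det x y
  rw [det_geomMat] at h
  have h0 : PowerSeries.X ^ (∑ i : Fin n, (n - 1 - (i : ℕ))) * PowerSeries.C (vand x * vand y) ≠ 0 :=
    mul_ne_zero (pow_ne_zero _ PowerSeries.X_ne_zero)
      ((map_ne_zero_iff _ PowerSeries.C_injective).2 (mul_ne_zero (vand_ne_zero hx) (vand_ne_zero hy)))
  refine mul_left_cancel₀ h0 ?_
  rw [mul_one]
  refine Eq.trans ?_ h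
  ring

lemma map_schurVal {S : Type*} [CommRing S] (g : R →+* S) (k : ℕ → ℕ) (x : Fin n → R) :
    g (schurVal n k x) = schurVal n k fun i => g (x i) := map_evalAt g x _

lemma map_schurSeries {S : Type*} [CommRing S] (g : R →+* S) {m : ℕ} (x : Fin n → R)
    (y : Fin m → R) : PowerSeries.map g (schurSeries x y) =
      schurSeries (fun i => g (x i)) fun i => g (y i) := by
  ext M
  simp [schurSeries, map_schurVal]

lemma map_cauchyProd {S : Type*} [CommRing S] (g : R →+* S) {m : ℕ} (x : Fin n → R)
    (y : Fin m → R) : (cauchyProd x y).map g = cauchyProd (fun i => g (x i)) fun i => g (y i) := by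
  simp [cauchyProd, Polynomial.map_prod]

lemma cauchyProd_mul_schurSeries (x y : Fin n → R) :
    (cauchyProd x y : PowerSeries R) * schurSeries x y = 1 := by
  have hX := MvPolynomial.X_injective (R := ℤ) (σ := Fin n ⊕ Fin n)
  have h := congrArg (PowerSeries.map (evalAt (Sum.elim x y))) (cauchyProd_mul_schurSeries_of_injective
    (hX.comp Sum.inl_injective) (hX.comp Sum.inr_injective))
  rw [map_mul, ← Polynomial.polynomial_map_coe, map_cauchyProd, map_schurSeries, map_one] at h
  simpa using h

lemma partSize_zeroPad {r l : ℕ} (hrl : r ≤ l) (k : Fin r → ℕ) :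
    partSize (fun i : Fin l => zeroPad k i) = partSize k := by
  have h : ∀ n (f : ℕ → ℕ), partSize (fun i : Fin n => f i) = ∑ i ∈ Finset.range n, (i + 1) * f i := by
    intro n f
    rw [partSize, Finset.sum_range]
  rw [h, ← Finset.sum_subset (Finset.range_mono hrl), ← h]
  · simp
  · intro m _ hm
    have : ¬ m < r := by simpa using hm
    simp [zeroPad, this]

lemma zeroPad_zeroPad {r l : ℕ} (hrl : r ≤ l) (k : Fin r → ℕ) :
    zeroPad (fun i : Fin l => zeroPad k i) = zeroPad k := by
  ext m
  simp only [zeroPad]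
  split_ifs <;> first | rfl | omega

/-- The Cauchy identity, for `r` variables `x_i` and `l ≥ r` variables `y_j`. -/
theorem cauchy_identity {r l : ℕ} (hrl : r ≤ l) (x : Fin r → R) (y : Fin l → R) :
    (cauchyProd x y : PowerSeries R) * schurSeries x y = 1 := by
  -- Pad the shorter family by zeros. The factors 1 - 0 are trivial, partitions with more than r
  -- parts contribute 0, and on the others the Schur values are unchanged.
  set x' : ℕ → R := fun m => if h : m < r then x ⟨m, h⟩ else 0 with hx'
  have hxx : (fun i : Fin r => x' i) = x := by ext i; simp [x']
  have hx0 : ∀ m, r ≤ m → x' m = 0 := fun m hm => by simp [x', hm]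
  have h := cauchyProd_mul_schurSeries (fun i : Fin l => x' i) y
  have h1 : cauchyProd (fun i : Fin l => x' i) y = cauchyProd x y := by
    have h : ∀ n, cauchyProd (fun i : Fin n => x' i) y =
        ∏ i ∈ Finset.range n, ∏ j, (1 - C (x' i * y j) * X) := by
      intro n
      rw [cauchyProd, Finset.prod_range]
    rw [h, ← Finset.prod_subset (Finset.range_mono hrl), ← h, hxx]
    intro m _ hm
    rw [hx0 m (by simpa using hm)]
    simp
  have h2 : schurSeries (fun i : Fin l => x' i) y = schurSeries x y := by
    ext M
    rw [schurSeries, schurSeries, PowerSeries.coeff_mk, PowerSeries.coeff_mk]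
    symm
    refine Finset.sum_of_injOn (fun k i => zeroPad k i) ?_ ?_ ?_ ?_
    · intro k _ k' _ h
      ext i
      have := congrFun h ⟨i, i.2.trans_le hrl⟩
      simpa using this
    · intro k hk
      rw [Finset.mem_coe, mem_partsOfSize] at hk ⊢
      rw [partSize_zeroPad hrl, hk]
    · intro k hk hk2
      rw [schurVal_extend_zero_eq_zero hrl (zeroPad k) x' hx0, zero_mul]
      by_contra! hcon
      refine hk2 ⟨fun i => k ⟨i, i.2.trans_le hrl⟩, ?_, ?_⟩
      all_goals
        have hk' : (fun i : Fin l => zeroPad (fun i : Fin r => k ⟨i, i.2.trans_le hrl⟩) i) = k := by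
          ext i
          by_cases hi : (i : ℕ) < r
          · simp [zeroPad, hi]
          · have := hcon i (not_lt.1 hi) i.2
            rw [zeroPad_val] at this
            simp [zeroPad, hi, this]
      · rw [Finset.mem_coe, mem_partsOfSize, ← partSize_zeroPad hrl, hk']
        exact mem_partsOfSize.1 hk
      · exact hk'
    · intro k _
      rw [zeroPad_zeroPad hrl, schurVal_extend_zero hrl _ x' hx0, hxx]
      intro m hm _
      simp [zeroPad, not_lt.2 hm]
  rwa [h1, h2] at h

end CauchyIdentity

/-! ### Symmetric functions of roots in terms of coefficients, and their degrees -/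

section SymmetricValues

variable {R : Type*} [CommRing R] {n : ℕ}

/-- The fundamental theorem on symmetric polynomials over ℤ. It allows values at the roots of a
polynomial to be computed inside the coefficient ring, which gives both integrality in A and degree
bounds. -/
lemma exists_esymm_expression {S : MvPolynomial (Fin n) ℤ} (hS : S.IsSymmetric) :
    ∃ G : MvPolynomial (Fin n) ℤ,
      evalAt (fun i : Fin n => MvPolynomial.esymm (Fin n) ℤ (i + 1)) G = S := by
  obtain ⟨G, hG⟩ := (MvPolynomial.esymmAlgEquiv (Fin n) ℤ (Fintype.card_fin n)).surjective ⟨S, hS⟩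
  refine ⟨G, ?_⟩
  have h := congrArg Subtype.val hG
  rw [← aeval_eq_evalAt, ← MvPolynomial.esymmAlgHom_apply]
  exact h

/-- An expression of a symmetric polynomial in terms of the elementary symmetric ones. -/
noncomputable def symPoly (S : MvPolynomial (Fin n) ℤ) : MvPolynomial (Fin n) ℤ :=
  Function.invFun (evalAt fun i : Fin n => MvPolynomial.esymm (Fin n) ℤ (i + 1)) S

lemma evalAt_symPoly {S : MvPolynomial (Fin n) ℤ} (hS : S.IsSymmetric) :
    evalAt (fun i : Fin n => MvPolynomial.esymm (Fin n) ℤ (i + 1)) (symPoly S) = S :=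
  Function.invFun_eq (exists_esymm_expression hS)

/-- The value of the symmetric polynomial `S` at the roots of a monic polynomial of degree `n`,
computed from its coefficients. -/
noncomputable def symEval (S : MvPolynomial (Fin n) ℤ) (P : R[X]) : R :=
  evalAt (fun i : Fin n => (-1) ^ ((i : ℕ) + 1) * P.coeff (n - 1 - i)) (symPoly S)

lemma map_symEval {T : Type*} [CommRing T] (g : R →+* T) (S : MvPolynomial (Fin n) ℤ) (P : R[X]) :
    g (symEval S P) = symEval S (P.map g) := by
  rw [symEval, symEval, map_evalAt]
  simp

lemma evalAt_esymm (x : Fin n → R) (i : Fin n) :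
    evalAt x (MvPolynomial.esymm (Fin n) ℤ (i + 1)) =
      (-1) ^ ((i : ℕ) + 1) * (∏ j, (X - C (x j))).coeff (n - 1 - i) := by
  have hi := i.2
  rw [← aeval_eq_evalAt, MvPolynomial.aeval_esymm_eq_multiset_esymm]
  have h := Multiset.prod_X_sub_C_coeff (Finset.univ.val.map x) (k := n - 1 - i)
    (by simp; omega)
  rw [Multiset.map_map] at h
  have h2 : (Finset.univ.val.map x).card - (n - 1 - i) = i + 1 := by simp; omega
  rw [h2] at h
  change (∏ j, (X - C (x j))).coeff (n - 1 - i) = _ at h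
  rw [h, ← mul_assoc, ← mul_pow]
  simp

lemma symEval_prod {S : MvPolynomial (Fin n) ℤ} (hS : S.IsSymmetric) (x : Fin n → R) :
    symEval S (∏ j, (X - C (x j))) = evalAt x S := by
  conv_rhs => rw [← evalAt_symPoly hS, map_evalAt]
  rw [symEval]
  simp_rw [evalAt_esymm]

lemma evalAt_esymm_scale (c : R) (x : Fin n → R) (m : ℕ) :
    evalAt (fun i => c * x i) (MvPolynomial.esymm (Fin n) ℤ m) =
      c ^ m * evalAt x (MvPolynomial.esymm (Fin n) ℤ m) := by
  simp only [MvPolynomial.esymm, map_sum, map_prod, evalAt_var, Finset.prod_mul_distrib,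
    Finset.mul_sum, Finset.prod_const]
  refine Finset.sum_congr rfl fun t ht => ?_
  rw [(Finset.mem_powersetCard.1 ht).2]

lemma exists_prod_eq {k : Type*} [Field k] [IsAlgClosed k] {P : k[X]} (hP : P.Monic)
    (hn : P.natDegree = n) : ∃ x : Fin n → k, P = ∏ j, (X - C (x j)) := by
  have hs := IsAlgClosed.splits P
  have hcard : P.roots.card = n := by rw [← hn]; exact hs.natDegree_eq_card_roots.symm
  obtain ⟨L, hL⟩ : ∃ L : List k, (L : Multiset k) = P.roots := ⟨_, Multiset.coe_toList _⟩
  rw [← hL, Multiset.coe_card] at hcard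
  subst hcard
  refine ⟨L.get, ?_⟩
  conv_lhs => rw [hs.eq_prod_roots_of_monic hP, ← hL]
  rw [Multiset.map_coe, Multiset.prod_coe, ← List.prod_ofFn]
  congr 1
  refine List.ext_getElem (by simp) fun i h1 h2 => by simp

/-- Scaling all roots by c multiplies the m-th elementary symmetric function by c^m and a
bialternant of degree N by c^N; both sides compute the same scaled value. -/
lemma symEval_scale {k : Type*} [Field k] [IsAlgClosed k] {P : k[X]} (hP : P.Monic)
    (hn : P.natDegree = n) (c : k) (e : Fin n → ℕ) {N : ℕ}
    (hN : ∑ i, e i = N + ∑ i : Fin n, (n - 1 - (i : ℕ))) :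
    evalAt (fun i : Fin n => c ^ ((i : ℕ) + 1) * ((-1) ^ ((i : ℕ) + 1) * P.coeff (n - 1 - i)))
      (symPoly (altQ n e)) = c ^ N * symEval (altQ n e) P := by
  obtain ⟨x, rfl⟩ := exists_prod_eq hP hn
  rw [symEval_prod (altQ_isSymmetric n e), ← evalAt_altQ_scale c x e hN]
  conv_rhs => rw [← evalAt_symPoly (altQ_isSymmetric n e), map_evalAt]
  simp_rw [← evalAt_esymm, evalAt_esymm_scale]

lemma symEval_scale_of_isDomain [IsDomain R] {P : R[X]} (hP : P.Monic)
    (hn : P.natDegree = n) (c : R) (e : Fin n → ℕ) {N : ℕ}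
    (hN : ∑ i, e i = N + ∑ i : Fin n, (n - 1 - (i : ℕ))) :
    evalAt (fun i : Fin n => c ^ ((i : ℕ) + 1) * ((-1) ^ ((i : ℕ) + 1) * P.coeff (n - 1 - i)))
      (symPoly (altQ n e)) = c ^ N * symEval (altQ n e) P := by
  let g : R →+* AlgebraicClosure (FractionRing R) :=
    (algebraMap (FractionRing R) (AlgebraicClosure (FractionRing R))).comp
      (algebraMap R (FractionRing R))
  have hg : Function.Injective g :=
    (algebraMap (FractionRing R) _).injective.comp (IsFractionRing.injective R (FractionRing R))
  apply hg
  have h := symEval_scale (hP.map g) (by rw [hP.natDegree_map, hn]) (g c) e hN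
  rw [map_evalAt, map_mul, map_pow, map_symEval, ← h]
  simp

/-- The Rees ring of polynomials `∑ a_m Y^m` with `r deg a_m ≤ d m`. -/
def reesSubring (F : Type*) [Field F] (r d : ℕ) : Subring F[X][X] where
  carrier := {p | ∀ m, r * (p.coeff m).natDegree ≤ d * m}
  mul_mem' := by
    intro a b ha hb m
    rw [coeff_mul]
    rcases Nat.eq_zero_or_pos r with rfl | hr
    · simp
    rw [mul_comm, ← Nat.le_div_iff_mul_le hr]
    refine natDegree_sum_le_of_forall_le _ _ fun p hp => ?_
    rw [Nat.le_div_iff_mul_le hr]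
    rw [Finset.HasAntidiagonal.mem_antidiagonal] at hp
    calc (a.coeff p.1 * b.coeff p.2).natDegree * r
        ≤ ((a.coeff p.1).natDegree + (b.coeff p.2).natDegree) * r :=
          Nat.mul_le_mul_right _ natDegree_mul_le
      _ = r * (a.coeff p.1).natDegree + r * (b.coeff p.2).natDegree := by ring
      _ ≤ d * p.1 + d * p.2 := add_le_add (ha _) (hb _)
      _ = d * m := by rw [← hp]; ring
  one_mem' := by
    intro m
    rw [coeff_one]
    split_ifs <;> simp
  add_mem' := by
    intro a b ha hb m
    rw [coeff_add]
    rcases le_total (a.coeff m).natDegree (b.coeff m).natDegree with h | h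
    · exact (Nat.mul_le_mul_left _ (natDegree_add_le_of_degree_le h le_rfl)).trans (hb m)
    · exact (Nat.mul_le_mul_left _ (natDegree_add_le_of_degree_le le_rfl h)).trans (ha m)
  zero_mem' := by intro m; simp
  neg_mem' := by
    intro a ha m
    rw [coeff_neg, natDegree_neg]
    exact ha m

lemma evalAt_mem {σ : Type*} (W : Subring R) {x : σ → R} (hx : ∀ i, x i ∈ W)
    (p : MvPolynomial σ ℤ) : evalAt x p ∈ W := by
  have h := map_evalAt W.subtype (fun i => ⟨x i, hx i⟩) p
  simp only [Subring.coe_subtype] at h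
  rw [← h]
  exact Subtype.prop _

/-- If `r deg c_m ≤ d m` for the coefficients of `X^n + c_1 X^{n-1} + ⋯ + c_n`, then the value
at its roots of a bialternant of degree `N` has degree at most `d N / r`. -/
lemma natDegree_symEval_le {F : Type*} [Field F] {P : F[X][X]} (hP : P.Monic)
    (hn : P.natDegree = n) {r d : ℕ}
    (hdeg : ∀ i : Fin n, r * (P.coeff (n - 1 - i)).natDegree ≤ d * (i + 1)) (e : Fin n → ℕ) {N : ℕ}
    (hN : ∑ i, e i = N + ∑ i : Fin n, (n - 1 - (i : ℕ))) :
    r * (symEval (altQ n e) P).natDegree ≤ d * N := by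
  -- Scale the roots by the outer variable Y. The arguments ± c_m Y^m lie in the Rees ring, hence so
  -- does Y^N times the value; its coefficient of Y^N is the required bound.
  have h := symEval_scale_of_isDomain (hP.map (C : F[X] →+* F[X][X]))
    (by rw [hP.natDegree_map, hn]) (X : F[X][X]) e hN
  rw [← map_symEval] at h
  have hmem : X ^ N * C (symEval (altQ n e) P) ∈ reesSubring F r d := by
    rw [← h]
    refine evalAt_mem _ (fun i => ?_) _
    intro m
    have h1 : (X : F[X][X]) ^ ((i : ℕ) + 1) * ((-1) ^ ((i : ℕ) + 1) * (P.map C).coeff (n - 1 - i)) =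
        C ((-1) ^ ((i : ℕ) + 1) * P.coeff (n - 1 - i)) * X ^ ((i : ℕ) + 1) := by
      rw [coeff_map, mul_comm]; simp
    rw [h1, coeff_C_mul_X_pow]
    split_ifs with him
    · rw [him]
      refine (Nat.mul_le_mul_left _ ?_).trans (hdeg i)
      refine natDegree_mul_le.trans ?_
      have : ((-1 : F[X]) ^ ((i : ℕ) + 1)).natDegree = 0 := by
        rcases neg_one_pow_eq_or F[X] ((i : ℕ) + 1) with h | h <;> simp [h]
      omega
    · simp
  have h2 := hmem N
  simpa [coeff_X_pow_mul'] using h2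

/-- The value at the roots of `P` of the Schur polynomial of the partition with
`λ_i = k_i + ⋯ + k_n`. -/
noncomputable def schurSym (n : ℕ) (k : ℕ → ℕ) (P : R[X]) : R :=
  symEval (altQ n (partExponent n k)) P

lemma map_schurSym {T : Type*} [CommRing T] (g : R →+* T) (k : ℕ → ℕ) (P : R[X]) :
    g (schurSym n k P) = schurSym n k (P.map g) := map_symEval g _ P

lemma schurSym_prod (k : ℕ → ℕ) (x : Fin n → R) :
    schurSym n k (∏ j, (X - C (x j))) = schurVal n k x :=
  symEval_prod (altQ_isSymmetric n _) x

end SymmetricValues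

/-! ### The tensor product of polynomials over the base field -/

section Tensor

variable {k : Type*} [Field k] {n m : ℕ}

/-- The list of roots has exactly `n` entries, so the default value 0 in `rootFamily` is never
taken. -/
lemma map_rootFamily {P : k[X]} (hP : P.Monic) (hn : P.natDegree = n) :
    Finset.univ.val.map (rootFamily n P) = P.aroots (AlgebraicClosure k) := by
  have hs := IsAlgClosed.splits (P.map (algebraMap k (AlgebraicClosure k)))
  have hcard : (P.aroots (AlgebraicClosure k)).card = n := by
    rw [← hn, ← hP.natDegree_map (algebraMap k (AlgebraicClosure k))]
    exact hs.natDegree_eq_card_roots.symm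
  conv_rhs => rw [← Multiset.coe_toList (P.aroots (AlgebraicClosure k))]
  rw [Fin.univ_val_map]
  congr 1
  refine List.ext_getElem (by simp [hcard]) fun i h1 h2 => ?_
  simp only [List.getElem_ofFn, rootFamily]
  exact List.getD_eq_getElem _ _ h2

lemma prod_rootFamily {P : k[X]} (hP : P.Monic) (hn : P.natDegree = n) :
    ∏ i, (X - C (rootFamily n P i)) = P.map (algebraMap k (AlgebraicClosure k)) := by
  have hs := IsAlgClosed.splits (P.map (algebraMap k (AlgebraicClosure k)))
  conv_rhs => rw [hs.eq_prod_roots_of_monic (hP.map _)]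
  rw [← Polynomial.aroots, ← map_rootFamily hP hn, Multiset.map_map]
  rfl

lemma multiset_prod_product {M N : Type*} {T : Type*} [CommMonoid T] (s : Multiset M)
    (t : Multiset N) (f : M × N → T) :
    ((s ×ˢ t).map f).prod = (s.map fun a => (t.map fun b => f (a, b)).prod).prod := by
  change ((s.bind fun a => t.map (Prod.mk a)).map f).prod = _
  rw [Multiset.map_bind, Multiset.prod_bind]
  simp only [Multiset.map_map, Function.comp_def]

lemma polyTensor_comm (P Q : k[X]) : polyTensor P Q = polyTensor Q P := by
  rw [polyTensor, polyTensor, multiset_prod_product, multiset_prod_product,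
    Multiset.prod_map_prod_map]
  simp only [mul_comm]

/-- The generating series of the products of Schur values at the roots of `P` and of `Q`. -/
noncomputable def schurSymSeries (n m : ℕ) (P Q : k[X]) : PowerSeries k :=
  PowerSeries.mk fun M => ∑ j ∈ partsOfSize n M,
    schurSym n (zeroPad j) P * schurSym m (zeroPad j) Q

lemma map_schurSymSeries {P Q : k[X]} (hP : P.Monic) (hn : P.natDegree = n) (hQ : Q.Monic)
    (hm : Q.natDegree = m) :
    (schurSymSeries n m P Q).map (algebraMap k (AlgebraicClosure k)) =
      schurSeries (rootFamily n P) (rootFamily m Q) := by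
  ext M
  simp only [schurSymSeries, schurSeries, PowerSeries.coeff_map, PowerSeries.coeff_mk, map_sum,
    map_mul, map_schurSym, ← prod_rootFamily hP hn, ← prod_rootFamily hQ hm, schurSym_prod]

lemma cauchyProd_eq_reflect {R : Type*} [CommRing R] (x : Fin n → R) (y : Fin m → R) :
    cauchyProd x y = reflect (n * m) (∏ i, ∏ j, (X - C (x i * y j))) := by
  have h := reflect_prod_X_sub_C (Finset.univ : Finset (Fin n × Fin m)) fun p => x p.1 * y p.2
  rw [Finset.card_univ, Fintype.card_prod, Fintype.card_fin, Fintype.card_fin,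
    Fintype.prod_prod_type, Fintype.prod_prod_type] at h
  exact h.symm

/-- The product over the pairs of roots descends to k because, by the Cauchy identity, its
reciprocal is inverse to a power series whose coefficients are symmetric in each family of roots and
thus lie in k. This makes the `Function.invFun` in `polyTensor` meaningful. -/
lemma map_polyTensor {P Q : k[X]} (hP : P.Monic) (hn : P.natDegree = n) (hQ : Q.Monic)
    (hm : Q.natDegree = m) (hnm : n ≤ m) :
    (polyTensor P Q).map (algebraMap k (AlgebraicClosure k)) =
      ∏ i, ∏ j, (X - C (rootFamily n P i * rootFamily m Q j)) := by
  have h1 : ((P.aroots (AlgebraicClosure k) ×ˢ Q.aroots (AlgebraicClosure k)).map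
      fun x => X - C (x.1 * x.2)).prod =
      ∏ i, ∏ j, (X - C (rootFamily n P i * rootFamily m Q j)) := by
    rw [multiset_prod_product, ← map_rootFamily hP hn, ← map_rootFamily hQ hm, Multiset.map_map]
    simp only [Multiset.map_map]
    rfl
  rw [polyTensor, h1]
  refine Function.invFun_eq (f := Polynomial.map (algebraMap k (AlgebraicClosure k))) ?_
  have hc := cauchy_identity hnm (rootFamily n P) (rootFamily m Q)
  rw [← map_schurSymSeries hP hn hQ hm] at hc
  set S := schurSymSeries n m P Q
  have hS : PowerSeries.constantCoeff S ≠ 0 := by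
    intro h0
    have := congrArg PowerSeries.constantCoeff hc
    rw [map_mul, ← PowerSeries.coeff_zero_eq_constantCoeff_apply (PowerSeries.map _ S),
      PowerSeries.coeff_map, PowerSeries.coeff_zero_eq_constantCoeff_apply, h0] at this
    simp at this
  have hE : (cauchyProd (rootFamily n P) (rootFamily m Q) : PowerSeries (AlgebraicClosure k)) =
      PowerSeries.map (algebraMap k (AlgebraicClosure k)) S⁻¹ := by
    have h2 := congrArg (PowerSeries.map (algebraMap k (AlgebraicClosure k)))
      (PowerSeries.mul_inv_cancel S hS)
    rw [map_mul, map_one] at h2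
    calc _ = _ * (PowerSeries.map (algebraMap k (AlgebraicClosure k)) S *
          PowerSeries.map (algebraMap k (AlgebraicClosure k)) S⁻¹) := by rw [h2, mul_one]
      _ = _ := by rw [← mul_assoc, hc, one_mul]
  refine (lifts_iff_coeff_lifts _).2 fun i => ?_
  by_cases hi : i ≤ n * m
  · refine ⟨PowerSeries.coeff (n * m - i) S⁻¹, ?_⟩
    rw [← PowerSeries.coeff_map, ← hE, Polynomial.coeff_coe, cauchyProd_eq_reflect, coeff_reflect,
      revAt_le (Nat.sub_le _ _), Nat.sub_sub_self hi]
  · refine ⟨0, ?_⟩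
    rw [map_zero, coeff_eq_zero_of_natDegree_lt]
    refine lt_of_le_of_lt ?_ (not_le.1 hi)
    rw [← Fintype.prod_prod_type (fun p : Fin n × Fin m =>
      X - C (rootFamily n P p.1 * rootFamily m Q p.2))]
    refine (natDegree_prod_X_sub_C_le _ _).trans (by simp)

/-- `∏ (1 - α_i β_j T) ∑_λ s_λ(α) s_λ(β) T^{|λ|} = 1` over the base field. -/
theorem reverse_polyTensor_mul {P Q : k[X]} (hP : P.Monic) (hn : P.natDegree = n) (hQ : Q.Monic)
    (hm : Q.natDegree = m) (hnm : n ≤ m) :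
    ((polyTensor P Q).reverse : PowerSeries k) * schurSymSeries n m P Q = 1 := by
  have h1 := map_polyTensor hP hn hQ hm hnm
  have hdeg : (polyTensor P Q).natDegree = n * m := by
    rw [← natDegree_map (algebraMap k (AlgebraicClosure k)), h1,
      ← Fintype.prod_prod_type (fun p : Fin n × Fin m =>
        X - C (rootFamily n P p.1 * rootFamily m Q p.2)),
      natDegree_prod_of_monic _ _ fun p _ => monic_X_sub_C _]
    simp_rw [natDegree_X_sub_C]
    simp
  have h2 : (polyTensor P Q).reverse.map (algebraMap k (AlgebraicClosure k)) =
      cauchyProd (rootFamily n P) (rootFamily m Q) := by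
    rw [reverse, hdeg, ← reflect_map, h1, cauchyProd_eq_reflect]
  apply PowerSeries.map_injective _ (algebraMap k (AlgebraicClosure k)).injective
  rw [map_mul, map_one, map_schurSymSeries hP hn hQ hm, ← Polynomial.polynomial_map_coe, h2]
  exact cauchy_identity hnm _ _

end Tensor

/-! ### Bases of Tate modules -/

section TateModule

variable {R : Type*} [CommRing R] {a : R} {M : Type*} [AddCommGroup M] [Module R M] {r : ℕ}

/-- Evaluation of the Tate module at level `m`. -/
def tateEval (a : R) (M : Type*) [AddCommGroup M] [Module R M] (m : ℕ) : tateModule a M →+ M where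
  toFun x := x.1 m
  map_zero' := rfl
  map_add' _ _ := rfl

lemma tateEval_sum_smul (c : Fin r → AdicCompletion (Ideal.span {a}) R) (t : Fin r → tateModule a M)
    (m : ℕ) : (∑ j, c j • t j).1 m = ∑ j, adicLift (c j) m • (t j).1 m := by
  change tateEval a M m (∑ j, c j • t j) = _
  rw [map_sum]
  rfl

lemma exists_tateModule_one (hsurj : ∀ x : M, ∃ y, a • y = x) {v : M} (hv : a • v = 0) :
    ∃ t : tateModule a M, t.1 1 = v := by
  choose g hg using hsurj
  refine ⟨⟨fun m => Nat.casesOn m 0 fun m => g^[m] v, rfl, fun m => ?_⟩, rfl⟩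
  rcases m with _ | m
  · exact hv
  · change a • g^[m + 1] v = g^[m] v
    rw [Function.iterate_succ_apply', hg]

lemma tateModule_pow_smul_succ (t : tateModule a M) (m : ℕ) : a ^ m • t.1 (m + 1) = t.1 1 := by
  induction m with
  | zero => simp
  | succ m ih => rw [pow_succ, mul_smul, t.2.2, ih]

/-- Express a^m x through the level-one vectors, subtract the same combination at level m + 1, and
apply induction to the remainder, which is killed by a^m. Multiplication by a takes level m + 1 to
level m, which produces the coefficients c + a c'. -/
lemma tate_level_span {t : Fin r → tateModule a M}
    (hspan : ∀ x : M, a • x = 0 → ∃ c : Fin r → R, x = ∑ j, c j • (t j).1 1) (m : ℕ) (x : M)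
    (hx : a ^ m • x = 0) : ∃ c : Fin r → R, x = ∑ j, c j • (t j).1 m := by
  induction m generalizing x with
  | zero => exact ⟨0, by simpa using hx⟩
  | succ m ih =>
    obtain ⟨c, hc⟩ := hspan (a ^ m • x) (by rw [smul_smul, ← pow_succ', hx])
    obtain ⟨c', hc'⟩ := ih (x - ∑ j, c j • (t j).1 (m + 1)) (by
      rw [smul_sub, Finset.smul_sum, hc, sub_eq_zero]
      exact Finset.sum_congr rfl fun j _ => by rw [smul_comm, tateModule_pow_smul_succ])
    refine ⟨fun j => c j + a * c' j, ?_⟩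
    rw [sub_eq_iff_eq_add'] at hc'
    rw [hc', ← Finset.sum_add_distrib]
    refine Finset.sum_congr rfl fun j _ => ?_
    rw [add_smul, mul_comm, mul_smul, (t j).2.2]

/-- A relation at level m + 1 is multiplied by a^m to a relation at level one, so every coefficient
is divisible by a; the quotients form a relation at level m. -/
lemma tate_level_indep {t : Fin r → tateModule a M}
    (hind : ∀ c : Fin r → R, ∑ j, c j • (t j).1 1 = 0 → ∀ j, a ∣ c j) (m : ℕ) (c : Fin r → R)
    (hc : ∑ j, c j • (t j).1 m = 0) (j : Fin r) : a ^ m ∣ c j := by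
  induction m generalizing c with
  | zero => simp
  | succ m ih =>
    have h1 : ∑ j, c j • (t j).1 1 = 0 := by
      have := congrArg (a ^ m • ·) hc
      simp only [smul_zero, Finset.smul_sum] at this
      rw [← this]
      exact Finset.sum_congr rfl fun j _ => by rw [smul_comm, tateModule_pow_smul_succ]
    choose c' hc' using hind c h1
    rw [hc' j, pow_succ']
    refine mul_dvd_mul_left _ (ih c' ?_)
    rw [← hc]
    refine Finset.sum_congr rfl fun j _ => ?_
    rw [hc' j, mul_comm, mul_smul, (t j).2.2]

lemma tate_linearIndependent {t : Fin r → tateModule a M}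
    (hind : ∀ c : Fin r → R, ∑ j, c j • (t j).1 1 = 0 → ∀ j, a ∣ c j) :
    LinearIndependent (AdicCompletion (Ideal.span {a}) R) t := by
  rw [Fintype.linearIndependent_iff]
  intro c hc j
  refine AdicCompletion.ext_evalₐ (I := Ideal.span {a}) fun m => ?_
  have h : ∑ j, adicLift (c j) m • (t j).1 m = 0 := by
    rw [← tateEval_sum_smul, hc]
    rfl
  rw [map_zero, ← mk_adicLift, Ideal.Quotient.eq_zero_iff_mem, Ideal.span_singleton_pow,
    Ideal.mem_span_singleton]
  exact tate_level_indep hind m _ h j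

/-- By independence the coordinates at successive levels agree modulo a^m, so they are Cauchy
sequences and define elements of the completion. -/
lemma tate_span {t : Fin r → tateModule a M}
    (hspan : ∀ x : M, a • x = 0 → ∃ c : Fin r → R, x = ∑ j, c j • (t j).1 1)
    (hind : ∀ c : Fin r → R, ∑ j, c j • (t j).1 1 = 0 → ∀ j, a ∣ c j) :
    ⊤ ≤ Submodule.span (AdicCompletion (Ideal.span {a}) R) (Set.range t) := by
  intro x _
  choose c hc using fun m => tate_level_span hspan m (x.1 m) (tateModule_pow_smul x m)
  have hcomp : ∀ j m, a ^ m ∣ c m j - c (m + 1) j := by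
    intro j m
    refine tate_level_indep hind m (fun j => c m j - c (m + 1) j) ?_ j
    simp only [sub_smul, Finset.sum_sub_distrib]
    rw [← hc m, sub_eq_zero, ← x.2.2 m]
    conv_lhs => rw [hc (m + 1), Finset.smul_sum]
    exact Finset.sum_congr rfl fun j _ => by rw [smul_comm, (t j).2.2]
  let C : Fin r → AdicCompletion (Ideal.span {a}) R := fun j =>
    AdicCompletion.mk _ _ (AdicCompletion.AdicCauchySequence.mk (Ideal.span {a}) R
      (fun m => c m j) fun m => by
        rw [SModEq.sub_mem, smul_eq_mul, Ideal.mul_top, Ideal.span_singleton_pow,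
          Ideal.mem_span_singleton]
        exact hcomp j m)
  have hx : x = ∑ j, C j • t j := by
    refine Subtype.ext (funext fun m => ?_)
    rw [tateEval_sum_smul, hc m]
    refine Finset.sum_congr rfl fun j _ => ?_
    refine (tateModule_smul_congr (t j) ?_).symm
    rw [mk_adicLift]
    exact AdicCompletion.evalₐ_mk _ _ _
  rw [hx]
  exact Submodule.sum_mem _ fun j _ => Submodule.smul_mem _ _ (Submodule.subset_span ⟨j, rfl⟩)

/-- The `a`-adic Tate module of a module with surjective multiplication by `a` is free on any
lift of a basis of the `a`-torsion; the characteristic polynomial of an induced endomorphism is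
determined by its matrices at finite levels. -/
theorem exists_tate_basis (hsurj : ∀ x : M, ∃ y, a • y = x) {v : Fin r → M}
    (hv : ∀ j, a • v j = 0) (hspan : ∀ x : M, a • x = 0 → ∃ c : Fin r → R, x = ∑ j, c j • v j)
    (hind : ∀ c : Fin r → R, ∑ j, c j • v j = 0 → ∀ j, a ∣ c j) (g : M →ₗ[R] M) (P : R[X])
    (hP : ∀ (m : ℕ) (e : Fin r → M) (C : Matrix (Fin r) (Fin r) R), (∀ j, a ^ m • e j = 0) →
      (∀ x, a ^ m • x = 0 → ∃ c : Fin r → R, x = ∑ j, c j • e j) →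
      (∀ j, g (e j) = ∑ i, C i j • e i) → ∀ n, a ^ m ∣ C.charpoly.coeff n - P.coeff n) :
    ∃ b : Module.Basis (Fin r) (AdicCompletion (Ideal.span {a}) R) (tateModule a M),
      (LinearMap.toMatrix b b (tateMap a g)).charpoly =
        P.map (algebraMap R (AdicCompletion (Ideal.span {a}) R)) := by
  choose t ht using fun j => exists_tateModule_one hsurj (hv j)
  simp only [← ht] at hspan hind
  let b := Module.Basis.mk (tate_linearIndependent hind) (tate_span hspan hind)
  refine ⟨b, ?_⟩
  set Cm := LinearMap.toMatrix b b (tateMap a g) with hCm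
  refine Polynomial.ext fun n => ?_
  refine AdicCompletion.ext_evalₐ (I := Ideal.span {a}) fun m => ?_
  rw [coeff_map, AlgHom.commutes]
  -- Lift the a-adic matrix modulo a^m to a matrix over `R`: this is a matrix of `g` on the level-m
  -- generators, to which `hP` applies.
  let C : Matrix (Fin r) (Fin r) R := Matrix.of fun i j => adicLift (Cm i j) m
  have hC : C.map (Ideal.Quotient.mk (Ideal.span {a} ^ m)) =
      Cm.map (AdicCompletion.evalₐ (Ideal.span {a}) m).toRingHom := by
    ext i j
    simp only [C, Matrix.map_apply, Matrix.of_apply]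
    exact mk_adicLift _ _
  have h := hP m (fun j => (t j).1 m) C (fun j => tateModule_pow_smul _ _)
    (tate_level_span hspan m) (fun j => by
      have h1 : tateMap a g (t j) = ∑ i, Cm i j • t i := by
        have h2 : ∀ i, b i = t i := fun i => Module.Basis.mk_apply _ _ i
        rw [← b.sum_repr (tateMap a g (t j))]
        refine Finset.sum_congr rfl fun i _ => ?_
        rw [hCm, LinearMap.toMatrix_apply, h2, h2]
      have h3 := congrFun (congrArg Subtype.val h1) m
      rw [tateEval_sum_smul] at h3
      exact h3) n
  have h4 : Ideal.Quotient.mk (Ideal.span {a} ^ m) (C.charpoly.coeff n) =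
      AdicCompletion.evalₐ (Ideal.span {a}) m (Cm.charpoly.coeff n) := by
    have h5 := congrArg (fun A => A.charpoly.coeff n) hC
    simp only [Matrix.charpoly_map, coeff_map] at h5
    exact h5
  rw [← h4]
  change _ = Ideal.Quotient.mk _ _
  rw [Ideal.Quotient.eq, Ideal.span_singleton_pow, Ideal.mem_span_singleton]
  exact h

end TateModule

/-! ### Characteristic polynomials of contragredients -/

section Charpoly

variable {S : Type*} [CommRing S] {N : Type*} [AddCommGroup N] [Module S N] {n : ℕ}

lemma HasCharpoly.eq {g : Module.End S N} {P Q : S[X]} (hP : HasCharpoly g P)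
    (hQ : HasCharpoly g Q) : P = Q := by
  obtain ⟨m, b, rfl⟩ := hP
  obtain ⟨m', b', rfl⟩ := hQ
  have : Module.Free S N := Module.Free.of_basis b
  have : Module.Finite S N := Module.Finite.of_basis b
  rw [LinearMap.charpoly_toMatrix, LinearMap.charpoly_toMatrix]

lemma toMatrix_dualMap (b : Module.Basis (Fin n) S N) (g : Module.End S N) :
    LinearMap.toMatrix b.dualBasis b.dualBasis g.dualMap = (LinearMap.toMatrix b b g).transpose := by
  ext i j
  rw [LinearMap.toMatrix_apply, Matrix.transpose_apply, LinearMap.toMatrix_apply,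
    Module.Basis.dualBasis_repr]
  simp

/-- The contragredient of an automorphism, and its characteristic polynomial. -/
lemma exists_contragredient (b : Module.Basis (Fin n) S N) (g : Module.End S N)
    (hg : IsUnit (LinearMap.toMatrix b b g).det) :
    ∃ D : Module.End S (Module.Dual S N), (∀ ξ x, D ξ (g x) = ξ x) ∧
      HasCharpoly D (LinearMap.toMatrix b b g)⁻¹.charpoly ∧
      ∀ D' : Module.End S (Module.Dual S N), (∀ ξ x, D' ξ (g x) = ξ x) → D' = D := by
  set A := LinearMap.toMatrix b b g with hA
  set g' : Module.End S N := Matrix.toLin b b A⁻¹ with hg'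
  have hgA : g = Matrix.toLin b b A := (Matrix.toLin_toMatrix b b g).symm
  have h1 : g' ∘ₗ g = LinearMap.id := by
    rw [hgA, hg', ← Matrix.toLin_mul, Matrix.nonsing_inv_mul _ hg, Matrix.toLin_one]
  have h2 : g ∘ₗ g' = LinearMap.id := by
    rw [hgA, hg', ← Matrix.toLin_mul, Matrix.mul_nonsing_inv _ hg, Matrix.toLin_one]
  refine ⟨g'.dualMap, fun ξ x => ?_, ⟨n, b.dualBasis, ?_⟩, fun D' hD' => ?_⟩
  · rw [LinearMap.dualMap_apply]
    exact congrArg ξ (LinearMap.congr_fun h1 x)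
  · rw [toMatrix_dualMap, Matrix.charpoly_transpose, hg', LinearMap.toMatrix_toLin]
  · ext ξ x
    have h3 : g (g' x) = x := LinearMap.congr_fun h2 x
    conv_lhs => rw [← h3]
    rw [hD', LinearMap.dualMap_apply]

/-- The characteristic polynomial of an inverse is the reciprocal polynomial divided by the constant
term (-1)^n det A; the statement is multiplied out. -/
lemma coeff_charpoly_inv [Nontrivial S] (A : Matrix (Fin n) (Fin n) S) (hA : IsUnit A.det) {i : ℕ}
    (hi : i ≤ n) : A.charpoly.coeff 0 * A⁻¹.charpoly.coeff i = A.charpoly.coeff (n - i) := by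
  have h0 : A.charpoly.coeff 0 = (-1) ^ n * A.det := by
    rw [Matrix.det_eq_sign_charpoly_coeff, Fintype.card_fin, ← mul_assoc, ← mul_pow]
    simp
  rw [Matrix.charpoly_inv _ ((Matrix.isUnit_iff_isUnit_det A).2 hA), ← Matrix.reverse_charpoly]
  have h1 : ((-1 : S[X]) ^ Fintype.card (Fin n) * C (Ring.inverse A.det) * A.charpoly.reverse) =
      C ((-1) ^ n * Ring.inverse A.det) * A.charpoly.reverse := by
    simp
  rw [h1, coeff_C_mul, h0, coeff_reverse, Matrix.charpoly_natDegree_eq_dim, Fintype.card_fin,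
    revAt_le hi]
  have h2 : A.det * Ring.inverse A.det = 1 := Ring.mul_inverse_cancel _ hA
  calc _ = ((-1) * (-1)) ^ n * (A.det * Ring.inverse A.det) * A.charpoly.coeff (n - i) := by
        rw [mul_pow]; ring
    _ = _ := by rw [h2]; simp

end Charpoly

/-! ### Additive polynomials and torsion of a twisted operator -/

section Linearized

variable (F : Type*) [Field F] [Fintype F] {K : Type*} [Field K] [Algebra F K]

/-- The additive polynomial `∑ p_i X^{q^i}` with the coefficients of `p`. -/
noncomputable def linPoly : K[X] →ₗ[K] K[X] :=
  Polynomial.lsum fun i => monomial (Fintype.card F ^ i)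

/-- The `q^i`-power Frobenius of `K`. -/
noncomputable def frobHom (K : Type*) [Field K] [Algebra F K] (i : ℕ) : K →+* K :=
  ((FiniteField.frobeniusAlgHom F K) ^ i : K →ₐ[F] K).toRingHom

variable {F}

lemma frobHom_apply (i : ℕ) (x : K) : frobHom F K i x = x ^ Fintype.card F ^ i := by
  rw [← frobenius_pow_apply (F := F)]
  induction i generalizing x with
  | zero => rfl
  | succ i ih =>
    rw [pow_succ, Module.End.mul_apply, ← ih]
    simp only [frobHom, pow_succ]
    rfl

lemma one_lt_card : 1 < Fintype.card F := Fintype.one_lt_card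

lemma linPoly_monomial {K : Type*} [Field K] (i : ℕ) (c : K) :
    linPoly F (monomial i c) = monomial (Fintype.card F ^ i) c := by
  simp [linPoly, Polynomial.lsum, Polynomial.sum_monomial_index]

lemma coeff_linPoly (p : K[X]) (i : ℕ) : (linPoly F p).coeff (Fintype.card F ^ i) = p.coeff i := by
  induction p using Polynomial.induction_on' with
  | add p q hp hq => rw [map_add, coeff_add, coeff_add, hp, hq]
  | monomial n c =>
    rw [linPoly_monomial, coeff_monomial, coeff_monomial]
    simp only [Nat.pow_right_inj one_lt_card]

lemma linPoly_eq_zero {p : K[X]} (h : linPoly F p = 0) : p = 0 := by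
  ext i
  rw [← coeff_linPoly (F := F), h, coeff_zero, coeff_zero]

lemma linPoly_eq_sum (p : K[X]) :
    linPoly F p = ∑ i ∈ Finset.range (p.natDegree + 1), monomial (Fintype.card F ^ i) (p.coeff i) := by
  conv_lhs => rw [p.as_sum_range, map_sum]
  simp_rw [linPoly_monomial]

lemma natDegree_linPoly_le {p : K[X]} {n : ℕ} (hp : p.natDegree ≤ n) :
    (linPoly F p).natDegree ≤ Fintype.card F ^ n := by
  rw [linPoly_eq_sum]
  refine natDegree_sum_le_of_forall_le _ _ fun i hi => (natDegree_monomial_le _).trans ?_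
  exact Nat.pow_le_pow_right one_lt_card.le (by have := Finset.mem_range.1 hi; omega)

lemma natDegree_linPoly {p : K[X]} (hp : p ≠ 0) :
    (linPoly F p).natDegree = Fintype.card F ^ p.natDegree := by
  refine le_antisymm (natDegree_linPoly_le le_rfl) (le_natDegree_of_ne_zero ?_)
  rw [coeff_linPoly]
  exact leadingCoeff_ne_zero.2 hp

/-- Since q = 0 in K, only the linear term X^{q^0} has a nonzero derivative. Separability, and hence
the count of torsion points, depends only on that coefficient. -/
lemma derivative_linPoly (p : K[X]) : derivative (linPoly F p) = C (p.coeff 0) := by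
  induction p using Polynomial.induction_on' with
  | add p q hp hq => rw [map_add, derivative_add, hp, hq, coeff_add, C_add]
  | monomial n c =>
    rw [linPoly_monomial, derivative_monomial, coeff_monomial]
    rcases n with _ | n
    · simp
    · have h : (Fintype.card F : K) = 0 := by
        rw [← map_natCast (algebraMap F K), FiniteField.cast_card_eq_zero, map_zero]
      simp [pow_succ, h]

lemma separable_linPoly {p : K[X]} (hp : p.coeff 0 ≠ 0) : (linPoly F p).Separable := by
  rw [separable_def, derivative_linPoly]
  exact isCoprime_one_right.of_isCoprime_of_dvd_right (isUnit_C.2 (isUnit_iff_ne_zero.2 hp)).dvd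

/-- The rule τ^i c = c^{q^i} τ^i: composing with τ^i on the left shifts exponents and twists
coefficients. -/
lemma eval_linPoly_twist (i : ℕ) (p : K[X]) (x : K) :
    (linPoly F (X ^ i * p.map (frobHom F K i))).eval x = frobHom F K i ((linPoly F p).eval x) := by
  induction p using Polynomial.induction_on' with
  | add p q hp hq =>
    rw [Polynomial.map_add, mul_add, map_add, map_add, eval_add, eval_add, map_add, hp, hq]
  | monomial n c =>
    rw [Polynomial.map_monomial, X_pow_mul_monomial, linPoly_monomial, linPoly_monomial,
      eval_monomial, eval_monomial, map_mul, map_pow, frobHom_apply i x, ← pow_mul, pow_add, mul_comm (_ ^ n)]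

variable {r : ℕ}

/-- The operator `∑ κ_i τ^i` on `K`. -/
noncomputable def twistedOp (F : Type*) [Field F] [Fintype F] {K : Type*} [Field K] [Algebra F K]
    {r : ℕ} (κ : Fin (r + 1) → K) : Module.End F K :=
  ∑ i : Fin (r + 1), LinearMap.mulLeft F (κ i) *
    (FiniteField.frobeniusAlgHom F K).toLinearMap ^ (i : ℕ)

lemma twistedOp_apply (κ : Fin (r + 1) → K) (x : K) :
    twistedOp F κ x = ∑ i : Fin (r + 1), κ i * frobHom F K i x := by
  simp only [twistedOp, LinearMap.sum_apply, Module.End.mul_apply, LinearMap.mulLeft_apply,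
    frobenius_pow_apply, frobHom_apply]

variable (F) in
/-- The coefficients of `(∑ κ_i τ^i)^n` as a twisted polynomial. -/
noncomputable def twistPow (κ : Fin (r + 1) → K) : ℕ → K[X]
  | 0 => 1
  | n + 1 => ∑ i : Fin (r + 1), C (κ i) * (X ^ (i : ℕ) * (twistPow κ n).map (frobHom F K i))

lemma eval_linPoly_twistPow (κ : Fin (r + 1) → K) (n : ℕ) (x : K) :
    (linPoly F (twistPow F κ n)).eval x = (twistedOp F κ ^ n) x := by
  induction n with
  | zero =>
    have : (1 : K[X]) = monomial 0 1 := rfl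
    rw [twistPow, this, linPoly_monomial]
    simp
  | succ n ih =>
    rw [twistPow, map_sum, eval_finsetSum, pow_succ', Module.End.mul_apply, twistedOp_apply]
    refine Finset.sum_congr rfl fun i _ => ?_
    rw [← smul_eq_C_mul, map_smul, eval_smul, eval_linPoly_twist, ih, smul_eq_mul]

lemma coeff_zero_twistPow (κ : Fin (r + 1) → K) (n : ℕ) :
    (twistPow F κ n).coeff 0 = κ 0 ^ n := by
  induction n with
  | zero => simp [twistPow]
  | succ n ih =>
    rw [twistPow, finsetSum_coeff, Fin.sum_univ_succ, Finset.sum_eq_zero]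
    · have : frobHom F K 0 (κ 0 ^ n) = κ 0 ^ n := by rw [frobHom_apply, pow_zero, pow_one]
      simp [ih, this, pow_succ']
    · intro i _
      simp [mul_coeff_zero]

lemma twistPow_degree (κ : Fin (r + 1) → K) (hκ : κ (Fin.last r) ≠ 0) (n : ℕ) :
    (twistPow F κ n).degree = (r * n : ℕ) := by
  induction n with
  | zero => simp [twistPow]
  | succ n ih =>
    have hd : ∀ i : Fin (r + 1), ((twistPow F κ n).map (frobHom F K i)).degree = (r * n : ℕ) :=
      fun i => by rw [degree_map, ih]
    rw [twistPow, Fin.sum_univ_castSucc]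
    have hlast : (C (κ (Fin.last r)) * (X ^ ((Fin.last r : Fin (r + 1)) : ℕ) *
        (twistPow F κ n).map (frobHom F K (Fin.last r : Fin (r + 1))))).degree =
        ((r * (n + 1) : ℕ) : WithBot ℕ) := by
      rw [degree_C_mul hκ, degree_mul, degree_X_pow, hd, Fin.val_last, ← Nat.cast_add]
      congr 1
      ring
    rw [degree_add_eq_right_of_degree_lt, hlast]
    rw [hlast]
    refine (degree_sum_le _ _).trans_lt ((Finset.sup_lt_iff (WithBot.bot_lt_coe _)).2 fun i _ => ?_)
    rw [← smul_eq_C_mul]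
    refine (degree_smul_le _ _).trans_lt ?_
    rw [degree_mul, degree_X_pow, hd, ← Nat.cast_add]
    refine WithBot.coe_lt_coe.2 ?_
    have := i.2
    simp only [Fin.val_castSucc]
    rw [mul_add]
    change (i : ℕ) + r * n < r * n + r * 1
    omega

/-- The coefficients of the twisted polynomial `τ^{m mod r} (∑ κ_i τ^i)^{m / r}`, of degree `m`. -/
noncomputable def twistSeq (κ : Fin (r + 1) → K) (hκ : κ (Fin.last r) ≠ 0) : Polynomial.Sequence K where
  elems' m := X ^ (m % r) * (twistPow F κ (m / r)).map (frobHom F K (m % r))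
  degree_eq' m := by
    rw [degree_mul, degree_X_pow, degree_map, twistPow_degree κ hκ, ← Nat.cast_add]
    rw [Nat.mod_add_div]

lemma eval_linPoly_twistSeq (κ : Fin (r + 1) → K) (hκ : κ (Fin.last r) ≠ 0) (m : ℕ) (x : K) :
    (linPoly F (twistSeq (F := F) κ hκ m)).eval x =
      frobHom F K (m % r) ((twistedOp F κ ^ (m / r)) x) := by
  rw [← eval_linPoly_twistPow]
  exact eval_linPoly_twist _ _ _

/-- The twisted polynomial of the action of `a ∈ F[t]`. -/
noncomputable def twistAeval (κ : Fin (r + 1) → K) (a : F[X]) : K[X] :=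
  ∑ n ∈ Finset.range (a.natDegree + 1), C (algebraMap F K (a.coeff n)) * twistPow F κ n

lemma eval_linPoly_twistAeval (κ : Fin (r + 1) → K) (a : F[X]) (x : K) :
    (linPoly F (twistAeval κ a)).eval x = aeval (twistedOp F κ) a x := by
  rw [twistAeval, map_sum, eval_finsetSum, aeval_eq_sum_range, LinearMap.sum_apply]
  refine Finset.sum_congr rfl fun n _ => ?_
  rw [← smul_eq_C_mul, map_smul, eval_smul, eval_linPoly_twistPow, LinearMap.smul_apply,
    smul_eq_mul, Algebra.smul_def]

lemma coeff_zero_twistAeval (κ : Fin (r + 1) → K) (a : F[X]) :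
    (twistAeval κ a).coeff 0 = aeval (κ 0) a := by
  rw [twistAeval, finsetSum_coeff, aeval_eq_sum_range]
  refine Finset.sum_congr rfl fun n _ => ?_
  rw [coeff_C_mul, coeff_zero_twistPow, Algebra.smul_def]

lemma twistAeval_degree (κ : Fin (r + 1) → K) (hκ : κ (Fin.last r) ≠ 0) (hr : 0 < r) {a : F[X]}
    (ha : a ≠ 0) : (twistAeval κ a).degree = (r * a.natDegree : ℕ) := by
  have hlast : (C (algebraMap F K (a.coeff a.natDegree)) * twistPow F κ a.natDegree).degree =
      ((r * a.natDegree : ℕ) : WithBot ℕ) := by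
    rw [degree_C_mul, twistPow_degree κ hκ]
    rw [_root_.map_ne_zero]
    exact leadingCoeff_ne_zero.2 ha
  rw [twistAeval, Finset.sum_range_succ, degree_add_eq_right_of_degree_lt, hlast]
  rw [hlast]
  refine (degree_sum_le _ _).trans_lt ((Finset.sup_lt_iff (WithBot.bot_lt_coe _)).2 fun n hn => ?_)
  rw [← smul_eq_C_mul]
  refine (degree_smul_le _ _).trans_lt ?_
  rw [twistPow_degree κ hκ]
  exact WithBot.coe_lt_coe.2 (Nat.mul_lt_mul_of_pos_left (Finset.mem_range.1 hn) hr)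

lemma twistAeval_ne_zero (κ : Fin (r + 1) → K) (hκ : κ (Fin.last r) ≠ 0) (hr : 0 < r) {a : F[X]}
    (ha : a ≠ 0) : twistAeval κ a ≠ 0 := by
  intro h
  have := twistAeval_degree κ hκ hr ha
  rw [h, degree_zero] at this
  exact WithBot.bot_ne_coe this

lemma natDegree_linPoly_twistAeval (κ : Fin (r + 1) → K) (hκ : κ (Fin.last r) ≠ 0) (hr : 0 < r)
    {a : F[X]} (ha : a ≠ 0) :
    (linPoly F (twistAeval κ a)).natDegree = Fintype.card F ^ (r * a.natDegree) := by
  rw [natDegree_linPoly (twistAeval_ne_zero κ hκ hr ha),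
    natDegree_eq_of_degree_eq_some (twistAeval_degree κ hκ hr ha)]

variable [IsAlgClosed K]

lemma aeval_twistedOp_surjective (κ : Fin (r + 1) → K) (hκ : κ (Fin.last r) ≠ 0) (hr : 0 < r)
    {a : F[X]} (ha : a ≠ 0) (y : K) : ∃ x, aeval (twistedOp F κ) a x = y := by
  have hd : 0 < (linPoly F (twistAeval κ a)).natDegree := by
    rw [natDegree_linPoly_twistAeval κ hκ hr ha]
    exact pow_pos (by have := one_lt_card (F := F); omega) _
  obtain ⟨x, hx⟩ := IsAlgClosed.exists_root (linPoly F (twistAeval κ a) - C y) (by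
    rw [degree_sub_C (natDegree_pos_iff_degree_pos.1 hd)]
    exact (natDegree_pos_iff_degree_pos.1 hd).ne')
  refine ⟨x, ?_⟩
  rw [← eval_linPoly_twistAeval]
  simpa [sub_eq_zero] using hx

/-- For `a(κ_0) ≠ 0` the `a`-torsion has `q^{r deg a}` elements. -/
lemma card_torsion (κ : Fin (r + 1) → K) (hκ : κ (Fin.last r) ≠ 0) (hr : 0 < r)
    {a : F[X]} (ha0 : aeval (κ 0) a ≠ 0) :
    Nat.card {x : K // aeval (twistedOp F κ) a x = 0} = Fintype.card F ^ (r * a.natDegree) := by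
  classical
  have ha : a ≠ 0 := by rintro rfl; simp at ha0
  have hsep : (linPoly F (twistAeval κ a)).Separable :=
    separable_linPoly (by rwa [coeff_zero_twistAeval])
  have h0 : linPoly F (twistAeval κ a) ≠ 0 := hsep.ne_zero
  have h1 := (IsAlgClosed.splits (linPoly F (twistAeval κ a))).natDegree_eq_card_roots
  rw [← natDegree_linPoly_twistAeval κ hκ hr ha, h1,
    ← Multiset.toFinset_card_of_nodup (nodup_roots hsep)]
  refine Nat.subtype_card _ fun x => ?_
  rw [Multiset.mem_toFinset, mem_roots h0, IsRoot.def, eval_linPoly_twistAeval]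

/-- A combination of the `τ^i` (`i < r`) with coefficients of degree `< deg a` in `K[t]` which
vanishes on the `a`-torsion is zero. -/
lemma eq_zero_of_vanishing (κ : Fin (r + 1) → K) (hκ : κ (Fin.last r) ≠ 0) (hr : 0 < r)
    {a : F[X]} (ha0 : aeval (κ 0) a ≠ 0) (g : Fin r → K[X])
    (hg : ∀ i, (g i).degree < a.natDegree)
    (hv : ∀ x, aeval (twistedOp F κ) a x = 0 → ∑ i, ∑ n ∈ Finset.range a.natDegree,
      (g i).coeff n * frobHom F K i ((twistedOp F κ ^ n) x) = 0) : g = 0 := by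
  classical
  set D := a.natDegree with hD
  -- The combination as a twisted polynomial. The indices i + r n are distinct and below r D, so its
  -- additive polynomial has degree at most q^{rD-1}, yet it vanishes at the q^{rD} torsion points.
  -- Hence it is zero, and the coefficients vanish because the members of `twistSeq` have distinct
  -- degrees.
  let p : K[X] := ∑ i : Fin r, ∑ n ∈ Finset.range D,
    (g i).coeff n • twistSeq (F := F) κ hκ (i + r * n)
  have hmod : ∀ (i : Fin r) (n : ℕ), (i + r * n) % r = i ∧ (i + r * n) / r = n := fun i n =>
    ⟨by rw [Nat.add_mul_mod_self_left, Nat.mod_eq_of_lt i.2],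
      by rw [Nat.add_mul_div_left _ _ hr, Nat.div_eq_of_lt i.2, zero_add]⟩
  have heval : ∀ x, aeval (twistedOp F κ) a x = 0 → (linPoly F p).eval x = 0 := by
    intro x hx
    rw [← hv x hx]
    simp only [p, map_sum, eval_finsetSum, map_smul, eval_smul, eval_linPoly_twistSeq,
      (hmod _ _).1, (hmod _ _).2, smul_eq_mul]
  have hdeg : ∀ (i : Fin r), ∀ n ∈ Finset.range D, (i : ℕ) + r * n ≤ r * D - 1 := by
    intro i n hn
    have h1 : r * (n + 1) ≤ r * D := Nat.mul_le_mul_left _ (Finset.mem_range.1 hn)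
    have := i.2
    rw [mul_add] at h1
    omega
  have hp : p = 0 := by
    apply linPoly_eq_zero (F := F)
    have hpd : p.natDegree ≤ r * D - 1 := by
      refine natDegree_sum_le_of_forall_le _ _ fun i _ => natDegree_sum_le_of_forall_le _ _ fun n hn =>
        (natDegree_smul_le _ _).trans ?_
      rw [natDegree_eq_of_degree_eq_some ((twistSeq (F := F) κ hκ).degree_eq _)]
      exact hdeg i n hn
    rcases Nat.eq_zero_or_pos D with hD0 | hDpos
    · simp [p, hD0]
    have hcard := card_torsion κ hκ hr ha0
    have hfin : Finite {x : K // aeval (twistedOp F κ) a x = 0} :=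
      Nat.finite_of_card_ne_zero (by rw [hcard]; exact pow_ne_zero _ Fintype.card_ne_zero)
    have := Fintype.ofFinite {x : K // aeval (twistedOp F κ) a x = 0}
    refine eq_zero_of_natDegree_lt_card_of_eval_eq_zero _
      (Subtype.val_injective (p := fun x : K => aeval (twistedOp F κ) a x = 0))
      (fun x => heval x.1 x.2) ?_
    rw [← Nat.card_eq_fintype_card, hcard, ← hD]
    refine (natDegree_linPoly_le hpd).trans_lt (Nat.pow_lt_pow_right one_lt_card ?_)
    have : 0 < r * D := Nat.mul_pos hr hDpos
    omega
  have hinj : Function.Injective fun p : Fin r × ℕ => (p.1 : ℕ) + r * p.2 := by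
    rintro ⟨i, n⟩ ⟨i', n'⟩ h
    have h1 := hmod i n
    have h2 := hmod i' n'
    simp only at h
    rw [h] at h1
    exact Prod.ext (Fin.ext (h1.1.symm.trans h2.1)) (h1.2.symm.trans h2.2)
  have hli := (twistSeq (F := F) κ hκ).linearIndependent.comp _ hinj
  rw [linearIndependent_iff'] at hli
  funext i
  ext n
  rw [Pi.zero_apply, coeff_zero]
  by_cases hn : n < D
  · have h := hli (Finset.univ ×ˢ Finset.range D) (fun p => (g p.1).coeff p.2) (by
      rw [Finset.sum_product]
      exact hp) (i, n) (by simpa using hn)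
    exact h
  · exact coeff_eq_zero_of_degree_lt ((hg i).trans_le (by exact_mod_cast not_lt.1 hn))

end Linearized

/-! ### The matrix of Frobenius on the t-motive -/

section FrobeniusMatrix

variable (F : Type*) [Field F] [Fintype F] {K : Type*} [Field K] [Algebra F K]

/-- X^q - X = ∏_{c ∈ F} (X - c), so a root in K is one of the c. -/
lemma exists_algebraMap_eq_of_pow_card {x : K} (hx : x ^ Fintype.card F = x) :
    ∃ c : F, algebraMap F K c = x := by
  have h1 : 1 < Fintype.card F := Fintype.one_lt_card
  have hp : ∏ c : F, (X - C c) = (X ^ Fintype.card F - X : F[X]) := by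
    have h2 := prod_multiset_X_sub_C_of_monic_of_roots_card_eq (p := (X ^ Fintype.card F - X : F[X]))
      (monic_X_pow_sub (by rw [degree_X]; exact_mod_cast h1))
      (by rw [FiniteField.roots_X_pow_card_sub_X, FiniteField.X_pow_card_sub_X_natDegree_eq F h1]; rfl)
    rw [FiniteField.roots_X_pow_card_sub_X] at h2
    exact h2
  have h := congrArg (fun p : F[X] => (p.map (algebraMap F K)).eval x) hp
  simp only [Polynomial.map_prod, Polynomial.map_sub, map_X, map_C, eval_prod, eval_sub, eval_X, eval_C,
    Polynomial.map_pow, eval_pow, hx, sub_self] at h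
  obtain ⟨c, -, hc⟩ := Finset.prod_eq_zero_iff.1 h
  exact ⟨c, (sub_eq_zero.1 hc).symm⟩

/-- The `q`-power Frobenius on the coefficients of polynomials over `K`. -/
noncomputable def coeffFrob (K : Type*) [Field K] [Algebra F K] : K[X] →+* K[X] :=
  mapRingHom (frobHom F K 1)

variable {F}

lemma coeff_coeffFrob (p : K[X]) (n : ℕ) :
    (coeffFrob F K p).coeff n = p.coeff n ^ Fintype.card F := by
  rw [coeffFrob, coe_mapRingHom, coeff_map, frobHom_apply, pow_one]

lemma coeffFrob_C (c : K) : coeffFrob F K (C c) = C (c ^ Fintype.card F) := by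
  rw [coeffFrob, coe_mapRingHom, map_C, frobHom_apply, pow_one]

lemma coeffFrob_X : coeffFrob F K X = X := by
  rw [coeffFrob, coe_mapRingHom, map_X]

lemma exists_map_eq_of_coeffFrob {p : K[X]} (hp : coeffFrob F K p = p) :
    ∃ g : F[X], g.map (algebraMap F K) = p := by
  refine (mem_lifts _).1 ((lifts_iff_coeff_lifts _).2 fun n => ?_)
  refine exists_algebraMap_eq_of_pow_card F ?_
  rw [← coeff_coeffFrob, hp]

variable {r : ℕ}

/-- The matrix of `τ` in the basis `1, τ, …, τ^{r-1}` of the `t`-motive. -/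
noncomputable def tauMat (κ : Fin (r + 1) → K) : Matrix (Fin r) (Fin r) K[X] :=
  Matrix.of fun i j => if (i : ℕ) + 1 < r then (if (j : ℕ) = i + 1 then 1 else 0) else
    C (κ (Fin.last r))⁻¹ * ((if (j : ℕ) = 0 then X else 0) - C (κ j.castSucc))

/-- Only the bottom entry of the first column is nonzero, and the complementary minor is the
identity. -/
lemma det_tauMat (κ : Fin (r + 1) → K) (hr : 0 < r) :
    (tauMat κ).det = C ((-1) ^ (r - 1) * (κ (Fin.last r))⁻¹) * (X - C (κ 0)) := by
  obtain ⟨n, rfl⟩ : ∃ n, r = n + 1 := ⟨r - 1, by omega⟩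
  rw [Matrix.det_succ_column_zero, Fin.sum_univ_castSucc, Finset.sum_eq_zero, zero_add]
  · have h1 : (tauMat κ).submatrix (Fin.last n).succAbove Fin.succ = 1 := by
      ext i j
      simp only [tauMat, Matrix.submatrix_apply, Matrix.of_apply, Fin.succAbove_last,
        Fin.val_castSucc, Fin.val_succ, Matrix.one_apply]
      rw [if_pos (by omega)]
      by_cases hij : i = j
      · simp [hij]
      · rw [if_neg hij, if_neg]
        intro h
        exact hij (Fin.ext (by omega))
    rw [h1, Matrix.det_one]
    simp [tauMat]
    ring
  · intro i _
    simp [tauMat]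

variable (F) in
/-- The matrix of `τ^n` in the basis `1, τ, …, τ^{r-1}` of the `t`-motive. -/
noncomputable def tauPowMat (κ : Fin (r + 1) → K) : ℕ → Matrix (Fin r) (Fin r) K[X]
  | 0 => 1
  | n + 1 => (tauPowMat κ n).map (coeffFrob F K) * tauMat κ

lemma map_mul_matrix {R S : Type*} [CommRing R] [CommRing S] (g : R →+* S)
    (A B : Matrix (Fin r) (Fin r) R) : (A * B).map g = A.map g * B.map g :=
  Matrix.map_mul

/-- τ^{n+1} can be split as τ · τ^n or as τ^n · τ. Here the most twisted factor is peeled off on the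
left, instead of the untwisted one on the right. -/
lemma tauPowMat_succ (κ : Fin (r + 1) → K) (n : ℕ) :
    tauPowMat F κ (n + 1) = (tauMat κ).map ((coeffFrob F K) ^ n : K[X] →+* K[X]) * tauPowMat F κ n := by
  induction n with
  | zero =>
    simp only [tauPowMat, pow_zero, mul_one]
    rw [Matrix.map_one _ (map_zero _) (map_one _), one_mul]
    ext i j
    simp
  | succ n ih =>
    have h : ((tauMat κ).map ((coeffFrob F K) ^ n : K[X] →+* K[X])).map (coeffFrob F K) =
        (tauMat κ).map ((coeffFrob F K) ^ (n + 1) : K[X] →+* K[X]) := by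
      ext1 i j
      rw [Matrix.map_apply, Matrix.map_apply, Matrix.map_apply, pow_succ', RingHom.mul_def,
        RingHom.comp_apply]
    have h2 : tauPowMat F κ (n + 1) = (tauPowMat F κ n).map (coeffFrob F K) * tauMat κ := rfl
    have h3 : tauPowMat F κ (n + 1 + 1) = (tauPowMat F κ (n + 1)).map (coeffFrob F K) * tauMat κ := rfl
    rw [h3, ih, map_mul_matrix, Matrix.mul_assoc, ← h2, h, ← ih]

lemma coeffFrob_pow_apply_coeff (n : ℕ) (p : K[X]) (m : ℕ) :
    (((coeffFrob F K) ^ n : K[X] →+* K[X]) p).coeff m = p.coeff m ^ Fintype.card F ^ n := by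
  induction n with
  | zero => simp
  | succ n ih =>
    rw [pow_succ', RingHom.mul_def, RingHom.comp_apply, coeff_coeffFrob, ih, ← pow_mul, ← pow_succ]

lemma coeffFrob_pow_C (n : ℕ) (c : K) :
    ((coeffFrob F K) ^ n : K[X] →+* K[X]) (C c) = C (c ^ Fintype.card F ^ n) := by
  ext m
  rw [coeffFrob_pow_apply_coeff, coeff_C, coeff_C]
  split_ifs
  · rfl
  · exact zero_pow (pow_ne_zero _ Fintype.card_ne_zero)

lemma coeffFrob_pow_X (n : ℕ) : ((coeffFrob F K) ^ n : K[X] →+* K[X]) X = X := by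
  ext m
  rw [coeffFrob_pow_apply_coeff, coeff_X]
  split_ifs
  · simp
  · exact zero_pow (pow_ne_zero _ Fintype.card_ne_zero)

lemma tauMat_map_frob {κ : Fin (r + 1) → K} {d : ℕ} (hκ : ∀ i, κ i ^ Fintype.card F ^ d = κ i) :
    (tauMat κ).map ((coeffFrob F K) ^ d : K[X] →+* K[X]) = tauMat κ := by
  ext1 i j
  simp only [tauMat, Matrix.map_apply, Matrix.of_apply]
  split_ifs <;> simp only [map_mul, map_sub, coeffFrob_pow_C, coeffFrob_pow_X, inv_pow, hκ, map_one,
    map_zero]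

/-- The characteristic polynomial of `τ^d` is fixed by the Frobenius, if the `κ_i` lie in the field
with `q^d` elements. -/
lemma charpoly_tauPowMat_map {κ : Fin (r + 1) → K} {d : ℕ} (hd : 0 < d)
    (hκ : ∀ i, κ i ^ Fintype.card F ^ d = κ i) :
    (tauPowMat F κ d).charpoly.map (coeffFrob F K) = (tauPowMat F κ d).charpoly := by
  obtain ⟨n, rfl⟩ : ∃ n, d = n + 1 := ⟨d - 1, by omega⟩
  rw [← Matrix.charpoly_map]
  -- Twisting once turns the leftmost factor into its d-th twist, which is the untwisted matrix
  -- because the κ_i lie in the field with q^d elements. The result is a cyclic rotation of the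
  -- original product, with the same characteristic polynomial.
  conv_lhs => rw [tauPowMat_succ, map_mul_matrix, Matrix.map_map]
  have h : (tauMat κ).map ((coeffFrob F K) ∘ ((coeffFrob F K) ^ n : K[X] →+* K[X])) =
      (tauMat κ).map ((coeffFrob F K) ^ (n + 1) : K[X] →+* K[X]) := by
    ext1 i j
    rw [Matrix.map_apply, Matrix.map_apply, pow_succ', RingHom.mul_def, RingHom.comp_apply,
      Function.comp_apply]
  rw [h, tauMat_map_frob hκ, Matrix.charpoly_mul_comm]
  rfl

lemma exists_charpoly_descent {κ : Fin (r + 1) → K} {d : ℕ} (hd : 0 < d)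
    (hκ : ∀ i, κ i ^ Fintype.card F ^ d = κ i) :
    ∃ P : F[X][X], P.map (mapRingHom (algebraMap F K)) = (tauPowMat F κ d).charpoly := by
  refine (mem_lifts _).1 ((lifts_iff_coeff_lifts _).2 fun n => ?_)
  obtain ⟨g, hg⟩ := exists_map_eq_of_coeffFrob (F := F) (p := (tauPowMat F κ d).charpoly.coeff n)
    (by rw [← coeff_map, charpoly_tauPowMat_map hd hκ])
  exact ⟨g, hg⟩

lemma det_tauPowMat (κ : Fin (r + 1) → K) (n : ℕ) :
    (tauPowMat F κ n).det = ∏ i ∈ Finset.range n, ((coeffFrob F K) ^ i : K[X] →+* K[X]) (tauMat κ).det := by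
  induction n with
  | zero => simp [tauPowMat]
  | succ n ih =>
    rw [tauPowMat_succ, Matrix.det_mul, ih, Finset.prod_range_succ, mul_comm, RingHom.map_det]
    rfl

/-- A monic irreducible polynomial of degree `d` over `F` is `∏_{i<d} (X - θ^{q^i})`. -/
lemma map_eq_prod_conjugates {f : F[X]} (hf : f.Monic) (hfi : Irreducible f) {θ : K}
    (hθ : aeval θ f = 0) (hθd : θ ^ Fintype.card F ^ f.natDegree = θ) :
    f.map (algebraMap F K) = ∏ i ∈ Finset.range f.natDegree, (X - C (θ ^ Fintype.card F ^ i)) := by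
  set g : K[X] := ∏ i ∈ Finset.range f.natDegree, (X - C (θ ^ Fintype.card F ^ i)) with hg
  have hd : 0 < f.natDegree := hfi.natDegree_pos
  have hgm : g.Monic := monic_prod_of_monic _ _ fun i _ => monic_X_sub_C _
  have hgd : g.natDegree = f.natDegree := by
    rw [hg, natDegree_prod_of_monic _ _ fun i _ => monic_X_sub_C _]
    simp_rw [natDegree_X_sub_C]
    simp
  -- Frobenius permutes the factors cyclically because θ^{q^d} = θ, so the product has coefficients
  -- in F.
  have hgfix : coeffFrob F K g = g := by
    obtain ⟨n, hn⟩ : ∃ n, f.natDegree = n + 1 := ⟨f.natDegree - 1, by omega⟩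
    rw [hg, map_prod]
    simp only [map_sub, coeffFrob_C, coeffFrob_X, ← pow_mul, ← pow_succ]
    rw [hn] at hθd ⊢
    conv_rhs => rw [Finset.prod_range_succ']
    rw [Finset.prod_range_succ, hθd, pow_zero, pow_one]
  obtain ⟨g₀, hg₀⟩ := exists_map_eq_of_coeffFrob hgfix
  have hg₀m : g₀.Monic := monic_of_injective (algebraMap F K).injective (by rw [hg₀]; exact hgm)
  have hg₀d : g₀.natDegree = f.natDegree := by
    rw [← hgd, ← hg₀, natDegree_map]
  have hroot : aeval θ g₀ = 0 := by
    rw [← eval_map_algebraMap, hg₀, hg, eval_prod]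
    exact Finset.prod_eq_zero (Finset.mem_range.2 hd) (by simp)
  have hmin : f = minpoly F θ := minpoly.eq_of_irreducible_of_monic hfi hθ hf
  have hdvd : f ∣ g₀ := by
    have := minpoly.dvd F θ hroot
    rwa [← hmin] at this
  rw [← hg₀, eq_of_monic_of_dvd_of_natDegree_le hf hg₀m hdvd hg₀d.le]

/-- The determinants of the twists are a constant times X - κ_0^{q^i}. The linear factors multiply
to f, and the constant is the same in each twist because κ_r lies in F. -/
lemma det_tauPowMat_eq {κ : Fin (r + 1) → K} (hr : 0 < r) {f : F[X]} (hf : f.Monic)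
    (hfi : Irreducible f) (hθ : aeval (κ 0) f = 0)
    (hθd : κ 0 ^ Fintype.card F ^ f.natDegree = κ 0) {c : F}
    (hc : κ (Fin.last r) = algebraMap F K c) :
    (tauPowMat F κ f.natDegree).det =
      (C (((-1) ^ (r - 1) * c⁻¹) ^ f.natDegree) * f).map (algebraMap F K) := by
  rw [det_tauPowMat, det_tauMat κ hr, hc]
  simp only [map_mul, map_sub, coeffFrob_pow_C, coeffFrob_pow_X]
  rw [Finset.prod_mul_distrib, ← map_eq_prod_conjugates hf hfi hθ hθd, Polynomial.map_mul]
  congr 1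
  have h : ∀ i, ((-1 : K) ^ (r - 1)) ^ Fintype.card F ^ i * ((algebraMap F K c)⁻¹) ^ Fintype.card F ^ i =
      algebraMap F K ((-1) ^ (r - 1) * c⁻¹) := by
    intro i
    rw [← mul_pow]
    have : (-1 : K) ^ (r - 1) * (algebraMap F K c)⁻¹ = algebraMap F K ((-1) ^ (r - 1) * c⁻¹) := by simp
    rw [this, ← map_pow, FiniteField.pow_card_pow]
  simp_rw [← map_mul, h]
  rw [Finset.prod_const, Finset.card_range, ← C_pow, ← map_pow, map_C]

end FrobeniusMatrix

/-! ### Degree bounds for the Frobenius polynomial -/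

section Weights

variable {K : Type*} [Field K] {r : ℕ}

/-- Give t weight r and τ^i weight i, as suggested by t = κ_0 + ⋯ + κ_r τ^r; then τ raises weights
by at most 1. -/
lemma tauMat_weight (κ : Fin (r + 1) → K) (i j : Fin r) (n : ℕ) (hn : (tauMat κ i j).coeff n ≠ 0) :
    r * n + j ≤ i + 1 := by
  have hi := i.2
  have hj := j.2
  simp only [tauMat, Matrix.of_apply] at hn
  split_ifs at hn with h1 h2 h3
  · rw [coeff_one] at hn
    have : n = 0 := by by_contra h; exact hn (if_neg h)
    subst this; omega
  · simp at hn
  · rw [coeff_C_mul, coeff_sub, coeff_X, coeff_C] at hn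
    have : n ≤ 1 := by
      by_contra h
      rw [if_neg (by omega), if_neg (by omega)] at hn
      simp at hn
    interval_cases n <;> omega
  · rw [coeff_C_mul, zero_sub, coeff_neg, coeff_C] at hn
    have : n = 0 := by by_contra h; rw [if_neg h] at hn; simp at hn
    subst this; omega

lemma tauPowMat_weight (F : Type*) [Field F] [Fintype F] [Algebra F K] (κ : Fin (r + 1) → K) (d : ℕ)
    (i j : Fin r) (n : ℕ) (hn : (tauPowMat F κ d i j).coeff n ≠ 0) : r * n + j ≤ i + d := by
  induction d generalizing i j n with
  | zero =>
    rw [tauPowMat, Matrix.one_apply] at hn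
    split_ifs at hn with h
    · rw [coeff_one] at hn
      have : n = 0 := by by_contra h; exact hn (if_neg h)
      subst this; subst h; omega
    · simp at hn
  | succ d ih =>
    rw [tauPowMat, Matrix.mul_apply, finsetSum_coeff] at hn
    obtain ⟨k, -, hk⟩ := Finset.exists_ne_zero_of_sum_ne_zero hn
    rw [coeff_mul] at hk
    obtain ⟨⟨a, b⟩, hab, h⟩ := Finset.exists_ne_zero_of_sum_ne_zero hk
    rw [Finset.HasAntidiagonal.mem_antidiagonal] at hab
    rw [Matrix.map_apply, coeff_coeffFrob] at h
    have h1 := ih i k a (fun h0 => left_ne_zero_of_mul h (by simp only [h0]; exact zero_pow Fintype.card_ne_zero))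
    have h2 := tauMat_weight κ k j b (right_ne_zero_of_mul h)
    simp only at hab
    rw [← hab, mul_add]
    omega

/-- `p` has weight at most `N`, for the weights `r` of the inner and `d` of the outer variable. -/
def WeightLE (r d : ℕ) (p : K[X][X]) (N : ℤ) : Prop :=
  ∀ m n, (p.coeff m).coeff n ≠ 0 → (r * n + d * m : ℤ) ≤ N

lemma WeightLE.mul {d : ℕ} {p q : K[X][X]} {N M : ℤ} (hp : WeightLE r d p N) (hq : WeightLE r d q M) :
    WeightLE r d (p * q) (N + M) := by
  intro m n h
  rw [coeff_mul, finsetSum_coeff] at h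
  obtain ⟨⟨a, b⟩, hab, h⟩ := Finset.exists_ne_zero_of_sum_ne_zero h
  rw [coeff_mul] at h
  obtain ⟨⟨a', b'⟩, hab', h⟩ := Finset.exists_ne_zero_of_sum_ne_zero h
  rw [Finset.HasAntidiagonal.mem_antidiagonal] at hab hab'
  have h1 := hp a a' (left_ne_zero_of_mul h)
  have h2 := hq b b' (right_ne_zero_of_mul h)
  simp only at hab hab'
  rw [← hab, ← hab']
  push_cast
  linarith

lemma WeightLE.prod {d : ℕ} {ι : Type*} (s : Finset ι) {p : ι → K[X][X]} {N : ι → ℤ}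
    (h : ∀ i, WeightLE r d (p i) (N i)) : WeightLE r d (∏ i ∈ s, p i) (∑ i ∈ s, N i) := by
  classical
  induction s using Finset.induction_on with
  | empty =>
    intro m n hmn
    rw [Finset.prod_empty, coeff_one] at hmn
    split_ifs at hmn with hm
    · rw [coeff_one] at hmn
      split_ifs at hmn with hn
      · simp [hm, hn]
      · simp at hmn
    · simp at hmn
  | insert a s ha ih =>
    rw [Finset.prod_insert ha, Finset.sum_insert ha]
    exact (h a).mul ih

lemma WeightLE.sum {d : ℕ} {ι : Type*} (s : Finset ι) {p : ι → K[X][X]} {N : ℤ}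
    (h : ∀ i, WeightLE r d (p i) N) : WeightLE r d (∑ i ∈ s, p i) N := by
  intro m n hmn
  rw [finsetSum_coeff, finsetSum_coeff] at hmn
  obtain ⟨i, -, hi⟩ := Finset.exists_ne_zero_of_sum_ne_zero hmn
  exact h i m n hi

/-- The coefficient of `X^m` in the characteristic polynomial of `τ^d` has degree at most
`d (r - m) / r`. -/
lemma natDegree_coeff_charpoly_tauPowMat (F : Type*) [Field F] [Fintype F] [Algebra F K]
    (κ : Fin (r + 1) → K) (d m : ℕ) :
    r * ((tauPowMat F κ d).charpoly.coeff m).natDegree ≤ d * (r - m) := by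
  have hentry : ∀ i j, WeightLE r d ((tauPowMat F κ d).charmatrix i j) (d + (i : ℤ) - (j : ℤ)) := by
    intro i j m n h
    rw [Matrix.charmatrix_apply, coeff_sub, coeff_sub] at h
    by_cases h1 : ((C (tauPowMat F κ d i j)).coeff m).coeff n = 0
    · rw [h1, sub_zero, Matrix.diagonal_apply] at h
      split_ifs at h with hij
      · rw [coeff_X] at h
        split_ifs at h with h2
        · rw [coeff_one] at h
          split_ifs at h with h3
          · subst hij; subst h2; subst h3; simp
          · simp at h
        · simp at h
      · simp at h
    · rw [coeff_C] at h1
      split_ifs at h1 with h2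
      · have := tauPowMat_weight F κ d i j n h1
        subst h2
        have h3 : ((r * n + j : ℕ) : ℤ) ≤ ((i + d : ℕ) : ℤ) := by exact_mod_cast this
        push_cast at h3 ⊢
        linarith
      · simp at h1
  have hw : WeightLE r d (tauPowMat F κ d).charpoly (r * d) := by
    rw [Matrix.charpoly, Matrix.det_apply']
    refine WeightLE.sum _ fun σ => ?_
    have h1 := WeightLE.prod (r := r) (d := d) Finset.univ fun i => hentry (σ i) i
    -- Along a permutation the row and column shifts cancel, so every Leibniz term has weight at
    -- most r d, with weight d for the outer variable.
    have h2 : ∑ i : Fin r, ((d : ℤ) + ((σ i : Fin r) : ℤ) - (i : ℤ)) = r * d := by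
      rw [Finset.sum_sub_distrib, Finset.sum_add_distrib, Equiv.sum_comp σ fun i : Fin r => ((i : ℕ) : ℤ)]
      simp
    rw [h2] at h1
    have h3 : WeightLE r d (((Equiv.Perm.sign σ : ℤ) : K[X][X])) 0 := by
      intro m n hmn
      rw [← map_intCast (C : K[X] →+* K[X][X]), coeff_C] at hmn
      split_ifs at hmn with hm
      · rw [← map_intCast (C : K →+* K[X]), coeff_C] at hmn
        split_ifs at hmn with hn
        · simp [hm, hn]
        · simp at hmn
      · simp at hmn
    simpa using h3.mul h1
  by_cases h0 : (tauPowMat F κ d).charpoly.coeff m = 0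
  · simp [h0]
  have h := hw m _ (leadingCoeff_ne_zero.2 h0)
  have h' : r * ((tauPowMat F κ d).charpoly.coeff m).natDegree + d * m ≤ r * d := by exact_mod_cast h
  rw [Nat.mul_sub]
  rw [mul_comm r d] at h'
  omega

end Weights

/-! ### The pairing between torsion and the t-motive -/

section Comparison

variable {F : Type*} [Field F] {K : Type*} [Field K] [Algebra F K]

/-- The operator `u ↦ u ∘ T` on `Hom_F(K, K)`. -/
def precomp (T : Module.End F K) : Module.End K (K →ₗ[F] K) where
  toFun u := u ∘ₗ T
  map_add' _ _ := LinearMap.add_comp _ _ _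
  map_smul' _ _ := LinearMap.smul_comp _ _ _

lemma precomp_pow_apply (T : Module.End F K) (n : ℕ) (u : K →ₗ[F] K) (x : K) :
    ((precomp T) ^ n) u x = u ((T ^ n) x) := by
  induction n generalizing x with
  | zero => rfl
  | succ n ih =>
    rw [pow_succ', Module.End.mul_apply, pow_succ, Module.End.mul_apply, ← ih]
    rfl

/-- The action of `K[t]` on `Hom_F(K, K)`. -/
noncomputable def coeffAct (T : Module.End F K) (g : K[X]) : Module.End K (K →ₗ[F] K) :=
  aeval (precomp T) g

lemma coeffAct_apply (T : Module.End F K) (g : K[X]) (u : K →ₗ[F] K) (x : K) {n : ℕ}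
    (hn : g.natDegree < n) :
    coeffAct T g u x = ∑ i ∈ Finset.range n, g.coeff i * u ((T ^ i) x) := by
  rw [coeffAct, aeval_eq_sum_range' hn, LinearMap.sum_apply, LinearMap.sum_apply]
  refine Finset.sum_congr rfl fun i _ => ?_
  rw [LinearMap.smul_apply, LinearMap.smul_apply, precomp_pow_apply, smul_eq_mul]

lemma coeffAct_C (T : Module.End F K) (c : K) (u : K →ₗ[F] K) : coeffAct T (C c) u = c • u := by
  rw [coeffAct, aeval_C]
  rfl

lemma coeffAct_mul (T : Module.End F K) (g h : K[X]) (u : K →ₗ[F] K) :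
    coeffAct T (g * h) u = coeffAct T g (coeffAct T h u) := by
  rw [coeffAct, map_mul, Module.End.mul_apply]
  rfl

lemma coeffAct_X (T : Module.End F K) (u : K →ₗ[F] K) : coeffAct T X u = u ∘ₗ T := by
  rw [coeffAct, aeval_X]
  rfl

lemma coeffAct_sub (T : Module.End F K) (g h : K[X]) (u : K →ₗ[F] K) :
    coeffAct T (g - h) u = coeffAct T g u - coeffAct T h u := by
  rw [coeffAct, map_sub, LinearMap.sub_apply]
  rfl

lemma coeffAct_sum (T : Module.End F K) {ι : Type*} (s : Finset ι) (g : ι → K[X]) (u : K →ₗ[F] K) :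
    coeffAct T (∑ i ∈ s, g i) u = ∑ i ∈ s, coeffAct T (g i) u := by
  rw [coeffAct, map_sum, LinearMap.sum_apply]
  rfl

lemma coeffAct_one (T : Module.End F K) (u : K →ₗ[F] K) : coeffAct T 1 u = u := by
  rw [coeffAct, map_one]
  rfl

lemma coeffAct_zero (T : Module.End F K) (u : K →ₗ[F] K) : coeffAct T 0 u = 0 := by
  rw [coeffAct, map_zero]
  rfl

/-- The pairing of `x` and `u`: the map `u(·x)` applied to `(a(X) - a(T)) / (X - T)`. -/
noncomputable def torsionPairing (T : Module.End F K) (a : F[X]) (x : K) (u : K →ₗ[F] K) : K[X] :=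
  ∑ i ∈ Finset.range (a.natDegree + 1), ∑ j ∈ Finset.range i,
    X ^ j * C (algebraMap F K (a.coeff i) * u ((T ^ (i - 1 - j)) x))

variable (T : Module.End F K) (a : F[X])

lemma torsionPairing_add_left (x y : K) (u : K →ₗ[F] K) :
    torsionPairing T a (x + y) u = torsionPairing T a x u + torsionPairing T a y u := by
  simp only [torsionPairing, map_add, mul_add, Finset.sum_add_distrib]

lemma torsionPairing_smul_left (c : F) (x : K) (u : K →ₗ[F] K) :
    torsionPairing T a (c • x) u = C (algebraMap F K c) * torsionPairing T a x u := by
  simp only [torsionPairing, map_smul, Algebra.smul_def (R := F) (A := K) c (u _), Finset.mul_sum,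
    map_mul]
  refine Finset.sum_congr rfl fun i _ => Finset.sum_congr rfl fun j _ => ?_
  ring

lemma torsionPairing_add_right (x : K) (u v : K →ₗ[F] K) :
    torsionPairing T a x (u + v) = torsionPairing T a x u + torsionPairing T a x v := by
  simp only [torsionPairing, LinearMap.add_apply, mul_add, C_add, Finset.sum_add_distrib]

lemma torsionPairing_smul_right (x : K) (c : K) (u : K →ₗ[F] K) :
    torsionPairing T a x (c • u) = C c * torsionPairing T a x u := by
  simp only [torsionPairing, LinearMap.smul_apply, smul_eq_mul, Finset.mul_sum, map_mul]
  refine Finset.sum_congr rfl fun i _ => Finset.sum_congr rfl fun j _ => ?_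
  ring

/-- Adjointness: an operator commuting with `T` may be moved from the torsion side to the motive
side. It is applied to `T` itself and to τ^d. -/
lemma torsionPairing_comm {S : Module.End F K} (h : S * T = T * S) (x : K) (u : K →ₗ[F] K) :
    torsionPairing T a (S x) u = torsionPairing T a x (u ∘ₗ S) := by
  simp only [torsionPairing, LinearMap.comp_apply]
  refine Finset.sum_congr rfl fun i _ => Finset.sum_congr rfl fun j _ => ?_
  have h1 : S * T ^ (i - 1 - j) = T ^ (i - 1 - j) * S := (show Commute S T from h).pow_right _
  have h2 := LinearMap.congr_fun h1 x
  simp only [Module.End.mul_apply] at h2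
  rw [h2]

/-- Telescoping of (X - T) · (a(X) - a(T))/(X - T). On a-torsion and modulo a the right side
vanishes, so `T` acts on the pairing as multiplication by X. -/
lemma X_mul_torsionPairing (x : K) (u : K →ₗ[F] K) :
    X * torsionPairing T a x u - torsionPairing T a (T x) u =
      a.map (algebraMap F K) * C (u x) - C (u (aeval T a x)) := by
  have h1 : ∀ i, X * (∑ j ∈ Finset.range i,
      X ^ j * C (algebraMap F K (a.coeff i) * u ((T ^ (i - 1 - j)) x))) -
      ∑ j ∈ Finset.range i, X ^ j * C (algebraMap F K (a.coeff i) * u ((T ^ (i - 1 - j)) (T x))) =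
      C (algebraMap F K (a.coeff i)) * (X ^ i * C (u x) - C (u ((T ^ i) x))) := by
    intro i
    have h := Finset.sum_range_sub
      (fun j => X ^ j * C (algebraMap F K (a.coeff i) * u ((T ^ (i - j)) x))) i
    rw [Finset.mul_sum, ← Finset.sum_sub_distrib]
    simp only [Nat.sub_self, pow_zero, Nat.sub_zero, Module.End.one_apply, one_mul] at h
    rw [mul_sub, ← C_mul, mul_left_comm, ← C_mul, ← h]
    refine Finset.sum_congr rfl fun j hj => ?_
    have hj' := Finset.mem_range.1 hj
    rw [← Module.End.mul_apply (T ^ (i - 1 - j)) T x, ← pow_succ T, show i - 1 - j + 1 = i - j by omega,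
      show i - 1 - j = i - (j + 1) by omega, pow_succ' X]
    ring
  simp only [torsionPairing]
  rw [Finset.mul_sum, ← Finset.sum_sub_distrib, Finset.sum_congr rfl fun i _ => h1 i]
  have h2 : a.map (algebraMap F K) =
      ∑ i ∈ Finset.range (a.natDegree + 1), C (algebraMap F K (a.coeff i)) * X ^ i := by
    conv_lhs => rw [a.as_sum_range_C_mul_X_pow]
    simp only [Polynomial.map_sum, Polynomial.map_mul, map_C, Polynomial.map_pow, map_X]
  rw [h2, aeval_eq_sum_range, LinearMap.sum_apply, map_sum, map_sum, Finset.sum_mul,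
    ← Finset.sum_sub_distrib]
  refine Finset.sum_congr rfl fun i _ => ?_
  rw [LinearMap.smul_apply, map_smul, Algebra.smul_def, C_mul]
  ring

lemma torsionPairing_degree_lt (x : K) (u : K →ₗ[F] K) :
    (torsionPairing T a x u).degree < a.natDegree := by
  refine (degree_sum_le _ _).trans_lt ((Finset.sup_lt_iff (WithBot.bot_lt_coe _)).2 fun i hi => ?_)
  refine (degree_sum_le _ _).trans_lt ((Finset.sup_lt_iff (WithBot.bot_lt_coe _)).2 fun j hj => ?_)
  have hj' := Finset.mem_range.1 hj
  have hi' := Finset.mem_range.1 hi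
  rw [mul_comm]
  exact (degree_C_mul_X_pow_le j _).trans_lt (by exact_mod_cast (by omega : j < a.natDegree))

-- The leading coefficient of (a(X) - a(T))/(X - T) is 1 as `a` is monic, so the pairing determines
-- u(x). This is the source of its nondegeneracy.
variable {a} in
lemma coeff_torsionPairing (ha : a.Monic) (hd : 0 < a.natDegree) (x : K) (u : K →ₗ[F] K) :
    (torsionPairing T a x u).coeff (a.natDegree - 1) = u x := by
  simp only [torsionPairing, finsetSum_coeff, coeff_X_pow_mul', coeff_C]
  rw [Finset.sum_range_succ, Finset.sum_eq_zero, zero_add,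
    Finset.sum_eq_single (a.natDegree - 1)]
  · simp [ha.leadingCoeff]
  · intro j hj hne
    have := Finset.mem_range.1 hj
    rw [if_pos (by omega), if_neg (by omega)]
  · intro h
    exact absurd (Finset.mem_range.2 (by omega)) h
  · intro i hi
    refine Finset.sum_eq_zero fun j hj => ?_
    have h1 := Finset.mem_range.1 hi
    have h2 := Finset.mem_range.1 hj
    rw [if_pos (by omega), if_neg (by omega)]

/-- The pairing modulo `a`. -/
noncomputable def torsionPairingMod (x : K) (u : K →ₗ[F] K) : AdjoinRoot (a.map (algebraMap F K)) :=
  AdjoinRoot.mk _ (torsionPairing T a x u)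

lemma aeval_apply_zero_of (g : F[X]) {x : K} (hx : aeval T a x = 0) :
    aeval T a (aeval T g x) = 0 := by
  rw [← Module.End.mul_apply, ← map_mul, mul_comm, map_mul, Module.End.mul_apply, hx, map_zero]

lemma torsionPairingMod_T {x : K} (hx : aeval T a x = 0) (u : K →ₗ[F] K) :
    torsionPairingMod T a (T x) u = AdjoinRoot.mk _ X * torsionPairingMod T a x u := by
  have h := congrArg (AdjoinRoot.mk (a.map (algebraMap F K))) (X_mul_torsionPairing T a x u)
  rw [hx, map_zero, C_0, sub_zero, map_sub, map_mul, map_mul, AdjoinRoot.mk_self, zero_mul,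
    sub_eq_zero] at h
  exact h.symm

lemma torsionPairingMod_aeval_left (g : F[X]) {x : K} (hx : aeval T a x = 0) (u : K →ₗ[F] K) :
    torsionPairingMod T a (aeval T g x) u =
      AdjoinRoot.mk _ (g.map (algebraMap F K)) * torsionPairingMod T a x u := by
  induction g using Polynomial.induction_on with
  | C c =>
    rw [aeval_C, map_C, Module.algebraMap_end_apply, torsionPairingMod, torsionPairing_smul_left, map_mul]
    rfl
  | add p q hp hq =>
    rw [map_add, LinearMap.add_apply, torsionPairingMod, torsionPairing_add_left, map_add,
      Polynomial.map_add, map_add, add_mul, ← hp, ← hq]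
    rfl
  | monomial n c ih =>
    have h1 : aeval T (C c * X ^ (n + 1)) x = T (aeval T (C c * X ^ n) x) := by
      rw [pow_succ, ← mul_assoc, mul_comm, map_mul, aeval_X, Module.End.mul_apply]
    rw [h1, torsionPairingMod_T T a (aeval_apply_zero_of T a _ hx), ih, ← mul_assoc, ← map_mul]
    congr 2
    simp only [Polynomial.map_mul, Polynomial.map_pow, map_X, pow_succ]
    ring

lemma torsionPairingMod_coeffAct (g : K[X]) {x : K} (hx : aeval T a x = 0) (u : K →ₗ[F] K) :
    torsionPairingMod T a x (coeffAct T g u) = AdjoinRoot.mk _ g * torsionPairingMod T a x u := by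
  induction g using Polynomial.induction_on with
  | C c =>
    rw [coeffAct_C, torsionPairingMod, torsionPairing_smul_right, map_mul]
    rfl
  | add p q hp hq =>
    have : coeffAct T (p + q) u = coeffAct T p u + coeffAct T q u := by
      rw [coeffAct, map_add]; rfl
    rw [this, torsionPairingMod, torsionPairing_add_right, map_add, map_add, add_mul, ← hp, ← hq]
    rfl
  | monomial n c ih =>
    have h1 : coeffAct T (C c * X ^ (n + 1)) u = coeffAct T (C c * X ^ n) u ∘ₗ T := by
      rw [pow_succ, ← mul_assoc, mul_comm, coeffAct_mul, coeffAct_X]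
    rw [h1, torsionPairingMod, ← torsionPairing_comm T a rfl, ← torsionPairingMod,
      torsionPairingMod_T T a hx, ih, ← mul_assoc, ← map_mul]
    congr 2
    rw [pow_succ]
    ring

lemma torsionPairingMod_sum_left {ι : Type*} (s : Finset ι) (x : ι → K) (u : K →ₗ[F] K) :
    torsionPairingMod T a (∑ i ∈ s, x i) u = ∑ i ∈ s, torsionPairingMod T a (x i) u := by
  have h0 : torsionPairingMod T a 0 u = 0 := by
    rw [torsionPairingMod, ← zero_smul F (0 : K), torsionPairing_smul_left, map_zero, C_0, zero_mul,
      map_zero]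
  have hadd : ∀ x y, torsionPairingMod T a (x + y) u =
      torsionPairingMod T a x u + torsionPairingMod T a y u := fun x y => by
    rw [torsionPairingMod, torsionPairing_add_left, map_add]; rfl
  exact map_sum (⟨⟨fun x => torsionPairingMod T a x u, h0⟩, hadd⟩ : K →+ _) x s

lemma torsionPairingMod_sum_right {ι : Type*} (s : Finset ι) (x : K) (u : ι → (K →ₗ[F] K)) :
    torsionPairingMod T a x (∑ i ∈ s, u i) = ∑ i ∈ s, torsionPairingMod T a x (u i) := by
  have h0 : torsionPairingMod T a x 0 = 0 := by
    rw [torsionPairingMod, ← zero_smul K (0 : K →ₗ[F] K), torsionPairing_smul_right, C_0, zero_mul,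
      map_zero]
  have hadd : ∀ u v, torsionPairingMod T a x (u + v) =
      torsionPairingMod T a x u + torsionPairingMod T a x v := fun u v => by
    rw [torsionPairingMod, torsionPairing_add_right, map_add]; rfl
  exact map_sum (⟨⟨fun u => torsionPairingMod T a x u, h0⟩, hadd⟩ : (K →ₗ[F] K) →+ _) u s

-- The pairing has degree below deg a, so it vanishes as soon as it vanishes modulo a, and u(x) is
-- one of its coefficients. For deg a = 0 the torsion is trivial.
variable {T a} in
lemma eq_zero_of_torsionPairingMod_eq_zero (ha : a.Monic) {x : K} {u : K →ₗ[F] K}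
    (hx : aeval T a x = 0) (h : torsionPairingMod T a x u = 0) : u x = 0 := by
  rcases Nat.eq_zero_or_pos a.natDegree with h0 | hd
  · rw [ha.natDegree_eq_zero.1 h0, map_one, Module.End.one_apply] at hx
    rw [hx, map_zero]
  rw [torsionPairingMod, AdjoinRoot.mk_eq_zero] at h
  have h1 : torsionPairing T a x u = 0 := by
    refine eq_zero_of_dvd_of_degree_lt h ?_
    rw [degree_map, degree_eq_natDegree ha.ne_zero]
    exact torsionPairing_degree_lt T a x u
  rw [← coeff_torsionPairing T ha hd, h1, coeff_zero]

variable [Fintype F]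

variable (F K) in
/-- The `q`-power Frobenius as an `F`-linear map. -/
noncomputable abbrev tauLin : Module.End F K := (FiniteField.frobeniusAlgHom F K).toLinearMap

/-- The semilinearity of τ over K[t], responsible for the twist in the recursion of `tauPowMat`. -/
lemma tauLin_coeffAct (T : Module.End F K) (g : K[X]) (u : K →ₗ[F] K) :
    tauLin F K ∘ₗ coeffAct T g u = coeffAct T (coeffFrob F K g) (tauLin F K ∘ₗ u) := by
  ext x
  have hn : (coeffFrob F K g).natDegree < g.natDegree + 1 := by
    rw [Nat.lt_succ_iff, coeffFrob, coe_mapRingHom]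
    exact natDegree_map_le
  rw [LinearMap.comp_apply, coeffAct_apply T g u x (Nat.lt_succ_self _), coeffAct_apply T _ _ x hn,
    map_sum]
  refine Finset.sum_congr rfl fun i _ => ?_
  rw [coeff_coeffFrob, LinearMap.comp_apply]
  simp only [AlgHom.toLinearMap_apply, FiniteField.frobeniusAlgHom_apply, mul_pow]

variable {r : ℕ}

/-- Only the last row has content: there the relation T = κ_0 + ⋯ + κ_r τ^r is solved for τ^r. -/
lemma tauLin_pow_succ_eq (κ : Fin (r + 1) → K) (hκ : κ (Fin.last r) ≠ 0) (k : Fin r) :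
    tauLin F K ^ ((k : ℕ) + 1) =
      ∑ j : Fin r, coeffAct (twistedOp F κ) (tauMat κ k j) (tauLin F K ^ (j : ℕ)) := by
  by_cases hk : (k : ℕ) + 1 < r
  · rw [Finset.sum_eq_single ⟨k + 1, hk⟩]
    · simp only [tauMat, Matrix.of_apply]
      rw [if_pos hk, if_pos trivial, coeffAct_one]
    · intro j _ hj
      simp only [tauMat, Matrix.of_apply]
      rw [if_pos hk, if_neg (fun h => hj (Fin.ext h)), coeffAct_zero]
    · simp
  · have hkr : (k : ℕ) + 1 = r := by have := k.2; omega
    have hr : 0 < r := by omega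
    have h1 : ∀ j : Fin r, coeffAct (twistedOp F κ) (tauMat κ k j) (tauLin F K ^ (j : ℕ)) =
        (κ (Fin.last r))⁻¹ • ((if (j : ℕ) = 0 then twistedOp F κ else 0) -
          κ j.castSucc • tauLin F K ^ (j : ℕ)) := by
      intro j
      simp only [tauMat, Matrix.of_apply]
      rw [if_neg hk, coeffAct_mul, coeffAct_C, coeffAct_sub, coeffAct_C]
      congr 2
      split_ifs with hj
      · rw [coeffAct_X, hj, pow_zero]
        rfl
      · rw [coeffAct_zero]
    rw [Finset.sum_congr rfl fun j _ => h1 j, ← Finset.smul_sum, Finset.sum_sub_distrib]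
    have h2 : ∑ j : Fin r, (if (j : ℕ) = 0 then twistedOp F κ else 0) = twistedOp F κ := by
      rw [Finset.sum_eq_single ⟨0, hr⟩]
      · simp
      · intro j _ hj
        rw [if_neg (fun h => hj (Fin.ext h))]
      · simp
    have h3 : twistedOp F κ = ∑ i : Fin (r + 1), κ i • tauLin F K ^ (i : ℕ) := by
      rw [twistedOp]
      rfl
    rw [h2, eq_inv_smul_iff₀ hκ, eq_sub_iff_add_eq, h3, Fin.sum_univ_castSucc, hkr, add_comm]
    rfl

/-- The matrix `tauPowMat` describes `τ^n` in terms of `1, τ, …, τ^{r-1}`. -/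
lemma tauLin_pow_add_eq (κ : Fin (r + 1) → K) (hκ : κ (Fin.last r) ≠ 0) (n : ℕ) (i : Fin r) :
    tauLin F K ^ ((i : ℕ) + n) =
      ∑ j : Fin r, coeffAct (twistedOp F κ) (tauPowMat F κ n i j) (tauLin F K ^ (j : ℕ)) := by
  induction n with
  | zero =>
    rw [Finset.sum_eq_single i]
    · rw [tauPowMat, Matrix.one_apply_eq, coeffAct_one, add_zero]
    · intro j _ hj
      rw [tauPowMat, Matrix.one_apply_ne hj.symm, coeffAct_zero]
    · simp
  | succ n ih =>
    have h1 : tauLin F K ^ ((i : ℕ) + (n + 1)) = tauLin F K ∘ₗ tauLin F K ^ ((i : ℕ) + n) := by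
      rw [← add_assoc, pow_succ']
      rfl
    have h2 : ∀ k : Fin r, tauLin F K ∘ₗ tauLin F K ^ (k : ℕ) = tauLin F K ^ ((k : ℕ) + 1) := by
      intro k
      rw [pow_succ']
      rfl
    rw [h1, ih]
    have h3 : ∀ s : Fin r → (K →ₗ[F] K), tauLin F K ∘ₗ (∑ k, s k) = ∑ k, tauLin F K ∘ₗ s k := by
      intro s
      ext x
      simp
    rw [h3]
    simp_rw [tauLin_coeffAct, h2, tauLin_pow_succ_eq κ hκ, map_sum, ← coeffAct_mul]
    rw [Finset.sum_comm]
    refine Finset.sum_congr rfl fun j _ => ?_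
    rw [tauPowMat, Matrix.mul_apply, coeffAct_sum]
    rfl

/-- If the `e_j` generate the `a`-torsion and `τ^d` acts on them through `C`, then the
characteristic polynomials of `C` and of `τ^d` on the `t`-motive agree modulo `a`. -/
theorem dvd_charpoly_sub [IsAlgClosed K] (κ : Fin (r + 1) → K) (hκ : κ (Fin.last r) ≠ 0) (hr : 0 < r)
    {d : ℕ} (hκd : ∀ i, κ i ^ Fintype.card F ^ d = κ i) {P : F[X][X]}
    (hP : P.map (mapRingHom (algebraMap F K)) = (tauPowMat F κ d).charpoly)
    {a : F[X]} (ha : a.Monic) (ha0 : aeval (κ 0) a ≠ 0) {e : Fin r → K}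
    (he : ∀ j, aeval (twistedOp F κ) a (e j) = 0)
    (hspan : ∀ x, aeval (twistedOp F κ) a x = 0 →
      ∃ c : Fin r → F[X], x = ∑ j, aeval (twistedOp F κ) (c j) (e j))
    {M : Matrix (Fin r) (Fin r) F[X]}
    (hM : ∀ j, (tauLin F K ^ d) (e j) = ∑ i, aeval (twistedOp F κ) (M i j) (e i)) (n : ℕ) :
    a ∣ M.charpoly.coeff n - P.coeff n := by
  classical
  set T := twistedOp F κ with hT
  set aK := a.map (algebraMap F K) with haK
  have haKm : aK.Monic := ha.map _
  set π : K[X] →+* AdjoinRoot aK := AdjoinRoot.mk aK with hπ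
  set Ψ : Matrix (Fin r) (Fin r) (AdjoinRoot aK) :=
    Matrix.of fun i j => torsionPairingMod T a (e j) (tauLin F K ^ (i : ℕ)) with hΨ
  set B := (tauPowMat F κ d).map π with hB
  set M' := M.map (π.comp (mapRingHom (algebraMap F K))) with hM'
  have hcomm : tauLin F K ^ d * T = T * tauLin F K ^ d := by
    rw [hT, twistedOp, Finset.mul_sum, Finset.sum_mul]
    refine Finset.sum_congr rfl fun i _ => LinearMap.ext fun x => ?_
    simp only [Module.End.mul_apply, LinearMap.mulLeft_apply, frobenius_pow_apply]
    rw [mul_pow, hκd, ← pow_mul, ← pow_mul, mul_comm (_ ^ (i : ℕ))]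
  -- Both sides are the pairing of τ^d e_j with τ^i: on the left τ^d is expanded on the motive, on
  -- the right on the torsion points.
  have h1 : B * Ψ = Ψ * M' := by
    ext1 i j
    have hl : (B * Ψ) i j = torsionPairingMod T a (e j) (tauLin F K ^ ((i : ℕ) + d)) := by
      rw [tauLin_pow_add_eq κ hκ, torsionPairingMod_sum_right, Matrix.mul_apply]
      refine Finset.sum_congr rfl fun k _ => ?_
      rw [torsionPairingMod_coeffAct T a _ (he j)]
      rfl
    have hr' : (Ψ * M') i j = torsionPairingMod T a ((tauLin F K ^ d) (e j)) (tauLin F K ^ (i : ℕ)) := by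
      rw [hM, torsionPairingMod_sum_left, Matrix.mul_apply]
      refine Finset.sum_congr rfl fun k _ => ?_
      rw [torsionPairingMod_aeval_left T a _ (he k), mul_comm]
      rfl
    rw [hl, hr', torsionPairingMod, torsionPairingMod, torsionPairing_comm T a hcomm, pow_add]
    rfl
  -- Representatives of degree below deg a of a vector in the left kernel give a combination of the
  -- τ^i that pairs to 0 with all generators. It vanishes on the whole a-torsion, hence is zero by
  -- `eq_zero_of_vanishing`.
  have hinj : ∀ v : Fin r → AdjoinRoot aK, Matrix.vecMul v Ψ = 0 → v = 0 := by
    intro v hv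
    set g : Fin r → K[X] := fun i => AdjoinRoot.modByMonicHom haKm (v i) with hg
    have hgv : ∀ i, π (g i) = v i := fun i => AdjoinRoot.mk_leftInverse haKm (v i)
    have hgd : ∀ i, (g i).degree < a.natDegree := by
      intro i
      obtain ⟨p, hp⟩ := AdjoinRoot.mk_surjective (v i)
      rw [hg]
      simp only
      rw [← hp, AdjoinRoot.modByMonicHom_mk]
      refine (degree_modByMonic_lt _ haKm).trans_le ?_
      rw [haK, degree_map, degree_eq_natDegree ha.ne_zero]
    have hu : ∀ j, torsionPairingMod T a (e j)
        (∑ i, coeffAct T (g i) (tauLin F K ^ (i : ℕ))) = 0 := by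
      intro j
      rw [torsionPairingMod_sum_right, ← Pi.zero_apply (M := fun _ => AdjoinRoot aK) j, ← hv,
        Matrix.vecMul, dotProduct]
      refine Finset.sum_congr rfl fun i _ => ?_
      rw [torsionPairingMod_coeffAct T a _ (he j), ← hgv i]
      rfl
    have hg0 : g = 0 := by
      refine eq_zero_of_vanishing κ hκ hr ha0 g hgd fun x hx => ?_
      obtain ⟨c, hc⟩ := hspan x hx
      have hxu : torsionPairingMod T a x (∑ i, coeffAct T (g i) (tauLin F K ^ (i : ℕ))) = 0 := by
        rw [hc, torsionPairingMod_sum_left]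
        refine Finset.sum_eq_zero fun j _ => ?_
        rw [torsionPairingMod_aeval_left T a _ (he j), hu, mul_zero]
      have h := eq_zero_of_torsionPairingMod_eq_zero ha hx hxu
      rw [LinearMap.sum_apply] at h
      rw [← h]
      refine Finset.sum_congr rfl fun i _ => ?_
      have hlt : a.natDegree = 0 ∨ (g i).natDegree < a.natDegree := by
        rcases Nat.eq_zero_or_pos a.natDegree with h0 | h0
        · exact Or.inl h0
        · refine Or.inr ?_
          by_cases hg : g i = 0
          · rwa [hg, natDegree_zero]
          · exact (natDegree_lt_iff_degree_lt hg).2 (hgd i)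
      rcases hlt with h0 | hlt
      · have hgi : g i = 0 := by
          have := hgd i
          rw [h0, Nat.cast_zero] at this
          exact degree_eq_bot.1 (Nat.WithBot.lt_zero_iff.1 this)
        rw [hgi, h0, coeffAct_zero]
        simp
      · rw [coeffAct_apply T (g i) _ x hlt]
        simp only [frobenius_pow_apply, frobHom_apply]
        rfl
    funext i
    rw [← hgv i, hg0]
    simp
  -- K[t]/a is finite-dimensional over K, so injectivity implies surjectivity; thus `B` and `M'` are
  -- conjugate.
  have hunit : IsUnit Ψ := by
    have : Module.Finite K (AdjoinRoot aK) := haKm.finite_adjoinRoot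
    have hs : Function.Surjective ((Matrix.vecMulLinear Ψ).restrictScalars K) := by
      rw [← LinearMap.injective_iff_surjective, ← LinearMap.ker_eq_bot, LinearMap.ker_eq_bot']
      intro v hv
      exact hinj v hv
    rw [← Matrix.vecMul_surjective_iff_isUnit]
    exact hs
  obtain ⟨U, hU⟩ := hunit
  have h2 : M' = (U⁻¹ : (Matrix (Fin r) (Fin r) (AdjoinRoot aK))ˣ).val * B * U.val := by
    rw [Matrix.mul_assoc, hU, h1, ← hU, ← Matrix.mul_assoc, Units.inv_mul, Matrix.one_mul]
  have h3 : M'.charpoly = B.charpoly := by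
    rw [h2, Matrix.coe_units_inv]
    exact Matrix.charpoly_units_conj' U B
  rw [hM', hB, Matrix.charpoly_map, Matrix.charpoly_map, ← hP, Polynomial.map_map] at h3
  have h4 := congrArg (fun p => coeff p n) h3
  simp only [coeff_map, RingHom.comp_apply, coe_mapRingHom] at h4
  rw [← sub_eq_zero, ← map_sub, hπ, AdjoinRoot.mk_eq_zero, ← Polynomial.map_sub, haK] at h4
  exact (map_dvd_map' _).1 h4

end Comparison

/-! ### A basis of the torsion from its cardinality -/

section Torsion

variable {F : Type*} [Field F] [Fintype F] {M : Type*} [AddCommGroup M] [Module F[X] M] {r : ℕ}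

/-- The `l`-torsion of a module over `F[X]` has an `F[X]/l`-basis of length `r` if it has
`q^{r deg l}` elements. -/
lemma exists_torsion_basis {l : F[X]} (hl : Irreducible l)
    (hcard : Nat.card {x : M // l • x = 0} = Fintype.card F ^ (r * l.natDegree)) :
    ∃ v : Fin r → M, (∀ j, l • v j = 0) ∧
      (∀ x : M, l • x = 0 → ∃ c : Fin r → F[X], x = ∑ j, c j • v j) ∧
      (∀ c : Fin r → F[X], ∑ j, c j • v j = 0 → ∀ j, l ∣ c j) := by
  have hmax : (Ideal.span {l}).IsMaximal := PrincipalIdealRing.isMaximal_of_irreducible hl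
  let : Field (F[X] ⧸ Ideal.span {l}) := Ideal.Quotient.field _
  have hk : Nat.card (F[X] ⧸ Ideal.span {l}) = Fintype.card F ^ l.natDegree := by
    have : Module.Finite F (AdjoinRoot l) := (AdjoinRoot.powerBasis hl.ne_zero).finite
    have h := Module.natCard_eq_pow_finrank (K := F) (V := AdjoinRoot l)
    rw [(AdjoinRoot.powerBasis hl.ne_zero).finrank, AdjoinRoot.powerBasis_dim,
      Nat.card_eq_fintype_card (α := F)] at h
    exact h
  let N := Submodule.torsionBy F[X] M l
  have hN : Nat.card N = Fintype.card F ^ (r * l.natDegree) := hcard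
  have hfin : Finite N := Nat.finite_of_card_ne_zero (by rw [hN]; exact pow_ne_zero _ Fintype.card_ne_zero)
  have : Module.Finite (F[X] ⧸ Ideal.span {l}) N := Module.Finite.of_finite
  -- The torsion is a vector space over a field with q^{deg l} elements, so its cardinality
  -- determines its dimension.
  have hrank : Module.finrank (F[X] ⧸ Ideal.span {l}) N = r := by
    have h := Module.natCard_eq_pow_finrank (K := F[X] ⧸ Ideal.span {l}) (V := N)
    rw [hN, hk, ← pow_mul, mul_comm r] at h
    have h2 := Nat.pow_right_injective (one_lt_card (F := F)) h
    exact (Nat.eq_of_mul_eq_mul_left hl.natDegree_pos h2).symm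
  let b := Module.finBasisOfFinrankEq (F[X] ⧸ Ideal.span {l}) N hrank
  have hmk : ∀ (c : F[X]) (y : N), ((Ideal.Quotient.mk (Ideal.span {l}) c • y : N) : M) = c • (y : M) :=
    fun c y => rfl
  refine ⟨fun j => (b j : M), fun j => (b j).2, fun x hx => ?_, fun c hc j => ?_⟩
  · have h := b.sum_repr ⟨x, hx⟩
    choose c hc using fun j => Ideal.Quotient.mk_surjective (b.repr ⟨x, hx⟩ j)
    refine ⟨c, ?_⟩
    have h2 := congrArg (fun y : N => (y : M)) h
    simp only [← hc, Submodule.coe_sum, hmk] at h2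
    exact h2.symm
  · have h : ∑ j, Ideal.Quotient.mk (Ideal.span {l}) (c j) • b j = 0 := by
      apply Subtype.ext
      simpa only [Submodule.coe_sum, hmk, Submodule.coe_zero] using hc
    have h2 := Fintype.linearIndependent_iff.1 b.linearIndependent _ h j
    rwa [Ideal.Quotient.eq_zero_iff_mem, Ideal.mem_span_singleton] at h2

end Torsion

/-! ### Polynomials embed into the adic completion -/

section AdicInjective

/-- A polynomial in the kernel is divisible by every power of l, which is impossible for a nonzero
one by degree. -/
lemma algebraMap_adicCompletion_injective {F : Type*} [Field F] {l : F[X]} (hl : Irreducible l) :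
    Function.Injective (algebraMap F[X] (AdicCompletion (Ideal.span {l}) F[X])) := by
  rw [injective_iff_map_eq_zero]
  intro p hp
  by_contra h0
  have h : ∀ n, l ^ n ∣ p := by
    intro n
    have h1 := congrArg (AdicCompletion.evalₐ (Ideal.span {l}) n) hp
    rw [AlgHom.commutes, map_zero] at h1
    change Ideal.Quotient.mk _ p = 0 at h1
    rwa [Ideal.Quotient.eq_zero_iff_mem, Ideal.span_singleton_pow, Ideal.mem_span_singleton] at h1
  have h2 := natDegree_le_of_dvd (h (p.natDegree + 1)) h0
  rw [natDegree_pow] at h2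
  have := Nat.mul_le_mul_left (p.natDegree + 1) (Nat.succ_le_of_lt hl.natDegree_pos)
  omega

end AdicInjective

/-! ### Coefficients on the dual module -/

section Contragredient

variable {S : Type*} [CommRing S] {N : Type*} [AddCommGroup N] [Module S N] {n : ℕ}

lemma isUnit_det_toMatrix (b : Module.Basis (Fin n) S N) {g : Module.End S N} (hg : IsUnit g) :
    IsUnit (LinearMap.toMatrix b b g).det :=
  (Matrix.isUnit_iff_isUnit_det _).1 (hg.map (LinearMap.toMatrixAlgEquiv b))

lemma exists_contragredient_coeff [Nontrivial S] {g : Module.End S N} {P : S[X]}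
    (hP : HasCharpoly g P) (hPn : P.natDegree = n)
    (hg : IsUnit g) :
    IsUnit (P.coeff 0) ∧ ∃ (D : Module.End S (Module.Dual S N)) (R : S[X]), (∀ ξ x, D ξ (g x) = ξ x) ∧
      HasCharpoly D R ∧ (∀ i ≤ n, P.coeff 0 * R.coeff i = P.coeff (n - i)) ∧
      ∀ i, n < i → R.coeff i = 0 := by
  obtain ⟨m, b, hb⟩ := hP
  have hm : m = n := by
    rw [← hPn, ← hb, Matrix.charpoly_natDegree_eq_dim, Fintype.card_fin]
  subst hm
  obtain ⟨D, hD, hDc, -⟩ := exists_contragredient b g (isUnit_det_toMatrix b hg)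
  refine ⟨?_, D, _, hD, hDc, fun i hi => ?_, fun i hi => ?_⟩
  · have h := isUnit_det_toMatrix b hg
    rw [Matrix.det_eq_sign_charpoly_coeff, hb] at h
    exact isUnit_of_mul_isUnit_right h
  · rw [← hb]
    exact coeff_charpoly_inv _ (isUnit_det_toMatrix b hg) hi
  · rw [coeff_eq_zero_of_natDegree_lt]
    rwa [Matrix.charpoly_natDegree_eq_dim, Fintype.card_fin]

/-- The contragredient of an automorphism is unique. Its coefficients are known through relations s
R = t, which encode fractions t/s in K; the conclusion is their cross-multiplied equality. -/
lemma contragredient_coeff_unique {g : Module.End S N} {P : S[X]} (hP : HasCharpoly g P)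
    (hg : IsUnit g)
    {s s' t t' : ℕ → S}
    (h : ∃ (D : Module.End S (Module.Dual S N)) (R : S[X]), (∀ ξ x, D ξ (g x) = ξ x) ∧
      HasCharpoly D R ∧ ∀ i, s i * R.coeff i = t i)
    (h' : ∃ (D : Module.End S (Module.Dual S N)) (R : S[X]), (∀ ξ x, D ξ (g x) = ξ x) ∧
      HasCharpoly D R ∧ ∀ i, s' i * R.coeff i = t' i) (i : ℕ) : t i * s' i = t' i * s i := by
  obtain ⟨m, b, -⟩ := hP
  obtain ⟨E, -, -, hE⟩ := exists_contragredient b g (isUnit_det_toMatrix b hg)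
  obtain ⟨D, R, hD, hDR, hR⟩ := h
  obtain ⟨D', R', hD', hDR', hR'⟩ := h'
  rw [hE D hD] at hDR
  rw [hE D' hD'] at hDR'
  rw [← hR, ← hR', hDR.eq hDR']
  ring

end Contragredient

/-! ### Existence and uniqueness of Frobenius polynomials -/

section FrobPoly

variable {F : Type*} [Field F]

lemma MonicIrred.eq_of_dvd {f l : MonicIrred F} (h : f.1 ∣ l.1) : l = f :=
  Subtype.ext (eq_of_monic_of_associated l.2.1 f.2.1 (f.2.2.associated_of_dvd l.2.2 h).symm)

/-- Ensures that the conditions over all λ ≠ f are not vacuous, so that Frobenius polynomials are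
unique. -/
lemma MonicIrred.exists_ne (f : MonicIrred F) : ∃ l : MonicIrred F, l ≠ f := by
  by_cases h : f.1 = X
  · refine ⟨⟨X - C 1, monic_X_sub_C 1, irreducible_X_sub_C 1⟩, fun hf => ?_⟩
    have h2 := congrArg (fun p => eval 0 p.1) hf
    simp [h] at h2
  · exact ⟨⟨X, monic_X, irreducible_X⟩, fun hf => h (congrArg Subtype.val hf).symm⟩

/-- A nonzero polynomial with no monic irreducible factor is a unit, that is, a nonzero constant. -/
lemma DrinfeldModule.EverywhereGoodReduction.lead_eq {r : ℕ} {φ : DrinfeldModule F r}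
    (hφ : φ.EverywhereGoodReduction) : φ.lead = C (φ.lead.coeff 0) ∧ φ.lead.coeff 0 ≠ 0 := by
  have hu : IsUnit φ.lead := by
    by_contra hu
    obtain ⟨g, hg, hgd⟩ := WfDvdMonoid.exists_irreducible_factor hu φ.coeff_last_ne_zero
    classical
    refine hφ ⟨normalize g, monic_normalize hg.ne_zero, (associated_normalize g).irreducible hg⟩ ?_
    exact (normalize_dvd_iff).2 hgd
  obtain ⟨c, hc, h⟩ := Polynomial.isUnit_iff.1 hu
  rw [← h, coeff_C_zero]
  exact ⟨rfl, hc.ne_zero⟩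

variable [Fintype F] {r : ℕ} (φ : DrinfeldModule F r) (f : MonicIrred F)

lemma smul_reductionPoints_of (p : F[X]) (x : ResidueClosure f) :
    p • Module.AEval'.of (φ.reductionOp f) x =
      Module.AEval'.of (φ.reductionOp f) (aeval (φ.reductionOp f) p x) :=
  (Module.AEval.of_aeval_smul _ p x).symm

lemma frob_of (x : ResidueClosure f) : φ.frob f (Module.AEval'.of (φ.reductionOp f) x) =
    Module.AEval'.of (φ.reductionOp f) ((tauLin F (ResidueClosure f) ^ f.1.natDegree) x) := rfl

lemma aeval_residue_eq_zero_iff (p : F[X]) :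
    aeval (algebraMap (AdjoinRoot f.1) (ResidueClosure f) (AdjoinRoot.mk f.1 (φ.coeff 0))) p = 0 ↔
      f.1 ∣ p := by
  rw [φ.coeff_zero, AdjoinRoot.mk_X, aeval_algebraMap_apply,
    FaithfulSMul.algebraMap_eq_zero_iff, AdjoinRoot.aeval_eq, AdjoinRoot.mk_eq_zero]

variable {φ}

/-- Existence of the characteristic polynomial of Frobenius, with its constant term and bounds on
the degrees of its coefficients. -/
theorem exists_isFrobPoly (hr : 0 < r) (hφ : φ.EverywhereGoodReduction) :
    ∃ P : F[X][X], φ.IsFrobPoly f P ∧ P.Monic ∧ P.natDegree = r ∧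
      P.coeff 0 = C ((-1) ^ r * (φ.chi f.1)⁻¹) * f.1 ∧
      ∀ m, r * (P.coeff m).natDegree ≤ f.1.natDegree * (r - m) := by
  obtain ⟨hc, hc0⟩ := hφ.lead_eq
  set c := φ.lead.coeff 0 with hcdef
  let κ : Fin (r + 1) → ResidueClosure f := fun i =>
    algebraMap (AdjoinRoot f.1) (ResidueClosure f) (AdjoinRoot.mk f.1 (φ.coeff i))
  have hlast : κ (Fin.last r) = algebraMap F (ResidueClosure f) c := by
    change algebraMap (AdjoinRoot f.1) (ResidueClosure f) (AdjoinRoot.mk f.1 φ.lead) = _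
    rw [hc, AdjoinRoot.mk_C]
    exact (IsScalarTower.algebraMap_apply F (AdjoinRoot f.1) (ResidueClosure f) c).symm
  have hκ : κ (Fin.last r) ≠ 0 := by
    rw [hlast, _root_.map_ne_zero]
    exact hc0
  have hκd : ∀ i, κ i ^ Fintype.card F ^ f.1.natDegree = κ i := fun i => by
    simp only [κ]
    rw [← map_pow, residue_pow]
  obtain ⟨P, hP⟩ := exists_charpoly_descent f.2.2.natDegree_pos hκd
  have hinj : Function.Injective (mapRingHom (algebraMap F (ResidueClosure f))) :=
    map_injective _ (algebraMap F (ResidueClosure f)).injective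
  have hmonic : P.Monic := monic_of_injective hinj (by rw [hP]; exact Matrix.charpoly_monic _)
  have hdeg : P.natDegree = r := by
    rw [← natDegree_map_eq_of_injective hinj, hP, Matrix.charpoly_natDegree_eq_dim, Fintype.card_fin]
  have hcoeff : ∀ m, (P.coeff m).map (algebraMap F (ResidueClosure f)) =
      (tauPowMat F κ f.1.natDegree).charpoly.coeff m := fun m => by
    rw [← hP, coeff_map]; rfl
  refine ⟨P, fun l hl => ?_, hmonic, hdeg, ?_, fun m => ?_⟩
  · have hl0 : aeval (κ 0) l.1 ≠ 0 := by
      rw [Ne, aeval_residue_eq_zero_iff]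
      exact fun h => hl (MonicIrred.eq_of_dvd h)
    obtain ⟨v, hv, hspan, hind⟩ := exists_torsion_basis (M := φ.ReductionPoints f) (r := r) l.2.2 (by
      rw [← card_torsion κ hκ hr hl0]
      refine Nat.card_congr ((Module.AEval'.of (φ.reductionOp f)).toEquiv.subtypeEquiv fun x => ?_).symm
      change _ ↔ l.1 • Module.AEval'.of (φ.reductionOp f) x = 0
      rw [smul_reductionPoints_of, LinearEquiv.map_eq_zero_iff]
      rfl)
    have hsurj : ∀ x : φ.ReductionPoints f, ∃ y, l.1 • y = x := by
      intro x
      obtain ⟨x, rfl⟩ := (Module.AEval'.of (φ.reductionOp f)).surjective x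
      obtain ⟨y, hy⟩ := aeval_twistedOp_surjective κ hκ hr l.2.2.ne_zero x
      exact ⟨Module.AEval'.of (φ.reductionOp f) y, by
        rw [smul_reductionPoints_of]; exact congrArg _ hy⟩
    -- At level m the requirement is the comparison with the t-motive modulo a = λ^m, valid because
    -- λ ≠ f gives a(κ_0) ≠ 0.
    obtain ⟨b, hb⟩ := exists_tate_basis hsurj hv hspan hind (φ.frob f) P (by
      intro m e M he hespan hM n
      obtain ⟨e', rfl⟩ : ∃ e' : Fin r → ResidueClosure f,
          e = fun j => Module.AEval'.of (φ.reductionOp f) (e' j) :=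
        ⟨fun j => (Module.AEval'.of (φ.reductionOp f)).symm (e j), by simp⟩
      simp only [smul_reductionPoints_of, LinearEquiv.map_eq_zero_iff, frob_of, ← map_sum,
        EmbeddingLike.apply_eq_iff_eq] at he hM
      refine dvd_charpoly_sub κ hκ hr hκd hP (l.2.1.pow m)
        (by rw [map_pow]; exact pow_ne_zero _ hl0) he (fun x hx => ?_) hM n
      obtain ⟨c, hc⟩ := hespan (Module.AEval'.of (φ.reductionOp f) x) (by
        rw [smul_reductionPoints_of, LinearEquiv.map_eq_zero_iff]; exact hx)
      refine ⟨c, ?_⟩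
      simp only [smul_reductionPoints_of, ← map_sum, EmbeddingLike.apply_eq_iff_eq] at hc
      exact hc)
    exact ⟨r, b, hb⟩
  · have h0 : aeval (κ 0) f.1 = 0 := (aeval_residue_eq_zero_iff φ f f.1).2 dvd_rfl
    have h1 := det_tauPowMat_eq hr f.2.1 f.2.2 h0 (hκd 0) hlast
    rw [Matrix.det_eq_sign_charpoly_coeff, Fintype.card_fin, ← hcoeff] at h1
    apply map_injective _ (algebraMap F (ResidueClosure f)).injective
    have h2 : (-1 : (ResidueClosure f)[X]) ^ r * (-1) ^ r = 1 := by
      rw [← mul_pow]; simp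
    rw [← one_mul ((P.coeff 0).map _), ← h2, mul_assoc, h1, DrinfeldModule.chi, ← hcdef]
    -- The signs (-1)^{r+1} in χ_φ and (-1)^{r-1} in the determinant agree.
    have h3 : (((-1) ^ (r + 1) * c) ^ f.1.natDegree)⁻¹ = ((-1 : F) ^ (r - 1) * c⁻¹) ^ f.1.natDegree := by
      rw [← inv_pow, mul_inv, ← inv_pow]
      congr 2
      obtain ⟨n, rfl⟩ : ∃ n, r = n + 1 := ⟨r - 1, by omega⟩
      rw [Nat.add_sub_cancel, inv_neg, inv_one, add_assoc, pow_add]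
      norm_num
    rw [h3]
    simp only [Polynomial.map_mul, C_mul, Polynomial.map_pow, Polynomial.map_neg,
      Polynomial.map_one, C_pow, C_neg, C_1, mul_assoc]
  · rw [← natDegree_map (algebraMap F (ResidueClosure f)), hcoeff]
    exact natDegree_coeff_charpoly_tauPowMat F κ _ m

variable (φ) in
lemma DrinfeldModule.IsFrobPoly.eq {f} {P Q : F[X][X]} (hP : φ.IsFrobPoly f P) (hQ : φ.IsFrobPoly f Q) :
    P = Q := by
  obtain ⟨l, hl⟩ := MonicIrred.exists_ne f
  exact map_injective _ (algebraMap_adicCompletion_injective l.2.2) (HasCharpoly.eq (N := tateModule l.1 (φ.ReductionPoints f)) (hP l hl) (hQ l hl))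

/-- By existence and uniqueness the choice made by `Classical.epsilon` is the constructed
polynomial. -/
lemma frobPoly_spec (hr : 0 < r) (hφ : φ.EverywhereGoodReduction) :
    φ.IsFrobPoly f (φ.frobPoly f) ∧ (φ.frobPoly f).Monic ∧ (φ.frobPoly f).natDegree = r ∧
      (φ.frobPoly f).coeff 0 = C ((-1) ^ r * (φ.chi f.1)⁻¹) * f.1 ∧
      ∀ m, r * ((φ.frobPoly f).coeff m).natDegree ≤ f.1.natDegree * (r - m) := by
  obtain ⟨P, hP, h⟩ := exists_isFrobPoly f hr hφ
  have : φ.frobPoly f = P :=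
    DrinfeldModule.IsFrobPoly.eq φ (Classical.epsilon_spec ⟨P, hP⟩) hP
  rw [this]
  exact ⟨hP, h⟩

lemma DrinfeldModule.EverywhereGoodReduction.chi_ne_zero (hφ : φ.EverywhereGoodReduction) (a : F[X]) :
    φ.chi a ≠ 0 :=
  pow_ne_zero _ (mul_ne_zero (pow_ne_zero _ (neg_ne_zero.2 one_ne_zero)) hφ.lead_eq.2)

-- The map x ↦ x^{q^d} is bijective on an algebraically closed field of characteristic p, and its
-- inverse commutes with the module structure.
variable (φ) in
lemma isUnit_frobTate (l : MonicIrred F) : IsUnit (φ.frobTate f l) := by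
  have hbij : Function.Bijective (φ.frob f) := by
    constructor
    · rw [← LinearMap.ker_eq_bot, LinearMap.ker_eq_bot']
      intro x hx
      obtain ⟨x, rfl⟩ := (Module.AEval'.of (φ.reductionOp f)).surjective x
      rw [frob_of, LinearEquiv.map_eq_zero_iff, frobenius_pow_apply] at hx
      rw [eq_zero_of_pow_eq_zero hx, map_zero]
    · intro y
      obtain ⟨y, rfl⟩ := (Module.AEval'.of (φ.reductionOp f)).surjective y
      obtain ⟨x, hx⟩ := IsAlgClosed.exists_pow_nat_eq y
        (pow_pos (Fintype.card_pos (α := F)) f.1.natDegree)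
      exact ⟨Module.AEval'.of (φ.reductionOp f) x, by rw [frob_of, frobenius_pow_apply, hx]⟩
  let e := LinearEquiv.ofBijective (φ.frob f) hbij
  refine ⟨⟨φ.frobTate f l, tateMap l.1 e.symm.toLinearMap, ?_, ?_⟩, rfl⟩
  · exact LinearMap.ext fun x => Subtype.ext (funext fun m => e.apply_symm_apply _)
  · exact LinearMap.ext fun x => Subtype.ext (funext fun m => e.symm_apply_apply _)

/-- The characteristic polynomial of Frobenius on the dual Tate module is
`P(0)⁻¹ X^r P(X⁻¹)`. -/
lemma isFrobPolyDual_reverse {P : F[X][X]} (hP : φ.IsFrobPoly f P) (hPr : P.natDegree = r)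
    (h0 : P.coeff 0 ≠ 0) :
    φ.IsFrobPolyDual f (C (algebraMap F[X] (RatFunc F) (P.coeff 0))⁻¹ *
      (P.map (algebraMap F[X] (RatFunc F))).reverse) := by
  intro l hl
  have hι := algebraMap_adicCompletion_injective l.2.2
  set ι := algebraMap F[X] (AdicCompletion (Ideal.span {l.1}) F[X]) with hιdef
  have : Nontrivial (AdicCompletion (Ideal.span {l.1}) F[X]) := hι.nontrivial
  have hex := exists_contragredient_coeff (n := r)
    (N := tateModule l.1 (φ.ReductionPoints f)) (hP l hl)
    ((natDegree_map_eq_of_injective hι P).trans hPr) (isUnit_frobTate φ f l)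
  obtain ⟨hu0, hex⟩ := hex
  obtain ⟨D, hex⟩ := hex
  obtain ⟨R, hD, hDR, hR, hR0⟩ := hex
  rw [coeff_map] at hu0
  refine ⟨D, R, hD, hDR, fun i => ?_⟩
  have hK := IsFractionRing.injective F[X] (RatFunc F)
  set p := (C (algebraMap F[X] (RatFunc F) (P.coeff 0))⁻¹ *
      (P.map (algebraMap F[X] (RatFunc F))).reverse).coeff i with hp
  have hdeg : (P.map (algebraMap F[X] (RatFunc F))).natDegree = r := by
    rw [natDegree_map_eq_of_injective hK, hPr]
  by_cases hi : i ≤ r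
  · have h1 := hR i hi
    rw [coeff_map, coeff_map] at h1
    have h2 : algebraMap F[X] (RatFunc F) (P.coeff 0) * p =
        algebraMap F[X] (RatFunc F) (P.coeff (r - i)) := by
      rw [hp, coeff_C_mul, coeff_reverse, hdeg, revAt_le hi, coeff_map, ← mul_assoc,
        mul_inv_cancel₀ ((map_ne_zero_iff _ hK).2 h0), one_mul]
    have h3 : P.coeff 0 * p.num = P.coeff (r - i) * p.denom := by
      apply hK
      rw [map_mul, map_mul, ← h2, mul_assoc]
      congr 1
      exact ((div_eq_iff ((map_ne_zero_iff _ hK).2 (RatFunc.denom_ne_zero p))).1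
        (RatFunc.num_div_denom p))
    -- The constant term P(0) is a unit in the completion at λ, since Frobenius is invertible there;
    -- this permits the comparison of the fraction with the adic coefficient.
    apply hu0.mul_left_cancel
    rw [mul_left_comm, h1, ← map_mul, ← map_mul, h3, mul_comm]
  · have h1 : p = 0 := by
      rw [hp, coeff_eq_zero_of_natDegree_lt]
      refine (natDegree_C_mul_le _ _).trans_lt ((reverse_natDegree_le _).trans_lt ?_)
      omega
    rw [h1, hR0 i (by omega), RatFunc.num_zero, mul_zero, map_zero]

variable (φ) in
lemma DrinfeldModule.IsFrobPolyDual.eq {f} {P : F[X][X]} (hP : φ.IsFrobPoly f P)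
    {Q Q' : (RatFunc F)[X]} (hQ : φ.IsFrobPolyDual f Q) (hQ' : φ.IsFrobPolyDual f Q') : Q = Q' := by
  obtain ⟨l, hl⟩ := MonicIrred.exists_ne f
  have hι := algebraMap_adicCompletion_injective l.2.2
  have hK := IsFractionRing.injective F[X] (RatFunc F)
  have h := contragredient_coeff_unique (N := tateModule l.1 (φ.ReductionPoints f)) (hP l hl)
    (isUnit_frobTate φ f l) (hQ l hl) (hQ' l hl)
  ext i
  have h1 : (Q.coeff i).num * (Q'.coeff i).denom = (Q'.coeff i).num * (Q.coeff i).denom := by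
    apply hι
    rw [map_mul, map_mul]
    exact h i
  rw [← RatFunc.num_div_denom (Q.coeff i), ← RatFunc.num_div_denom (Q'.coeff i),
    div_eq_div_iff ((map_ne_zero_iff _ hK).2 (RatFunc.denom_ne_zero _))
      ((map_ne_zero_iff _ hK).2 (RatFunc.denom_ne_zero _)), ← map_mul, ← map_mul, h1]

lemma frobPoly_coeff_zero_ne_zero (hr : 0 < r) (hφ : φ.EverywhereGoodReduction) :
    (φ.frobPoly f).coeff 0 ≠ 0 := by
  rw [(frobPoly_spec f hr hφ).2.2.2.1]
  refine mul_ne_zero (C_ne_zero.2 (mul_ne_zero (pow_ne_zero _ (neg_ne_zero.2 one_ne_zero))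
    (inv_ne_zero (hφ.chi_ne_zero _)))) f.2.2.ne_zero

lemma frobPolyDual_eq (hr : 0 < r) (hφ : φ.EverywhereGoodReduction) :
    φ.frobPolyDual f = C (algebraMap F[X] (RatFunc F) ((φ.frobPoly f).coeff 0))⁻¹ *
      ((φ.frobPoly f).map (algebraMap F[X] (RatFunc F))).reverse := by
  obtain ⟨hP, -, hd, -, -⟩ := frobPoly_spec f hr hφ
  have h := isFrobPolyDual_reverse f hP hd (frobPoly_coeff_zero_ne_zero f hr hφ)
  exact DrinfeldModule.IsFrobPolyDual.eq φ hP (Classical.epsilon_spec ⟨_, h⟩) h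

end FrobPoly

/-! ### Reciprocal polynomials and inverse roots -/

section InverseRoots

variable {n : ℕ}

lemma schur_isSymmetric (n : ℕ) (k : Fin (n - 1) → ℕ) : (schur n k).IsSymmetric :=
  altQ_isSymmetric n _

lemma schur_zero (n : ℕ) : schur n (fun _ => 0) = 1 := by
  have h := vandermonde_mul_altQ n (schurExponent n fun _ => 0)
  have h1 : alternant n (schurExponent n fun _ => 0) = vandermonde n := by
    have h2 := evalAt_alternant (MvPolynomial.X : Fin n → MvPolynomial (Fin n) ℤ)
      (schurExponent n fun _ => 0)
    have h3 := evalAt_vandermonde (MvPolynomial.X : Fin n → MvPolynomial (Fin n) ℤ)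
    rw [evalAt_X] at h2 h3
    rw [h2, h3, schur_zero_exponent, det_altMat_delta]
  have hV : vandermonde n ≠ 0 := vand_ne_zero MvPolynomial.X_injective
  rw [h1] at h
  exact mul_left_cancel₀ hV (h.trans (mul_one _).symm)

lemma sum_schurExponent (n : ℕ) (k : Fin (n - 1) → ℕ) :
    ∑ i, schurExponent n k i =
      ∑ m : Fin (n - 1), ((m : ℕ) + 1) * k m + ∑ i : Fin n, (n - 1 - (i : ℕ)) := by
  simp only [schurExponent, Finset.sum_add_distrib]
  congr 1
  rw [Finset.sum_comm]
  refine Finset.sum_congr rfl fun m _ => ?_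
  have hm := m.2
  rw [← Finset.sum_filter, Finset.sum_const, smul_eq_mul]
  congr 1
  have h : (Finset.univ.filter fun i : Fin n => (i : ℕ) ≤ m) =
      Finset.Iic (⟨m, by omega⟩ : Fin n) := by
    ext i
    simp [Fin.le_def]
  rw [h, Fin.card_Iic]

/-- The inverses of the roots of the normalized reciprocal polynomial of `P` are the roots of `P`. -/
lemma prod_X_sub_C_inv {k : Type*} [Field k] [IsAlgClosed k] {P : k[X]} (hP : P.Monic)
    (hn : P.natDegree = n) (h0 : P.coeff 0 ≠ 0) {x : Fin n → k}
    (hx : ∏ i, (X - C (x i)) = C (P.coeff 0)⁻¹ * P.reverse) :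
    ∏ i, (X - C (x i)⁻¹) = P ∧ ∀ i, x i ≠ 0 := by
  obtain ⟨y, hy⟩ := exists_prod_eq hP hn
  have hc : P.coeff 0 = ∏ i, -y i := by
    rw [coeff_zero_eq_eval_zero, hy, eval_prod]
    simp
  have hy0 : ∀ i, y i ≠ 0 := fun i => by
    have := Finset.prod_ne_zero_iff.1 (hc ▸ h0) i (Finset.mem_univ i)
    exact neg_ne_zero.1 this
  have h1 : P.reverse = ∏ i, (1 - C (y i) * X) := by
    have h := reflect_prod_X_sub_C (Finset.univ : Finset (Fin n)) y
    rw [Finset.card_univ, Fintype.card_fin, ← hy] at h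
    rw [reverse, hn, h]
  have h2 : ∏ i, (X - C (x i)) = ∏ i, (X - C (y i)⁻¹) := by
    rw [hx, h1, hc, ← Finset.prod_inv_distrib, map_prod, ← Finset.prod_mul_distrib]
    refine Finset.prod_congr rfl fun i _ => ?_
    have h3 : C (-y i)⁻¹ * C (y i) = (-1 : k[X]) := by
      rw [← C_mul, inv_neg, neg_mul, inv_mul_cancel₀ (hy0 i), C_neg, C_1]
    rw [mul_sub, ← mul_assoc, h3, inv_neg, C_neg]
    ring
  have h4 : Finset.univ.val.map x = Finset.univ.val.map fun i => (y i)⁻¹ := by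
    have h5 := congrArg roots h2
    have h6 : ∀ z : Fin n → k, (∏ i, (X - C (z i))).roots = Finset.univ.val.map z := by
      intro z
      rw [← roots_multiset_prod_X_sub_C (Finset.univ.val.map z), Multiset.map_map]
      rfl
    rwa [h6, h6] at h5
  constructor
  · have h5 := congrArg (fun s : Multiset k => (s.map fun a => X - C a⁻¹).prod) h4
    simp only [Multiset.map_map, Function.comp_def, inv_inv] at h5
    rw [hy]
    exact h5
  · intro i
    have : x i ∈ Finset.univ.val.map x := Multiset.mem_map_of_mem x (Finset.mem_univ i)
    rw [h4, Multiset.mem_map] at this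
    obtain ⟨j, -, hj⟩ := this
    rw [← hj]
    exact inv_ne_zero (hy0 j)

lemma monic_normalized_reverse {k : Type*} [Field k] {P : k[X]} (hn : P.natDegree = n)
    (h0 : P.coeff 0 ≠ 0) :
    (C (P.coeff 0)⁻¹ * P.reverse).Monic ∧ (C (P.coeff 0)⁻¹ * P.reverse).natDegree = n := by
  have hd : P.reverse.natDegree = n := by
    rw [reverse_natDegree, natTrailingDegree_eq_zero.2 (Or.inr h0), Nat.sub_zero, hn]
  have hd' : (C (P.coeff 0)⁻¹ * P.reverse).natDegree = n := by
    rw [natDegree_C_mul (inv_ne_zero h0), hd]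
  refine ⟨?_, hd'⟩
  rw [Monic, leadingCoeff, hd', coeff_C_mul, coeff_reverse, hn, revAt_le le_rfl, Nat.sub_self,
    inv_mul_cancel₀ h0]

end InverseRoots

/-! ### Local values of 𝛍 and 𝛎 -/

section LocalValues

/-- By injectivity, `Function.invFun` in `muLocal` and `nuLocal` recovers the element of A once the
value is shown to come from A. -/
lemma algebraMap_closure_injective (F : Type*) [Field F] :
    Function.Injective (algebraMap F[X] (AlgebraicClosure (RatFunc F))) := by
  rw [IsScalarTower.algebraMap_eq F[X] (RatFunc F) (AlgebraicClosure (RatFunc F)), RingHom.coe_comp]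
  exact (algebraMap (RatFunc F) _).injective.comp (IsFractionRing.injective F[X] (RatFunc F))

variable {F : Type*} [Field F] [Fintype F] {r : ℕ} {φ : DrinfeldModule F r} (f : MonicIrred F)

lemma frobPolyDual_monic (hr : 0 < r) (hφ : φ.EverywhereGoodReduction) :
    (φ.frobPolyDual f).Monic ∧ (φ.frobPolyDual f).natDegree = r := by
  have hK := IsFractionRing.injective F[X] (RatFunc F)
  obtain ⟨-, hm, hd, -, -⟩ := frobPoly_spec f hr hφ
  rw [frobPolyDual_eq f hr hφ, ← coeff_map]
  refine monic_normalized_reverse (by rw [natDegree_map_eq_of_injective hK, hd]) ?_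
  rw [coeff_map]
  exact (map_ne_zero_iff _ hK).2 (frobPoly_coeff_zero_ne_zero f hr hφ)

lemma prod_rootFamily_inv (hr : 0 < r) (hφ : φ.EverywhereGoodReduction) :
    ∏ i, (X - C (rootFamily r (φ.frobPolyDual f) i)⁻¹) =
      (φ.frobPoly f).map (algebraMap F[X] (AlgebraicClosure (RatFunc F))) ∧
      ∀ i, rootFamily r (φ.frobPolyDual f) i ≠ 0 := by
  have hK : Function.Injective (algebraMap F[X] (AlgebraicClosure (RatFunc F))) :=
    algebraMap_closure_injective F
  obtain ⟨-, hm, hd, -, -⟩ := frobPoly_spec f hr hφ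
  obtain ⟨hm', hd'⟩ := frobPolyDual_monic f hr hφ
  refine prod_X_sub_C_inv (hm.map _) (by rw [natDegree_map_eq_of_injective hK, hd]) ?_ ?_
  · rw [coeff_map]
    exact (map_ne_zero_iff _ hK).2 (frobPoly_coeff_zero_ne_zero f hr hφ)
  · rw [prod_rootFamily hm' hd', frobPolyDual_eq f hr hφ, Polynomial.map_mul, map_C, map_inv₀, coeff_map,
      ← IsScalarTower.algebraMap_apply]
    congr 1
    rw [reverse, reverse, ← reflect_map, Polynomial.map_map, ← IsScalarTower.algebraMap_eq,
      natDegree_map_eq_of_injective hK,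
      natDegree_map_eq_of_injective (IsFractionRing.injective F[X] (RatFunc F))]

/-- The α_i⁻¹ are the roots of P_{φ,f}, so their product is (-1)^r P_{φ,f}(0). -/
lemma prod_rootFamily_inv_eq (hr : 0 < r) (hφ : φ.EverywhereGoodReduction) :
    ∏ i, (rootFamily r (φ.frobPolyDual f) i)⁻¹ =
      algebraMap F[X] (AlgebraicClosure (RatFunc F)) (C (φ.chi f.1)⁻¹ * f.1) := by
  have h := congrArg (coeff · 0) (prod_rootFamily_inv f hr hφ).1
  simp only [coeff_map, (frobPoly_spec f hr hφ).2.2.2.1] at h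
  rw [coeff_zero_eq_eval_zero, eval_prod] at h
  simp only [eval_sub, eval_X, eval_C, zero_sub, Finset.prod_neg, Finset.card_univ,
    Fintype.card_fin] at h
  have h2 : ((-1) ^ r * (-1) ^ r : AlgebraicClosure (RatFunc F)) = 1 := by rw [← mul_pow]; simp
  rw [← one_mul (∏ i, _), ← h2, mul_assoc, h]
  simp only [map_mul, map_pow, map_neg, map_one]
  rw [mul_assoc, ← mul_assoc, h2, one_mul]

lemma evalAt_rootFamily_inv (hr : 0 < r) (hφ : φ.EverywhereGoodReduction)
    {S : MvPolynomial (Fin r) ℤ} (hS : S.IsSymmetric) :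
    evalAt (fun i => (rootFamily r (φ.frobPolyDual f) i)⁻¹) S =
      algebraMap F[X] (AlgebraicClosure (RatFunc F)) (symEval S (φ.frobPoly f)) := by
  rw [map_symEval, ← (prod_rootFamily_inv f hr hφ).1, symEval_prod hS]

lemma nuLocal_eq (hr : 0 < r) (hφ : φ.EverywhereGoodReduction) (k : Fin (r - 1) → ℕ) :
    φ.nuLocal f k = symEval (schur r k) (φ.frobPoly f) := by
  rw [DrinfeldModule.nuLocal, aeval_eq_evalAt, evalAt_rootFamily_inv f hr hφ (schur_isSymmetric r k)]
  exact Function.leftInverse_invFun (algebraMap_closure_injective F) _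

/-- The power of f turns the product of the α_i⁻¹ into a power of χ_φ(f), and duality rewrites the
Schur value with reversed differences at the roots of P_{φ,f}. Hence 𝛍 takes values in A. -/
lemma evalAt_rootFamily_mul (hr : 0 < r) (hφ : φ.EverywhereGoodReduction) (k : Fin (r - 1) → ℕ) :
    evalAt (rootFamily r (φ.frobPolyDual f)) (schur r k) *
      algebraMap F[X] (AlgebraicClosure (RatFunc F)) f.1 ^ ∑ i, k i =
    algebraMap F[X] (AlgebraicClosure (RatFunc F))
      (C (φ.chi f.1 ^ ∑ i, k i) * symEval (schur r fun m => k m.rev) (φ.frobPoly f)) := by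
  have h := evalAt_schur_inverse k (fun i => (rootFamily r (φ.frobPolyDual f) i)⁻¹)
    (rootFamily r (φ.frobPolyDual f))
    fun i => inv_mul_cancel₀ ((prod_rootFamily_inv f hr hφ).2 i)
  rw [prod_rootFamily_inv_eq f hr hφ, evalAt_rootFamily_inv f hr hφ (schur_isSymmetric r _),
    map_mul, mul_pow, ← map_pow, ← map_pow, inv_pow] at h
  have h2 : algebraMap F[X] (AlgebraicClosure (RatFunc F)) (C (φ.chi f.1 ^ ∑ i, k i)) *
      algebraMap F[X] (AlgebraicClosure (RatFunc F)) (C (φ.chi f.1 ^ ∑ i, k i)⁻¹) = 1 := by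
    rw [← map_mul, ← C_mul, mul_inv_cancel₀ (pow_ne_zero _ (hφ.chi_ne_zero _)), C_1, map_one]
  rw [map_mul, ← h, mul_assoc, ← mul_assoc, h2, one_mul, mul_comm]

lemma muLocal_eq (hr : 0 < r) (hφ : φ.EverywhereGoodReduction) (k : Fin (r - 1) → ℕ) :
    φ.muLocal f k =
      C (φ.chi f.1 ^ ∑ i, k i) * symEval (schur r fun m => k m.rev) (φ.frobPoly f) := by
  rw [DrinfeldModule.muLocal, aeval_eq_evalAt, evalAt_rootFamily_mul f hr hφ]
  exact Function.leftInverse_invFun (algebraMap_closure_injective F) _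

lemma symEval_one_frobPoly (hr : 0 < r) (hφ : φ.EverywhereGoodReduction) :
    symEval (1 : MvPolynomial (Fin r) ℤ) (φ.frobPoly f) = 1 := by
  apply algebraMap_closure_injective F
  rw [← evalAt_rootFamily_inv f hr hφ MvPolynomial.IsSymmetric.one, map_one, map_one]

/-- The local factor `χ_φ(f)^{k_r} 𝛍(f^{k_1},…,f^{k_{r-1}})`. -/
noncomputable def DrinfeldModule.muFactor (φ : DrinfeldModule F r) (f : MonicIrred F) (k : ℕ → ℕ) : F[X] :=
  C (φ.chi f.1) ^ k (r - 1) * φ.muLocal f fun m => k m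

/-- The local factor `(χ_φ(f)⁻¹ f)^{k_r} 𝛎(f^{k_1},…,f^{k_{r-1}})`. -/
noncomputable def DrinfeldModule.nuFactor (φ : DrinfeldModule F r) (f : MonicIrred F) (k : ℕ → ℕ) : F[X] :=
  (C (φ.chi f.1)⁻¹ * f.1) ^ k (r - 1) * φ.nuLocal f fun m => k m

lemma muFactor_zero (hr : 0 < r) (hφ : φ.EverywhereGoodReduction) : φ.muFactor f (fun _ => 0) = 1 := by
  rw [DrinfeldModule.muFactor, muLocal_eq f hr hφ, schur_zero, symEval_one_frobPoly f hr hφ]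
  simp

lemma nuFactor_zero (hr : 0 < r) (hφ : φ.EverywhereGoodReduction) : φ.nuFactor f (fun _ => 0) = 1 := by
  rw [DrinfeldModule.nuFactor, nuLocal_eq f hr hφ, schur_zero, symEval_one_frobPoly f hr hφ]
  simp

lemma schurSym_frobPoly (hr : 0 < r) (hφ : φ.EverywhereGoodReduction) (k : ℕ → ℕ) :
    schurSym r k (φ.frobPoly f) = φ.nuFactor f k := by
  apply algebraMap_closure_injective F
  rw [map_schurSym, ← (prod_rootFamily_inv f hr hφ).1, schurSym_prod, schurVal_eq,
    prod_rootFamily_inv_eq f hr hφ, evalAt_rootFamily_inv f hr hφ (schur_isSymmetric r _),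
    DrinfeldModule.nuFactor, nuLocal_eq f hr hφ]
  simp only [map_mul, map_pow]

/-- Each full column contributes ∏ α_i, and (∏ α_i) f = χ_φ(f) uses up one factor f; the remaining
power of f is the one in the definition of 𝛍. -/
lemma schurSym_frobPolyDual (hr : 0 < r) (hφ : φ.EverywhereGoodReduction) (k : ℕ → ℕ) :
    schurSym r k (φ.frobPolyDual f) * algebraMap F[X] (RatFunc F) f.1 ^ (∑ i ∈ Finset.range r, k i) =
      algebraMap F[X] (RatFunc F) (φ.muFactor f k) := by
  apply (algebraMap (RatFunc F) (AlgebraicClosure (RatFunc F))).injective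
  obtain ⟨hm', hd'⟩ := frobPolyDual_monic f hr hφ
  have h1 : Finset.range r = Finset.range (r - 1 + 1) := by rw [Nat.sub_add_cancel hr]
  have h2 : (∏ i, rootFamily r (φ.frobPolyDual f) i) *
      algebraMap F[X] (AlgebraicClosure (RatFunc F)) f.1 =
      algebraMap F[X] (AlgebraicClosure (RatFunc F)) (C (φ.chi f.1)) := by
    have h3 := prod_rootFamily_inv_eq f hr hφ
    rw [Finset.prod_inv_distrib, inv_eq_iff_eq_inv] at h3
    have hf : algebraMap F[X] (AlgebraicClosure (RatFunc F)) f.1 ≠ 0 :=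
      (map_ne_zero_iff _ (algebraMap_closure_injective F)).2 f.2.2.ne_zero
    have h4 : algebraMap F[X] (AlgebraicClosure (RatFunc F)) (C (φ.chi f.1)) *
        algebraMap F[X] (AlgebraicClosure (RatFunc F)) (C (φ.chi f.1)⁻¹) = 1 := by
      rw [← map_mul, ← C_mul, mul_inv_cancel₀ (hφ.chi_ne_zero _), C_1, map_one]
    rw [h3, map_mul, mul_inv, mul_assoc, inv_mul_cancel₀ hf, mul_one]
    exact (eq_inv_of_mul_eq_one_left h4).symm
  rw [map_mul, map_pow, map_schurSym, ← prod_rootFamily hm' hd', schurSym_prod, schurVal_eq,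
    ← IsScalarTower.algebraMap_apply, ← IsScalarTower.algebraMap_apply, h1, Finset.sum_range_succ,
    pow_add, ← Fin.sum_univ_eq_sum_range, DrinfeldModule.muFactor, muLocal_eq f hr hφ, map_mul,
    ← evalAt_rootFamily_mul f hr hφ, map_pow, ← h2, mul_pow]
  ring

/-- Up to a constant the factor is a Schur value with reversed differences at the roots of P_{φ,f},
whose coefficients satisfy the weight bounds. The reversed partition has size ∑ (r - 1 - i) k_i;
full columns (i = r - 1) contribute nothing. -/
lemma natDegree_muFactor_le (hr : 0 < r) (hφ : φ.EverywhereGoodReduction) (k : ℕ → ℕ) :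
    r * (φ.muFactor f k).natDegree ≤ f.1.natDegree * ∑ i ∈ Finset.range r, (r - 1 - i) * k i := by
  obtain ⟨-, hm, hd, -, hdeg⟩ := frobPoly_spec f hr hφ
  have h1 : (φ.muFactor f k).natDegree ≤
      (symEval (schur r fun m : Fin (r - 1) => k m.rev) (φ.frobPoly f)).natDegree := by
    rw [DrinfeldModule.muFactor, muLocal_eq f hr hφ, ← C_pow]
    exact (natDegree_C_mul_le _ _).trans (natDegree_C_mul_le _ _)
  refine (Nat.mul_le_mul_left _ h1).trans ?_
  refine (natDegree_symEval_le hm hd (r := r) (d := f.1.natDegree) (fun i => ?_)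
    (schurExponent r fun m => k m.rev) (sum_schurExponent r _)).trans (le_of_eq ?_)
  · have hi := i.2
    refine (hdeg _).trans (Nat.mul_le_mul_left _ (by omega))
  · congr 1
    obtain ⟨n, rfl⟩ : ∃ n, r = n + 1 := ⟨r - 1, by omega⟩
    rw [Finset.sum_range_succ, Nat.add_sub_cancel, Nat.sub_self, zero_mul, add_zero,
      ← Fin.sum_univ_eq_sum_range fun i => (n - i) * k i, ← Equiv.sum_comp Fin.revPerm]
    refine Finset.sum_congr rfl fun m _ => ?_
    have hm := m.2
    rw [Fin.revPerm_apply]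
    simp only [Fin.val_rev] at hm ⊢
    congr 1
    · omega
    · congr 1; omega

end LocalValues

/-! ### Summation in Laurent series -/

section LaurentTopology

open WithZero Topology Filter

variable {K : Type*} [Field K]

lemma setOf_valuation_le_mem_nhds (D : ℤ) :
    {x : LaurentSeries K | Valued.v x ≤ exp (-D)} ∈ 𝓝 (0 : LaurentSeries K) := by
  rw [Valued.mem_nhds_zero]
  have h0 : Valued.v.restrict (HahnSeries.single D (1 : K) : LaurentSeries K) ≠ 0 := by
    rw [Ne, Valuation.restrict_eq_zero_iff, LaurentSeries.valuation_single_zpow]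
    exact exp_ne_zero
  refine ⟨Units.mk0 _ h0, fun x hx => ?_⟩
  rw [Units.val_mk0, Set.mem_ofPred_eq, Valuation.restrict_lt_iff,
    LaurentSeries.valuation_single_zpow] at hx
  exact hx.le

lemma exists_setOf_valuation_le_subset {U : Set (LaurentSeries K)} (hU : U ∈ 𝓝 (0 : LaurentSeries K)) :
    ∃ D : ℤ, {x : LaurentSeries K | Valued.v x ≤ exp (-D)} ⊆ U := by
  obtain ⟨γ, hγ⟩ := Valued.mem_nhds_zero.1 hU
  set g := MonoidWithZeroHom.ValueGroup₀.embedding γ.1 with hg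
  have hg0 : g ≠ 0 := (_root_.map_ne_zero _).2 γ.ne_zero
  -- The shift by 1 makes the inequality strict: exp(log g - 1) < g.
  refine ⟨1 - log g, fun x hx => hγ ?_⟩
  rw [Set.mem_ofPred_eq, Valuation.restrict_lt_iff_lt_embedding]
  refine lt_of_le_of_lt hx ?_
  rw [← hg]
  conv_rhs => rw [← exp_log hg0]
  rw [exp_lt_exp]
  omega

/-- By the ultrametric inequality the balls around 0 are additive subgroups. -/
instance : NonarchimedeanRing (LaurentSeries K) where
  is_nonarchimedean U hU := by
    obtain ⟨D, hD⟩ := exists_setOf_valuation_le_subset hU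
    let V : AddSubgroup (LaurentSeries K) :=
      { carrier := {x | Valued.v x ≤ exp (-D)}
        add_mem' := by
          intro x y hx hy
          rw [Set.mem_ofPred_eq] at *
          exact (Valuation.map_add _ x y).trans (max_le hx hy)
        zero_mem' := by simp
        neg_mem' := fun {x} hx => by
          rw [Set.mem_ofPred_eq, Valuation.map_neg]
          exact hx }
    exact ⟨⟨V, AddSubgroup.isOpen_of_mem_nhds V (setOf_valuation_le_mem_nhds D)⟩, hD⟩

/-- In a complete nonarchimedean group it suffices that the terms tend to 0 along the cofinite
filter. -/
lemma summable_of_finite_setOf_lt_valuation {α : Type*} {f : α → LaurentSeries K}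
    (h : ∀ D : ℤ, {i | ¬ Valued.v (f i) ≤ exp (-D)}.Finite) : Summable f := by
  refine NonarchimedeanAddGroup.summable_of_tendsto_cofinite_zero ?_
  intro U hU
  obtain ⟨D, hD⟩ := exists_setOf_valuation_le_subset hU
  rw [Filter.mem_map, Filter.mem_cofinite]
  exact (h D).subset fun i hi hi' => hi (hD hi')

/-- A sum of Laurent series agrees with a finite partial sum in a given coefficient. -/
lemma exists_coeff_eq_of_hasSum {α : Type*} {f : α → LaurentSeries K} {a : LaurentSeries K}
    (h : HasSum f a) (n : ℤ) : ∃ s : Finset α, a.coeff n = (∑ i ∈ s, f i).coeff n := by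
  have h1 : Tendsto (fun s : Finset α => ∑ i ∈ s, f i - a) atTop (𝓝 0) := by
    have h3 : Tendsto (fun s : Finset α => ∑ i ∈ s, f i) atTop (𝓝 a) := h
    have h2 := h3.sub_const a
    rwa [sub_self] at h2
  obtain ⟨s, hs⟩ := (h1.eventually (setOf_valuation_le_mem_nhds (n + 1))).exists
  refine ⟨s, ?_⟩
  have h2 := (LaurentSeries.valuation_le_iff_coeff_lt_eq_zero K).1 hs n (by omega)
  rw [HahnSeries.coeff_sub, sub_eq_zero] at h2
  exact h2.symm

end LaurentTopology

/-! ### The Tate algebra and valuations of polynomials -/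

section TateAlgebra

variable (F : Type*) [Field F]

/-- `𝕋_z(K_∞)` as a subring. -/
noncomputable def tateSubring : Subring (KInfty F) where
  carrier := tateAlgebra F
  mul_mem' := by
    intro x y hx hy n
    rw [HahnSeries.coeff_mul]
    exact sum_mem (S := (algebraMap F[X] (RatFunc F)).range) fun p _ => (algebraMap F[X] (RatFunc F)).range.mul_mem (hx _) (hy _)
  one_mem' := by
    intro n
    rw [HahnSeries.coeff_one]
    split_ifs
    · exact ⟨1, map_one _⟩
    · exact ⟨0, map_zero _⟩
  add_mem' := by
    intro x y hx hy n
    rw [HahnSeries.coeff_add]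
    exact (algebraMap F[X] (RatFunc F)).range.add_mem (hx _) (hy _)
  zero_mem' := by
    intro n
    exact ⟨0, by simp⟩
  neg_mem' := by
    intro x hx n
    rw [HahnSeries.coeff_neg]
    exact (algebraMap F[X] (RatFunc F)).range.neg_mem (hx _)

variable {F}

/-- Each coefficient of the sum is that of some finite partial sum, hence is a polynomial in z. -/
lemma mem_tateAlgebra_of_hasSum {α : Type*} {f : α → KInfty F} {a : KInfty F} (h : HasSum f a)
    (hf : ∀ i, f i ∈ tateAlgebra F) : a ∈ tateAlgebra F := by
  intro n
  obtain ⟨s, hs⟩ := exists_coeff_eq_of_hasSum h n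
  rw [hs]
  exact (sum_mem fun i _ => hf i : ∑ i ∈ s, f i ∈ tateSubring F) n

lemma zHom_mem_tateAlgebra (p : F[X]) : zHom F p ∈ tateAlgebra F := by
  intro n
  rw [zHom, RingHom.comp_apply, HahnSeries.C_apply, HahnSeries.coeff_single]
  split_ifs
  · exact ⟨p, rfl⟩
  · exact ⟨0, map_zero _⟩

/-- `K_∞ → 𝕂_∞`. -/
noncomputable def constHom : LaurentSeries F →+* KInfty F where
  toFun x := x.map (RatFunc.C : F →+* RatFunc F)
  map_one' := by
    ext n
    rw [HahnSeries.map_coeff, HahnSeries.coeff_one, HahnSeries.coeff_one]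
    split_ifs <;> simp
  map_mul' x y := HahnSeries.map_mul (RatFunc.C : F →+* RatFunc F).toNonUnitalRingHom
  map_zero' := by
    ext n
    simp
  map_add' x y := by
    ext n
    simp

lemma constHom_mem_tateAlgebra (x : LaurentSeries F) : constHom x ∈ tateAlgebra F := by
  intro n
  exact ⟨C (x.coeff n), RatFunc.algebraMap_C _⟩

lemma thetaHom_mem_range (p : F[X]) : ∃ x : LaurentSeries F, constHom x = thetaHom F p := by
  have h : thetaHom F p ∈ (constHom (F := F)).range := by
    rw [thetaHom, coe_eval₂RingHom, eval₂_eq_sum_range]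
    have h1 : constHom (HahnSeries.single (-1 : ℤ) (1 : F)) =
        (HahnSeries.single (-1 : ℤ) (1 : RatFunc F)) := by
      ext n
      change RatFunc.C ((HahnSeries.single (-1) (1 : F)).coeff n) = _
      rw [HahnSeries.coeff_single, HahnSeries.coeff_single]
      split_ifs <;> simp
    have h2 : ∀ c : F, constHom (HahnSeries.C c : LaurentSeries F) =
        (HahnSeries.C : RatFunc F →+* KInfty F) (RatFunc.C c) := by
      intro c
      ext n
      change RatFunc.C ((HahnSeries.C c : LaurentSeries F).coeff n) = _
      rw [HahnSeries.C_apply, HahnSeries.C_apply, HahnSeries.coeff_single, HahnSeries.coeff_single]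
      split_ifs <;> simp
    exact sum_mem fun i _ => (constHom (F := F)).range.mul_mem ⟨_, h2 (p.coeff i)⟩
      ((constHom (F := F)).range.pow_mem ⟨_, h1⟩ i)
  exact h

lemma thetaHom_mem_tateAlgebra (p : F[X]) : thetaHom F p ∈ tateAlgebra F := by
  obtain ⟨x, hx⟩ := thetaHom_mem_range p
  rw [← hx]
  exact constHom_mem_tateAlgebra x

/-- The inverse is taken in the field 𝔽_q((θ⁻¹)), so its coefficients are constants and no
denominators in z arise. -/
lemma thetaHom_inv_mem_tateAlgebra (p : F[X]) : (thetaHom F p)⁻¹ ∈ tateAlgebra F := by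
  obtain ⟨x, hx⟩ := thetaHom_mem_range p
  rw [← hx, ← map_inv₀]
  exact constHom_mem_tateAlgebra _

open WithZero

lemma valuation_zHom_le (p : F[X]) : Valued.v (zHom F p) ≤ 1 := by
  have h := (LaurentSeries.valuation_le_iff_coeff_lt_eq_zero (RatFunc F) (D := 0) (f := zHom F p)).2
    fun n hn => by
      rw [zHom, RingHom.comp_apply, HahnSeries.C_apply, HahnSeries.coeff_single, if_neg hn.ne]
  simpa using h

lemma valuation_thetaHom_le (p : F[X]) : Valued.v (thetaHom F p) ≤ exp (p.natDegree : ℤ) := by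
  have h := (LaurentSeries.valuation_le_iff_coeff_lt_eq_zero (RatFunc F) (D := -p.natDegree)
    (f := thetaHom F p)).2 fun n hn => by
      obtain ⟨m, rfl⟩ : ∃ m : ℕ, n = -(m : ℤ) := ⟨n.natAbs, by omega⟩
      rw [coeff_thetaHom, coeff_eq_zero_of_natDegree_lt (by omega), map_zero]
  rwa [neg_neg] at h

lemma valuation_thetaHom {p : F[X]} (hp : p ≠ 0) :
    Valued.v (thetaHom F p) = exp (p.natDegree : ℤ) := by
  refine le_antisymm (valuation_thetaHom_le p) (not_lt.1 fun hlt => ?_)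
  have h0 : Valued.v (thetaHom F p) ≠ 0 := by
    rw [Valuation.ne_zero_iff]
    exact (map_ne_zero_iff _ (thetaHom_injective F)).2 hp
  rw [← log_lt_iff_lt_exp h0] at hlt
  have h1 : Valued.v (thetaHom F p) ≤ exp (-(1 - (p.natDegree : ℤ))) := by
    rw [← log_le_iff_le_exp h0]
    omega
  have h2 := (LaurentSeries.valuation_le_iff_coeff_lt_eq_zero (RatFunc F)).1 h1 (-(p.natDegree : ℤ))
    (by omega)
  rw [coeff_thetaHom, map_eq_zero] at h2
  exact hp (leadingCoeff_eq_zero.1 h2)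

end TateAlgebra

/-! ### Euler products as sums over finitely supported exponents -/

section EulerProduct

open Filter Topology

variable {R : Type*} [CommRing R] [UniformSpace R] [IsUniformAddGroup R] [NonarchimedeanRing R]
  [T2Space R] {ι κ : Type*} [Zero κ]

/-- The finite partial products of an Euler product. -/
lemma hasSum_prod_of_support_subset [DecidableEq ι] {t : ι → κ → R} {e : ι → R}
    (ht : ∀ i, t i 0 = 1) (he : ∀ i, HasSum (t i) (e i)) (S : Finset ι) :
    HasSum (fun x : ι →₀ κ => if x.support ⊆ S then x.prod t else 0) (∏ i ∈ S, e i) := by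
  induction S using Finset.induction_on with
  | empty =>
    rw [Finset.prod_empty]
    have h := hasSum_single (f := fun x : ι →₀ κ => if x.support ⊆ ∅ then x.prod t else 0) 0
      fun x hx => if_neg fun h => hx (Finsupp.support_eq_empty.1 (Finset.subset_empty.1 h))
    simpa using h
  | insert a S ha ih =>
    rw [Finset.prod_insert ha]
    have h := (he a).mul_of_nonarchimedean ih
    -- Families supported in S ∪ {a} correspond to pairs of an exponent at a and a family supported
    -- in S; terms off these supports are 0.
    refine (hasSum_iff_hasSum_of_ne_zero_bij (f := fun p : κ × (ι →₀ κ) =>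
      t a p.1 * if p.2.support ⊆ S then p.2.prod t else 0)
      (fun x : Function.support fun x : ι →₀ κ =>
        if x.support ⊆ insert a S then x.prod t else 0 => (x.1 a, x.1.erase a)) ?_ ?_ ?_).1 h
    · rintro ⟨x, hx⟩ ⟨y, hy⟩ hxy
      rw [Prod.mk.injEq] at hxy
      refine Subtype.ext (Finsupp.ext fun i => ?_)
      by_cases hi : i = a
      · rw [hi]; exact hxy.1
      · have := DFunLike.congr_fun hxy.2 i
        rwa [Finsupp.erase_ne hi, Finsupp.erase_ne hi] at this
    · rintro ⟨k, y⟩ hky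
      rw [Function.mem_support] at hky
      simp only at hky
      have hy : y.support ⊆ S := by
        by_contra hy
        rw [if_neg hy, mul_zero] at hky
        exact hky rfl
      rw [if_pos hy] at hky
      have hya : y a = 0 := by
        by_contra h0
        exact ha (hy (Finsupp.mem_support_iff.2 h0))
      have herase : (y.update a k).erase a = y := by
        ext i
        by_cases hi : i = a
        · rw [hi, Finsupp.erase_same, hya]
        · rw [Finsupp.erase_ne hi, Finsupp.update_apply, if_neg hi]
      have hval : (y.update a k) a = k := by rw [Finsupp.update_apply, if_pos rfl]
      have hsub : (y.update a k).support ⊆ insert a S := by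
        intro i hi
        rw [Finset.mem_insert]
        by_cases hia : i = a
        · exact Or.inl hia
        · rw [Finsupp.mem_support_iff, Finsupp.update_apply, if_neg hia] at hi
          exact Or.inr (hy (Finsupp.mem_support_iff.2 hi))
      refine ⟨⟨y.update a k, ?_⟩, Prod.ext hval herase⟩
      rw [Function.mem_support, if_pos hsub, ← Finsupp.mul_prod_erase' _ a t fun i => ht i, herase, hval]
      exact hky
    · rintro ⟨x, hx⟩
      rw [Function.mem_support] at hx
      have hsub : x.support ⊆ insert a S := by
        by_contra h0
        exact hx (if_neg h0)
      have hsub' : (x.erase a).support ⊆ S := by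
        intro i hi
        rw [Finsupp.support_erase] at hi
        exact (Finset.mem_insert.1 (hsub (Finset.mem_of_mem_erase hi))).resolve_left
          (Finset.ne_of_mem_erase hi)
      simp only
      rw [if_pos hsub, if_pos hsub', Finsupp.mul_prod_erase' _ a t fun i => ht i]

/-- An absolutely convergent sum over multi-indices is the product of the local sums. -/
theorem hasProd_of_summable {t : ι → κ → R} {e : ι → R} (ht : ∀ i, t i 0 = 1)
    (he : ∀ i, HasSum (t i) (e i)) {a : R} (ha : HasSum (fun x : ι →₀ κ => x.prod t) a) :
    HasProd e a := by
  classical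
  change Tendsto (fun S : Finset ι => ∏ i ∈ S, e i) atTop (𝓝 a)
  -- Take a closed neighbourhood U of a, and B such that all finite sums over sets containing B lie
  -- in U. If S contains the supports of B, the partial product over S is a limit of such sums,
  -- hence in U.
  rw [(closed_nhds_basis a).tendsto_right_iff]
  rintro U ⟨hU, hUc⟩
  have h1 : Tendsto (fun B : Finset (ι →₀ κ) => ∑ x ∈ B, x.prod t) atTop (𝓝 a) := ha
  obtain ⟨B, hB⟩ := eventually_atTop.1 (h1.eventually hU)
  filter_upwards [eventually_ge_atTop (B.biUnion fun x => x.support)] with S hS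
  have h2 : Tendsto (fun B' : Finset (ι →₀ κ) => ∑ x ∈ B', if x.support ⊆ S then x.prod t else 0)
      atTop (𝓝 (∏ i ∈ S, e i)) := hasSum_prod_of_support_subset ht he S
  refine hUc.mem_of_tendsto h2 ?_
  filter_upwards [eventually_ge_atTop B] with B' hB'
  rw [← Finset.sum_filter]
  refine hB _ fun x hx => Finset.mem_filter.2 ⟨hB' hx, ?_⟩
  exact (Finset.subset_biUnion_of_mem (fun x : ι →₀ κ => x.support) hx).trans hS

end EulerProduct

/-! ### Evaluating formal power series identities -/

section Evaluation

variable {R : Type*} [CommRing R] [TopologicalSpace R] [IsTopologicalRing R] [T2Space R]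

lemma hasSum_polynomial_mul (u : R) (p : R[X]) {G : PowerSeries R} {e : R}
    (h : HasSum (fun m => PowerSeries.coeff m G * u ^ m) e) :
    HasSum (fun m => PowerSeries.coeff m ((p : PowerSeries R) * G) * u ^ m) (p.eval u * e) := by
  induction p using Polynomial.induction_on with
  | C c =>
    simp only [Polynomial.coe_C, PowerSeries.coeff_C_mul, eval_C, mul_assoc]
    exact h.mul_left c
  | add p q hp hq =>
    simp only [Polynomial.coe_add, add_mul, map_add, eval_add]
    exact hp.add hq
  | monomial n c ih =>
    have h1 : ((C c * X ^ (n + 1) : R[X]) : PowerSeries R) * G =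
        PowerSeries.X * (((C c * X ^ n : R[X]) : PowerSeries R) * G) := by
      simp only [Polynomial.coe_mul, Polynomial.coe_pow, Polynomial.coe_X, pow_succ]
      ring
    rw [h1, ← hasSum_nat_add_iff' 1]
    simp only [PowerSeries.coeff_succ_X_mul, Finset.sum_range_one, PowerSeries.coeff_zero_X_mul,
      zero_mul, sub_zero]
    have h2 : eval u (C c * X ^ (n + 1)) * e = u * (eval u (C c * X ^ n) * e) := by
      simp only [eval_mul, eval_C, eval_pow, eval_X, pow_succ]
      ring
    rw [h2]
    refine (ih.mul_left u).congr_fun fun m => ?_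
    rw [pow_succ]
    ring

lemma eval_mul_eq_one_of_hasSum {u : R} {p : R[X]} {G : PowerSeries R} {e : R}
    (h : HasSum (fun m => PowerSeries.coeff m G * u ^ m) e) (hpG : (p : PowerSeries R) * G = 1) :
    p.eval u * e = 1 := by
  have h1 := hasSum_polynomial_mul u p h
  rw [hpG] at h1
  refine h1.unique ?_
  have h2 : HasSum (fun m => PowerSeries.coeff m (1 : PowerSeries R) * u ^ m)
      (PowerSeries.coeff 0 (1 : PowerSeries R) * u ^ 0) :=
    hasSum_single 0 fun m hm => by rw [PowerSeries.coeff_one, if_neg hm, zero_mul]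
  simpa using h2

end Evaluation

/-! ### Monic tuples and exponent families -/

section Factorization

variable {F : Type*} [Field F] {n : ℕ}

/-- The tuple of monic polynomials with given factorizations. -/
noncomputable def monicTuple (x : MonicIrred F →₀ (Fin n → ℕ)) (i : Fin n) : MonicPoly F :=
  ⟨∏ f ∈ x.support, f.1 ^ x f i, monic_prod_of_monic _ _ fun f _ => f.2.1.pow _⟩

lemma multiplicity_monicTuple (x : MonicIrred F →₀ (Fin n → ℕ)) (i : Fin n) (f : MonicIrred F) :
    multiplicity f.1 (monicTuple x i).1 = x f i := by
  have h := Finsupp.mul_prod_erase' x f (fun f k => f.1 ^ k i) fun f => pow_zero _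
  have h1 : (monicTuple x i).1 = f.1 ^ x f i * (x.erase f).prod fun f k => f.1 ^ k i := h.symm
  rw [h1]
  refine multiplicity_eq_of_dvd_of_not_dvd (Dvd.intro _ rfl) fun hd => ?_
  rw [pow_succ, mul_dvd_mul_iff_left (pow_ne_zero _ f.2.2.ne_zero)] at hd
  obtain ⟨g, hg, hfg⟩ := (f.2.2.prime.dvd_finsetProd_iff _).1 hd
  have hgf : g = f := MonicIrred.eq_of_dvd (f.2.2.prime.dvd_of_dvd_pow hfg)
  rw [hgf] at hg
  simp at hg

lemma exists_factorization {a : F[X]} (ha : a.Monic) :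
    ∃ y : MonicIrred F →₀ ℕ, (y.prod fun f k => f.1 ^ k) = a := by
  classical
  induction h : a.natDegree using Nat.strong_induction_on generalizing a with
  | _ d ih =>
    by_cases hu : IsUnit a
    · refine ⟨0, ?_⟩
      rw [Finsupp.prod_zero_index, ha.eq_one_of_isUnit hu]
    · obtain ⟨f, hfm, hfi, b, rfl⟩ := exists_monic_irreducible_factor a hu
      have hb : b.Monic := hfm.of_mul_monic_left ha
      have hdeg : b.natDegree < d := by
        rw [← h, hfm.natDegree_mul hb]
        have := hfi.natDegree_pos
        omega
      obtain ⟨y, hy⟩ := ih _ hdeg hb rfl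
      refine ⟨Finsupp.single ⟨f, hfm, hfi⟩ 1 + y, ?_⟩
      rw [Finsupp.prod_add_index' (fun f => pow_zero _) (fun f => pow_add _), hy]
      congr 1
      exact (Finsupp.prod_single_index (h := fun (g : MonicIrred F) k => g.1 ^ k)
        (pow_zero _)).trans (pow_one _)

lemma monicTuple_injective : Function.Injective (monicTuple (F := F) (n := n)) := by
  intro x y h
  ext f i
  rw [← multiplicity_monicTuple, ← multiplicity_monicTuple, h]

lemma monicTuple_surjective : Function.Surjective (monicTuple (F := F) (n := n)) := by
  classical
  intro a
  choose y hy using fun i => exists_factorization (a i).2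
  let x : MonicIrred F →₀ (Fin n → ℕ) :=
    Finsupp.onFinset (Finset.univ.biUnion fun i => (y i).support) (fun f i => y i f) fun f hf => by
      obtain ⟨i, hi⟩ := Function.ne_iff.1 hf
      exact Finset.mem_biUnion.2 ⟨i, Finset.mem_univ i, Finsupp.mem_support_iff.2 hi⟩
  refine ⟨x, funext fun i => Subtype.ext ?_⟩
  rw [← hy i]
  refine (Finset.prod_subset (fun f hf => ?_) fun f _ hf => ?_).symm
  · rw [Finsupp.mem_support_iff]
    intro h0
    exact Finsupp.mem_support_iff.1 hf (congrFun h0 i)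
  · exact (congrArg (f.1 ^ ·) (Finsupp.notMem_support_iff.1 hf)).trans (pow_zero _)

/-- Tuples of monic polynomials correspond to families of exponents. -/
noncomputable def monicTupleEquiv : (MonicIrred F →₀ (Fin n → ℕ)) ≃ (Fin n → MonicPoly F) :=
  Equiv.ofBijective monicTuple ⟨monicTuple_injective, monicTuple_surjective⟩

lemma natDegree_monicTuple (x : MonicIrred F →₀ (Fin n → ℕ)) (i : Fin n) :
    (monicTuple x i).1.natDegree = ∑ f ∈ x.support, f.1.natDegree * x f i := by
  rw [monicTuple, natDegree_prod_of_monic _ _ fun f _ => f.2.1.pow _]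
  refine Finset.sum_congr rfl fun f _ => ?_
  rw [f.2.1.natDegree_pow, mul_comm]

variable [Fintype F]

lemma finite_setOf_natDegree_lt (B : ℕ) : {p : F[X] | p.natDegree < B}.Finite := by
  have h : Finite (degreeLT F B) := Finite.of_equiv _ (degreeLTEquiv F B).symm.toEquiv
  refine (Set.toFinite (degreeLT F B : Set F[X])).subset fun p hp => ?_
  rw [SetLike.mem_coe, mem_degreeLT]
  exact lt_of_le_of_lt degree_le_natDegree (by exact_mod_cast hp)

/-- Over a finite field there are finitely many polynomials of bounded degree; this turns degree
growth into summability. -/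
lemma finite_setOf_sum_natDegree_lt (B : ℕ) :
    {x : MonicIrred F →₀ (Fin n → ℕ) | ∑ i, (monicTuple x i).1.natDegree < B}.Finite := by
  have h : {a : Fin n → F[X] | ∀ i, (a i).natDegree < B}.Finite := by
    have := Set.Finite.pi' fun _ : Fin n => finite_setOf_natDegree_lt (F := F) B
    exact this
  refine (h.preimage (f := fun x i => (monicTuple x i).1) ?_).subset fun x hx i => ?_
  · intro x _ y _ hxy
    exact monicTuple_injective (funext fun i => Subtype.ext (congrFun hxy i))
  · exact lt_of_le_of_lt (Finset.single_le_sum (f := fun i => (monicTuple x i).1.natDegree)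
      (fun _ _ => Nat.zero_le _) (Finset.mem_univ i)) hx

end Factorization

/-! ### Terms of the L-series and their convergence -/

section GlobalTerms

variable {F : Type*} [Field F] [Fintype F] {r l n : ℕ} {φ : DrinfeldModule F r}
  {ψ : DrinfeldModule F l}

lemma multiplicity_pad (x : MonicIrred F →₀ (Fin n → ℕ)) (f : MonicIrred F) (i : ℕ) :
    multiplicity f.1 (pad (monicTuple x) i) = zeroPad (x f) i := by
  rw [pad, zeroPad]
  split_ifs with h
  · exact multiplicity_monicTuple x _ f
  · exact multiplicity_eq_zero.2 fun h1 => f.2.2.not_isUnit (isUnit_of_dvd_one h1)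

lemma sum_zeroPad (hnr : n ≤ r) (k : Fin n → ℕ) :
    ∑ i ∈ Finset.range r, zeroPad k i = ∑ i, k i := by
  rw [← Finset.sum_subset (Finset.range_mono hnr), ← Fin.sum_univ_eq_sum_range]
  · simp
  · intro i _ hi
    rw [zeroPad, dif_neg (by simpa using hi)]

lemma zeroPad_zero : zeroPad (0 : Fin n → ℕ) = fun _ => 0 := by
  ext i
  rw [zeroPad]
  split_ifs <;> rfl

lemma muLocal_zero (hr : 0 < r) (hφ : φ.EverywhereGoodReduction) (f : MonicIrred F) :
    φ.muLocal f (fun _ => 0) = 1 := by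
  have h := muFactor_zero f hr hφ
  rwa [DrinfeldModule.muFactor, pow_zero, one_mul] at h

lemma nuLocal_zero (hr : 0 < r) (hφ : φ.EverywhereGoodReduction) (f : MonicIrred F) :
    φ.nuLocal f (fun _ => 0) = 1 := by
  have h := nuFactor_zero f hr hφ
  rwa [DrinfeldModule.nuFactor, pow_zero, one_mul] at h

/-- Outside the support all exponents vanish and the local value is 1, so the `finprod` is a finite
product. -/
lemma mu_monicTuple (hr : 0 < r) (hφ : φ.EverywhereGoodReduction) (x : MonicIrred F →₀ (Fin n → ℕ)) :
    (φ.mu fun i => pad (monicTuple x) i) =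
      ∏ f ∈ x.support, φ.muLocal f fun i => zeroPad (x f) i := by
  rw [DrinfeldModule.mu]
  simp only [multiplicity_pad]
  refine finprod_eq_prod_of_mulSupport_subset _ fun f hf => ?_
  rw [Finset.mem_coe, Finsupp.mem_support_iff]
  intro h0
  refine hf ?_
  simp only [h0, zeroPad_zero]
  exact muLocal_zero hr hφ f

lemma nu_monicTuple (hr : 0 < r) (hφ : φ.EverywhereGoodReduction) (x : MonicIrred F →₀ (Fin n → ℕ)) :
    (φ.nu fun i => pad (monicTuple x) i) =
      ∏ f ∈ x.support, φ.nuLocal f fun i => zeroPad (x f) i := by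
  rw [DrinfeldModule.nu]
  simp only [multiplicity_pad]
  refine finprod_eq_prod_of_mulSupport_subset _ fun f hf => ?_
  rw [Finset.mem_coe, Finsupp.mem_support_iff]
  intro h0
  refine hf ?_
  simp only [h0, zeroPad_zero]
  exact nuLocal_zero hr hφ f

lemma pad_monicTuple (x : MonicIrred F →₀ (Fin n → ℕ)) (m : ℕ) :
    pad (monicTuple x) m = ∏ f ∈ x.support, f.1 ^ zeroPad (x f) m := by
  rw [pad]
  split_ifs with h
  · simp only [monicTuple, zeroPad, dif_pos h]
  · simp only [zeroPad, dif_neg h, pow_zero, Finset.prod_const_one]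

lemma chi_pad_monicTuple (φ : DrinfeldModule F r) (x : MonicIrred F →₀ (Fin n → ℕ)) (m : ℕ) :
    φ.chi (pad (monicTuple x) m) = ∏ f ∈ x.support, φ.chi f.1 ^ zeroPad (x f) m := by
  rw [pad_monicTuple, DrinfeldModule.chi, natDegree_prod_of_monic _ _ fun f _ => f.2.1.pow _,
    ← Finset.prod_pow_eq_pow_sum]
  refine Finset.prod_congr rfl fun f _ => ?_
  rw [f.2.1.natDegree_pow, DrinfeldModule.chi, ← pow_mul, mul_comm f.1.natDegree]

/-- The denominator of the local terms. -/
noncomputable def localDenom (s : ℕ) (f : MonicIrred F) (k : Fin n → ℕ) : F[X] :=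
  f.1 ^ (∑ i, k i) * (f.1 ^ partSize k) ^ s

lemma convDenom_monicTuple (s : ℕ) (x : MonicIrred F →₀ (Fin n → ℕ)) :
    convDenom s (monicTuple x) = thetaHom F (∏ f ∈ x.support, localDenom s f (x f)) := by
  simp only [convDenom, localDenom]
  congr 1
  rw [Finset.prod_mul_distrib, Finset.prod_pow]
  simp only [monicTuple, partSize, ← Finset.prod_pow_eq_pow_sum, ← Finset.prod_pow, ← pow_mul]
  rw [Finset.prod_comm]
  congr 1
  rw [Finset.prod_comm]
  refine Finset.prod_congr rfl fun i _ => Finset.prod_congr rfl fun f _ => ?_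
  congr 1
  ring

/-- The terms of the Euler factor at `f`. -/
noncomputable def localTerm (φ : DrinfeldModule F r) (ψ : DrinfeldModule F l) (s : ℕ)
    (f : MonicIrred F) (k : Fin n → ℕ) : KInfty F :=
  thetaHom F (φ.muFactor f (zeroPad k)) * zHom F (ψ.nuFactor f (zeroPad k)) /
    thetaHom F (localDenom s f k)

lemma localTerm_zero (hr : 0 < r) (hl : 0 < l) (hφ : φ.EverywhereGoodReduction)
    (hψ : ψ.EverywhereGoodReduction) (s : ℕ) (f : MonicIrred F) :
    localTerm φ ψ s f (0 : Fin n → ℕ) = 1 := by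
  rw [localTerm, zeroPad_zero, muFactor_zero f hr hφ, nuFactor_zero f hl hψ]
  simp [localDenom, partSize]

lemma prod_localTerm (φ : DrinfeldModule F r) (ψ : DrinfeldModule F l) (s : ℕ)
    (x : MonicIrred F →₀ (Fin n → ℕ)) :
    x.prod (localTerm φ ψ s) =
      thetaHom F (∏ f ∈ x.support, φ.muFactor f (zeroPad (x f))) *
        zHom F (∏ f ∈ x.support, ψ.nuFactor f (zeroPad (x f))) / convDenom s (monicTuple x) := by
  rw [convDenom_monicTuple, map_prod, map_prod, map_prod, ← Finset.prod_mul_distrib,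
    ← Finset.prod_div_distrib]
  rfl

lemma prod_localTerm_mem_tateAlgebra (φ : DrinfeldModule F r) (ψ : DrinfeldModule F l) (s : ℕ)
    (x : MonicIrred F →₀ (Fin n → ℕ)) : x.prod (localTerm φ ψ s) ∈ tateAlgebra F := by
  rw [prod_localTerm, div_eq_mul_inv, convDenom]
  exact (tateSubring F).mul_mem ((tateSubring F).mul_mem (thetaHom_mem_tateAlgebra _)
    (zHom_mem_tateAlgebra _)) (thetaHom_inv_mem_tateAlgebra _)

/-- For r < ℓ the ℓ-th exponent is padding, so no power of χ_ψ(f)⁻¹ f(z) appears, and the r-th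
exponents assemble to χ_φ(a_r). -/
lemma convTermLT_monicTuple (hr : 0 < r) (hφ : φ.EverywhereGoodReduction)
    (hψ : ψ.EverywhereGoodReduction) (hrl : r < l) (s : ℕ) (x : MonicIrred F →₀ (Fin r → ℕ)) :
    convTermLT φ ψ s (monicTuple x) = x.prod (localTerm φ ψ s) := by
  have h0 : ∀ k : Fin r → ℕ, zeroPad k (l - 1) = 0 := fun k => by
    rw [zeroPad, dif_neg (by omega)]
  rw [prod_localTerm, convTermLT, mu_monicTuple hr hφ, nu_monicTuple (by omega) hψ,
    chi_pad_monicTuple]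
  simp only [DrinfeldModule.muFactor, DrinfeldModule.nuFactor, h0, pow_zero, one_mul,
    Finset.prod_mul_distrib, map_mul, map_prod, map_pow]

/-- For ℓ < r the r-th exponent is padding, so χ_φ disappears, and the powers of χ_ψ(f)⁻¹ f(z)
assemble to the inverse character of a_ℓ times a_ℓ(z). -/
lemma convTermGT_monicTuple (hl : 0 < l) (hφ : φ.EverywhereGoodReduction)
    (hψ : ψ.EverywhereGoodReduction) (hrl : l < r) (s : ℕ) (x : MonicIrred F →₀ (Fin l → ℕ)) :
    convTermGT φ ψ s (monicTuple x) = x.prod (localTerm φ ψ s) := by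
  have h0 : ∀ k : Fin l → ℕ, zeroPad k (r - 1) = 0 := fun k => by
    rw [zeroPad, dif_neg (by omega)]
  have hC : ∀ c : F, zHom F (C c) = thetaHom F (C c) := fun c => by
    simp [zHom, thetaHom]
  rw [prod_localTerm, convTermGT, mu_monicTuple (by omega) hφ, nu_monicTuple hl hψ,
    chi_pad_monicTuple, pad_monicTuple]
  simp only [DrinfeldModule.muFactor, DrinfeldModule.nuFactor, h0, pow_zero, one_mul, mul_pow,
    Finset.prod_mul_distrib, map_mul, map_prod, map_pow, ← Finset.prod_inv_distrib, ← inv_pow, hC]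
  ring

/-- With W the total degree of the tuple, r times the degree of the numerator in θ is at most (r -
1) W, the denominator has degree at least W, and the factor in z has norm at most 1. Each term is
thus of size at most exp(-W/r). -/
lemma summable_prod_localTerm (hr : 0 < r) (hnr : n ≤ r) (hφ : φ.EverywhereGoodReduction)
    (ψ : DrinfeldModule F l) (s : ℕ) :
    Summable fun x : MonicIrred F →₀ (Fin n → ℕ) => x.prod (localTerm φ ψ s) := by
  refine summable_of_finite_setOf_lt_valuation fun D => ?_
  -- From W ≥ r D one gains W/r ≥ D in valuation; `toNat` covers negative D.
  refine (finite_setOf_sum_natDegree_lt (F := F) (n := n) (r * D.toNat)).subset fun x hx => ?_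
  rw [Set.mem_ofPred_eq]
  by_contra hlt
  rw [not_lt] at hlt
  refine hx ?_
  set M := ∏ f ∈ x.support, φ.muFactor f (zeroPad (x f)) with hM
  set Q := ∏ f ∈ x.support, localDenom s f (x f) with hQ
  have hQm : Q.Monic := monic_prod_of_monic _ _ fun f _ =>
    (f.2.1.pow _).mul ((f.2.1.pow _).pow _)
  set W := ∑ i, (monicTuple x i).1.natDegree with hW
  have hW' : W = ∑ f ∈ x.support, f.1.natDegree * ∑ i, x f i := by
    rw [hW]
    simp only [natDegree_monicTuple, Finset.mul_sum]
    exact Finset.sum_comm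
  have hQW : W ≤ Q.natDegree := by
    rw [hQ, hW', natDegree_prod_of_monic _ _ fun f _ => (f.2.1.pow _).mul ((f.2.1.pow _).pow _)]
    refine Finset.sum_le_sum fun f _ => ?_
    rw [localDenom, (f.2.1.pow _).natDegree_mul ((f.2.1.pow _).pow _), f.2.1.natDegree_pow, mul_comm]
    exact Nat.le_add_right _ _
  have hMW : r * M.natDegree ≤ (r - 1) * W := by
    calc r * M.natDegree ≤ r * ∑ f ∈ x.support, (φ.muFactor f (zeroPad (x f))).natDegree :=
          Nat.mul_le_mul_left _ (natDegree_prod_le _ _)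
      _ = ∑ f ∈ x.support, r * (φ.muFactor f (zeroPad (x f))).natDegree := Finset.mul_sum _ _ _
      _ ≤ ∑ f ∈ x.support, (r - 1) * (f.1.natDegree * ∑ i, x f i) := by
          refine Finset.sum_le_sum fun f _ => (natDegree_muFactor_le f hr hφ _).trans ?_
          rw [mul_left_comm]
          refine Nat.mul_le_mul_left _ ?_
          rw [← sum_zeroPad hnr, Finset.mul_sum]
          exact Finset.sum_le_sum fun i _ => Nat.mul_le_mul_right _ (by omega)
      _ = (r - 1) * W := by rw [hW', Finset.mul_sum]
  have hD : (D : ℤ) ≤ Q.natDegree - M.natDegree := by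
    obtain ⟨m, rfl⟩ : ∃ m, r = m + 1 := ⟨r - 1, by omega⟩
    rw [Nat.add_sub_cancel] at hMW
    have h1 : (m + 1) * (M.natDegree + D.toNat) ≤ (m + 1) * Q.natDegree := by
      calc _ = (m + 1) * M.natDegree + (m + 1) * D.toNat := by ring
        _ ≤ m * W + W := add_le_add hMW hlt
        _ = (m + 1) * W := by ring
        _ ≤ _ := Nat.mul_le_mul_left _ hQW
    have h2 := Nat.le_of_mul_le_mul_left h1 (Nat.succ_pos m)
    omega
  rw [prod_localTerm, convDenom_monicTuple, map_div₀, map_mul, valuation_thetaHom hQm.ne_zero]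
  have h1 : Valued.v (thetaHom F M) * Valued.v (zHom F (∏ f ∈ x.support, ψ.nuFactor f (zeroPad (x f)))) ≤
      WithZero.exp (M.natDegree : ℤ) := by
    have := mul_le_mul' (valuation_thetaHom_le M)
      (valuation_zHom_le (∏ f ∈ x.support, ψ.nuFactor f (zeroPad (x f))))
    rwa [mul_one] at this
  refine (div_le_div_of_nonneg_right h1 zero_le).trans ?_
  rw [← WithZero.exp_sub, WithZero.exp_le_exp]
  omega

end GlobalTerms

/-! ### Comparison of Euler factors with local sums -/

section EulerProduct

variable {F : Type*} [Field F] [Fintype F] {r l n : ℕ} {φ : DrinfeldModule F r}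
  {ψ : DrinfeldModule F l}

lemma thetaHomK_algebraMap (p : F[X]) :
    thetaHomK F (algebraMap F[X] (RatFunc F) p) = thetaHom F p := by
  exact RatFunc.liftRingHom_algebraMap _ (nonZeroDivisors_le_comap_nonZeroDivisors_of_injective _
    (thetaHom_injective F)) p

lemma thetaHom_irred_ne_zero (f : MonicIrred F) : thetaHom F f.1 ≠ 0 := fun h =>
  f.2.2.ne_zero (thetaHom_injective F (h.trans (map_zero _).symm))

lemma localTerm_eq (hr : 0 < r) (hl : 0 < l) (hnr : n ≤ r) (hφ : φ.EverywhereGoodReduction)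
    (hψ : ψ.EverywhereGoodReduction) (s : ℕ) (f : MonicIrred F) (k : Fin n → ℕ) :
    localTerm φ ψ s f k =
      schurSym r (zeroPad k) ((φ.frobPolyDual f).map (thetaHomK F)) *
        schurSym l (zeroPad k) ((ψ.frobPoly f).map (zHom F)) *
          (thetaHom F f.1 ^ s)⁻¹ ^ partSize k := by
  have hf := thetaHom_irred_ne_zero f
  have h := congrArg (thetaHomK F) (schurSym_frobPolyDual f hr hφ (zeroPad k))
  rw [map_mul, map_pow, thetaHomK_algebraMap, thetaHomK_algebraMap, sum_zeroPad hnr] at h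
  rw [← map_schurSym, ← map_schurSym, schurSym_frobPoly f hl hψ, localTerm, localDenom, ← h]
  simp only [map_mul, map_pow]
  rw [inv_pow, ← pow_mul, ← pow_mul, mul_comm s]
  field_simp

/-- Grouping the terms by the size of the partition gives the Cauchy series at T = f^{-s}; the
formal inverse relation with the reciprocal polynomial persists under this convergent evaluation. -/
lemma hasSum_localTerm (hr : 0 < r) (hl : 0 < l) (hφ : φ.EverywhereGoodReduction)
    (hψ : ψ.EverywhereGoodReduction) (hn : n = min r l) (s : ℕ) (f : MonicIrred F) :
    HasSum (fun k : Fin n → ℕ => localTerm φ ψ s f k) (eulerFactor φ ψ s f) := by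
  have hnr : n ≤ r := hn.trans_le (min_le_left _ _)
  have hsum : Summable fun k : Fin n → ℕ => localTerm φ ψ s f k := by
    -- Exponent families supported at f alone form a subfamily of the global sum, so the local sum
    -- inherits its summability.
    refine ((summable_prod_localTerm hr hnr hφ ψ s).comp_injective
      (Finsupp.single_injective f)).congr fun k => ?_
    exact Finsupp.prod_single_index (localTerm_zero hr hl hφ hψ s f)
  obtain ⟨hPm, hPn⟩ := frobPolyDual_monic f hr hφ
  obtain ⟨-, hQm, hQn, -⟩ := frobPoly_spec f hl hψ
  set P := (φ.frobPolyDual f).map (thetaHomK F) with hP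
  set Q := (ψ.frobPoly f).map (zHom F) with hQ
  have hPn' : P.natDegree = r := by rw [hP, hPm.natDegree_map, hPn]
  have hQn' : Q.natDegree = l := by rw [hQ, hQm.natDegree_map, hQn]
  set G : PowerSeries (KInfty F) := PowerSeries.mk fun M => ∑ j ∈ partsOfSize n M,
    schurSym r (zeroPad j) P * schurSym l (zeroPad j) Q with hG
  have hrev : ((convPolyDual φ ψ f).reverse : PowerSeries (KInfty F)) * G = 1 := by
    -- The Cauchy identity is stated with the shorter family of roots first; for ℓ ≤ r the factors
    -- of ⊗ are swapped.
    rcases le_total r l with h | h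
    · rw [min_eq_left h] at hn
      subst hn
      exact reverse_polyTensor_mul (hPm.map _) hPn' (hQm.map _) hQn' h
    · rw [min_eq_right h] at hn
      subst hn
      rw [convPolyDual, polyTensor_comm,
        ← reverse_polyTensor_mul (hQm.map (zHom F)) hQn' (hPm.map (thetaHomK F)) hPn' h, hG,
        schurSymSeries]
      simp only [mul_comm (schurSym r _ _)]
      rfl
  have hfib : HasSum (fun M => PowerSeries.coeff M G * (thetaHom F f.1 ^ s)⁻¹ ^ M)
      (∑' k : Fin n → ℕ, localTerm φ ψ s f k) := by
    have h1 := hsum.hasSum.tsum_fiberwise partSize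
    refine h1.congr_fun fun M => ?_
    have h2 : (partSize ⁻¹' {M} : Set (Fin n → ℕ)) = ↑(partsOfSize n M) := by
      ext k
      simp [mem_partsOfSize]
    rw [h2, Finset.tsum_subtype', hG, PowerSeries.coeff_mk, Finset.sum_mul]
    refine Finset.sum_congr rfl fun k hk => ?_
    rw [localTerm_eq hr hl hnr hφ hψ, mem_partsOfSize.1 hk]
  rw [eulerFactor, ← eq_inv_of_mul_eq_one_right (eval_mul_eq_one_of_hasSum hfib hrev)]
  exact hsum.hasSum

/-- The Euler product expands as a sum over families of exponents. -/
theorem hasProd_eulerFactor (hr : 0 < r) (hl : 0 < l) (hφ : φ.EverywhereGoodReduction)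
    (hψ : ψ.EverywhereGoodReduction) (hn : n = min r l) (s : ℕ) :
    Multipliable (eulerFactor φ ψ s) ∧ LEulerDual φ ψ s ∈ tateAlgebra F ∧
      HasSum (fun x : MonicIrred F →₀ (Fin n → ℕ) => x.prod (localTerm φ ψ s))
        (LEulerDual φ ψ s) := by
  have hs := (summable_prod_localTerm (n := n) hr (hn.trans_le (min_le_left _ _)) hφ ψ s).hasSum
  have hp := hasProd_of_summable (localTerm_zero hr hl hφ hψ s)
    (hasSum_localTerm hr hl hφ hψ hn s) hs
  rw [← hp.tprod_eq] at hs
  exact ⟨hp.multipliable, mem_tateAlgebra_of_hasSum hs (prod_localTerm_mem_tateAlgebra φ ψ s), hs⟩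

end EulerProduct

end DrinfeldConv

theorem theorem5 {F : Type*} [Field F] [Fintype F] {r l : ℕ} (hr : 2 ≤ r) (hl : 2 ≤ l)
    (hrl : r ≠ l) (φ : DrinfeldConv.DrinfeldModule F r) (ψ : DrinfeldConv.DrinfeldModule F l)
    (hφ : φ.EverywhereGoodReduction) (hψ : ψ.EverywhereGoodReduction) (s : ℕ) :
    Multipliable (DrinfeldConv.eulerFactor φ ψ s) ∧
    DrinfeldConv.LEulerDual φ ψ s ∈ DrinfeldConv.tateAlgebra F ∧
    (r < l → HasSum (DrinfeldConv.convTermLT φ ψ s) (DrinfeldConv.LEulerDual φ ψ s)) ∧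
    (l < r → HasSum (DrinfeldConv.convTermGT φ ψ s) (DrinfeldConv.LEulerDual φ ψ s)) := by
  have hr0 : 0 < r := by omega
  have hl0 : 0 < l := by omega
  rcases lt_or_gt_of_ne hrl with h | h
  · obtain ⟨h1, h2, h3⟩ :=
      DrinfeldConv.hasProd_eulerFactor hr0 hl0 hφ hψ (min_eq_left h.le).symm s
    refine ⟨h1, h2, fun _ => DrinfeldConv.monicTupleEquiv.hasSum_iff.1 ?_, fun h' => by omega⟩
    exact h3.congr_fun (DrinfeldConv.convTermLT_monicTuple hr0 hφ hψ h s)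
  · obtain ⟨h1, h2, h3⟩ :=
      DrinfeldConv.hasProd_eulerFactor hr0 hl0 hφ hψ (min_eq_right h.le).symm s
    refine ⟨h1, h2, fun h' => by omega, fun _ => DrinfeldConv.monicTupleEquiv.hasSum_iff.1 ?_⟩
    exact h3.congr_fun (DrinfeldConv.convTermGT_monicTuple hl0 hφ hψ h s)
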